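/- Let $V$ be a complex vector space of dimension $8$, let $L_0(V)$ be the space of linear operators on $V$ of trace $0$, and let $\delta\in\bigwedge^8V^*$ be non-zero. Embed $\bigwedge^4V$ in $V^{\otimes 4}$ by $v_1\wedge\dots\wedge v_4=\sum_\sigma(-1)^\sigma v_{\sigma(1)}\otimes\dots\otimes v_{\sigma(4)}$, and let $T^{ijkl}$ denote the components of $T\in\bigwedge^4V$ in a basis $e_1,\dots,e_8$ of $V$, with dual basis $e^1,\dots,e^8$. On $\mathfrak g=L_0(V)\oplus\bigwedge^4V$ define an antisymmetric bilinear bracket as follows (summing over repeated indices). For $A,B\in L_0(V)$ and $T,T_1,T_2\in\bigwedge^4V$: $$[A,B]=AB-BA,$$ $$[A,T]^{ijkl}=A^i_sT^{sjkl}+A^j_sT^{iskl}+A^k_sT^{ijsl}+A^l_sT^{ijks}=-[T,A]^{ijkl}$$ (the usual action of $L_0(V)$ on $\bigwedge^4V$), and $[T_1,T_2]\in L_0(V)$ is given by $$[T_1,T_2]^k_m=-\tfrac1{288}\,\delta_{p_1q_1r_1s_1p_2q_2r_2m}\bigl(T_1^{p_1q_1r_1s_1}T_2^{p_2q_2r_2k}-T_2^{p_1q_1r_1s_1}T_1^{p_2q_2r_2k}\bigr).$$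 Then the following hold. 1. With this bracket $\mathfrak g$ is a complex Lie algebra, graded modulo $2$ by $\mathfrak g_0=L_0(V)$, $\mathfrak g_1=\bigwedge^4V$. 2. Let $\mathfrak d\subset L_0(V)$ be the subalgebra of operators that are diagonal in the basis $e_1,\dots,e_8$, and let $\varepsilon_k\in\mathfrak d^*$ be given by $\varepsilon_k(\mathrm{diag}(c_1,\dots,c_8))=c_k$. The Lie algebra $\mathfrak g$ is simple of type $E_7$, $\mathfrak d$ is a Cartan subalgebra of it, and its root system relative to $\mathfrak d$ is $$\Sigma=\{\varepsilon_i-\varepsilon_j\ (i\ne j)\}\cup\{\varepsilon_i+\varepsilon_j+\varepsilon_k+\varepsilon_l\ (i,j,k,l\text{ pairwise distinct})\}.$$ For $A\in\mathfrak d$ one has $[A,e_i\otimes e^j]=(\varepsilon_i-\varepsilon_j)(A)\,e_i\otimes e^j$ and $[A,e_i\wedge e_j\wedge e_k\wedge e_l]=(\varepsilon_i+\varepsilon_j+\varepsilon_k+\varepsilon_l)(A)\,e_i\wedge e_j\wedge e_k\wedge e_l$, and the root spaces of $\varepsilon_i-\varepsilon_j$ and of $\varepsilon_i+\varepsilon_j+\varepsilon_k+\varepsilon_l$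 are the lines spanned by $e_i\otimes e^j$ and by $e_i\wedge e_j\wedge e_k\wedge e_l$ respectively. 3. The subalgebra $\mathfrak g_0=L_0(V)$ is simple of type $A_7$, $\mathfrak d$ is a Cartan subalgebra of it, and its root system relative to $\mathfrak d$ is $\{\varepsilon_i-\varepsilon_j\ (i\neq j)\}$. 4. Let $G$ be a connected Lie group whose Lie algebra is (isomorphic, as a real Lie algebra, to) $\mathfrak g$, and let $G_0\subset G$ be the connected subgroup that corresponds to the subalgebra $\mathfrak g_0$, i.e. the subgroup generated by $\exp(\mathfrak g_0)$. For every $T\in\mathfrak g_1=\bigwedge^4V$, the orbit of $T$ under the adjoint action of $G_0$ on $\mathfrak g$ is contained in $\mathfrak g_1$ and equals the orbit of $T$ under the natural action of $\mathrm{SL}(V)$ on $\bigwedge^4V$. -/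

import Mathlib

open scoped Manifold ContDiff

noncomputable section

namespace FourVector

attribute [local instance 100] LieRing.ofAssociativeRing

universe u

variable {V : Type u} [AddCommGroup V] [Module ℂ V]

/-- `L₀(V)`: the operators of trace `0`, with the commutator bracket. -/
def L₀ (V : Type u) [AddCommGroup V] [Module ℂ V] : LieSubalgebra ℂ (Module.End ℂ V) :=
  { LinearMap.ker (LinearMap.trace ℂ V) with
    lie_mem' := by
      intro A B _ _
      simp [LieRing.of_associative_ring_bracket, LinearMap.trace_mul_comm ℂ A B] }

theorem mem_L₀ {A : Module.End ℂ V} : A ∈ L₀ V ↔ LinearMap.trace ℂ V A = 0 := Iff.rfl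

/-- The alternating map
`(v₁, …, v₄) ↦ A v₁ ∧ v₂ ∧ v₃ ∧ v₄ + ⋯ + v₁ ∧ v₂ ∧ v₃ ∧ A v₄`. -/
def actionAlt (A : Module.End ℂ V) : V [⋀^Fin 4]→ₗ[ℂ] ⋀[ℂ]^4 V :=
  { ∑ a : Fin 4, (exteriorPower.ιMulti ℂ 4).toMultilinearMap.compLinearMap
      (Function.update (fun _ => LinearMap.id) a A) with
    map_eq_zero_of_eq' := by
      intro v i j hv hij
      have key : ∀ a : Fin 4,
          (fun b => Function.update (fun _ : Fin 4 => (LinearMap.id : V →ₗ[ℂ] V)) a A b (v b)) =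
            Function.update v a (A (v a)) := by
        intro a
        funext b
        by_cases h : b = a
        · subst h; simp
        · simp [h]
      have hsum : (∑ a : Fin 4, exteriorPower.ιMulti ℂ 4 (Function.update v a (A (v a)))) = 0 := by
        rw [Finset.sum_eq_add i j hij]
        · have hsw : Function.update v j (A (v j)) =
              Function.update v i (A (v i)) ∘ Equiv.swap i j := by
            funext b
            by_cases h1 : b = i
            · subst h1; simp [hij, hij.symm, hv]
            · by_cases h2 : b = j
              · subst h2; simp [hv]
              · simp [h1, h2, Equiv.swap_apply_of_ne_of_ne h1 h2]
          rw [hsw, AlternatingMap.map_swap _ _ hij, add_neg_cancel]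
        · intro a _ ha
          exact AlternatingMap.map_eq_zero_of_eq _ _
            (by simp [Function.update_of_ne ha.1.symm, Function.update_of_ne ha.2.symm, hv]) hij
        · intro h; exact absurd (Finset.mem_univ _) h
        · intro h; exact absurd (Finset.mem_univ _) h
      simpa [sum_apply, MultilinearMap.compLinearMap_apply, key] using hsum }

/-- The usual action of an operator `A` on `⋀⁴V` (by a derivation). -/
def action (A : Module.End ℂ V) : ⋀[ℂ]^4 V →ₗ[ℂ] ⋀[ℂ]^4 V :=
  exteriorPower.alternatingMapLinearEquiv (actionAlt A)

/-- The component `T^{ijkl}` of a four-vector with respect to the basis `e`, where `⋀⁴V` is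
embedded in `V ⊗ V ⊗ V ⊗ V` by `v₁ ∧ … ∧ v₄ = ∑_σ sign(σ) v_{σ1} ⊗ … ⊗ v_{σ4}`; that is,
`(v₁ ∧ … ∧ v₄)^{i₁…i₄} = det (e^{i_a}(v_b))`. -/
def component (e : Module.Basis (Fin 8) ℂ V) (T : ⋀[ℂ]^4 V) (i : Fin 4 → Fin 8) : ℂ :=
  exteriorPower.pairingDual ℂ V 4 (exteriorPower.ιMulti ℂ 4 fun a => e.coord (i a)) T

/-- The matrix `[T₁, T₂]^k_m` (row `k`, column `m`) of the bracket of two four-vectors. -/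
def bracketMatrix (e : Module.Basis (Fin 8) ℂ V) (δ : V [⋀^Fin 8]→ₗ[ℂ] ℂ) (T₁ T₂ : ⋀[ℂ]^4 V) :
    Matrix (Fin 8) (Fin 8) ℂ :=
  Matrix.of fun k m => -(1 / 288) * ∑ p : Fin 4 → Fin 8, ∑ q : Fin 3 → Fin 8,
    δ (fun a => e (![p 0, p 1, p 2, p 3, q 0, q 1, q 2, m] a)) *
      (component e T₁ p * component e T₂ ![q 0, q 1, q 2, k] -
        component e T₂ p * component e T₁ ![q 0, q 1, q 2, k])

theorem trace_bracketMatrix (e : Module.Basis (Fin 8) ℂ V) (δ : V [⋀^Fin 8]→ₗ[ℂ] ℂ)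
    (T₁ T₂ : ⋀[ℂ]^4 V) : (bracketMatrix e δ T₁ T₂).trace = 0 := by
  let D : (Fin 4 → Fin 8) → (Fin 4 → Fin 8) → ℂ := fun p q =>
    δ (fun a => e (![p 0, p 1, p 2, p 3, q 0, q 1, q 2, q 3] a))
  have hD : ∀ p q, D q p = D p q := by
    intro p q
    have h := δ.map_perm (fun a => e (![p 0, p 1, p 2, p 3, q 0, q 1, q 2, q 3] a))
      (finRotate 8 ^ 4)
    have hs : Equiv.Perm.sign (finRotate 8 ^ 4) = 1 := by
      rw [map_pow, sign_finRotate]; decide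
    rw [hs, one_smul] at h
    refine Eq.trans ?_ h
    change δ _ = δ _
    congr 1
    funext a
    fin_cases a <;> rfl
  have hsnoc : ∀ f : (Fin 4 → Fin 8) → ℂ,
      ∑ m : Fin 8, ∑ q : Fin 3 → Fin 8, f ![q 0, q 1, q 2, m] = ∑ q : Fin 4 → Fin 8, f q := by
    intro f
    rw [← Fintype.sum_prod_type', ← (Fin.snocEquiv (fun _ : Fin 4 => Fin 8)).sum_comp]
    refine Finset.sum_congr rfl fun x _ => congrArg f ?_
    funext a
    fin_cases a <;> rfl
  have hmain : ∑ m : Fin 8, ∑ p : Fin 4 → Fin 8, ∑ q : Fin 3 → Fin 8,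
      δ (fun a => e (![p 0, p 1, p 2, p 3, q 0, q 1, q 2, m] a)) *
        (component e T₁ p * component e T₂ ![q 0, q 1, q 2, m] -
          component e T₂ p * component e T₁ ![q 0, q 1, q 2, m]) = 0 := by
    rw [Finset.sum_comm]
    have h1 : ∀ p : Fin 4 → Fin 8, (∑ m : Fin 8, ∑ q : Fin 3 → Fin 8,
        δ (fun a => e (![p 0, p 1, p 2, p 3, q 0, q 1, q 2, m] a)) *
          (component e T₁ p * component e T₂ ![q 0, q 1, q 2, m] -
            component e T₂ p * component e T₁ ![q 0, q 1, q 2, m])) =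
        ∑ q : Fin 4 → Fin 8, D p q *
          (component e T₁ p * component e T₂ q - component e T₂ p * component e T₁ q) :=
      fun p => hsnoc fun q => D p q *
        (component e T₁ p * component e T₂ q - component e T₂ p * component e T₁ q)
    simp_rw [h1, mul_sub, Finset.sum_sub_distrib]
    rw [sub_eq_zero, Finset.sum_comm]
    refine Finset.sum_congr rfl fun q _ => Finset.sum_congr rfl fun p _ => ?_
    rw [hD]
    ring
  simp only [Matrix.trace, Matrix.diag, bracketMatrix, Matrix.of_apply]
  rw [← Finset.mul_sum, hmain, mul_zero]

/-- The bracket of two four-vectors, as an element of `L₀(V)`. -/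
def bracketFour (e : Module.Basis (Fin 8) ℂ V) (δ : V [⋀^Fin 8]→ₗ[ℂ] ℂ) (T₁ T₂ : ⋀[ℂ]^4 V) :
    L₀ V :=
  ⟨Matrix.toLin e e (bracketMatrix e δ T₁ T₂), by
    rw [mem_L₀, LinearMap.trace_eq_matrix_trace ℂ e, LinearMap.toMatrix_toLin,
      trace_bracketMatrix]⟩

/-- The vector space `𝔤 = L₀(V) ⊕ ⋀⁴V`; the parameters only serve to attach the bracket. -/
def 𝔤 (_e : Module.Basis (Fin 8) ℂ V) (_δ : V [⋀^Fin 8]→ₗ[ℂ] ℂ) : Type u := L₀ V × ⋀[ℂ]^4 V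

variable (e : Module.Basis (Fin 8) ℂ V) (δ : V [⋀^Fin 8]→ₗ[ℂ] ℂ)

instance : AddCommGroup (𝔤 e δ) := inferInstanceAs (AddCommGroup (L₀ V × ⋀[ℂ]^4 V))
instance : Module ℂ (𝔤 e δ) := inferInstanceAs (Module ℂ (L₀ V × ⋀[ℂ]^4 V))
instance : Module.Finite ℂ (𝔤 e δ) :=
  haveI : Module.Finite ℂ V := Module.Finite.of_basis e
  inferInstanceAs (Module.Finite ℂ (L₀ V × ⋀[ℂ]^4 V))

/-- The bracket of `𝔤`: the commutator on `L₀(V)`, the usual action of `L₀(V)` on `⋀⁴V` (so that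
`[A, T] = -[T, A]`), and `bracketFour` on `⋀⁴V`. -/
instance : Bracket (𝔤 e δ) (𝔤 e δ) where
  bracket x y := (⁅x.1, y.1⁆ + bracketFour e δ x.2 y.2, action x.1 y.2 - action y.1 x.2)

/-- The inclusion of the summand `L₀(V)`. -/
def inl : L₀ V →ₗ[ℂ] 𝔤 e δ := LinearMap.inl ℂ (L₀ V) (⋀[ℂ]^4 V)

/-- The inclusion of the summand `⋀⁴V`. -/
def inr : ⋀[ℂ]^4 V →ₗ[ℂ] 𝔤 e δ := LinearMap.inr ℂ (L₀ V) (⋀[ℂ]^4 V)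

theorem lie_inl_inl (A B : L₀ V) : ⁅inl e δ A, inl e δ B⁆ = inl e δ ⁅A, B⁆ := by
  have h : bracketFour e δ 0 0 = 0 := by
    apply Subtype.ext
    have h0 : bracketMatrix e δ 0 0 = 0 := by
      ext k m
      simp [bracketMatrix, component]
    simp [bracketFour, h0]
  change ((⁅A, B⁆ + bracketFour e δ 0 0, action A.1 0 - action B.1 0) : L₀ V × ⋀[ℂ]^4 V) =
    (⁅A, B⁆, 0)
  rw [h]
  simp

/-- The bracket of `𝔤` satisfies the axioms of a complex Lie algebra: it is bilinear, alternating
and satisfies the Jacobi identity. -/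
class IsLieBracket : Prop where
  add_lie : ∀ x y z : 𝔤 e δ, ⁅x + y, z⁆ = ⁅x, z⁆ + ⁅y, z⁆
  lie_add : ∀ x y z : 𝔤 e δ, ⁅x, y + z⁆ = ⁅x, y⁆ + ⁅x, z⁆
  lie_smul : ∀ (c : ℂ) (x y : 𝔤 e δ), ⁅x, c • y⁆ = c • ⁅x, y⁆
  lie_self : ∀ x : 𝔤 e δ, ⁅x, x⁆ = 0
  jacobi : ∀ x y z : 𝔤 e δ, ⁅x, ⁅y, z⁆⁆ = ⁅⁅x, y⁆, z⁆ + ⁅y, ⁅x, z⁆⁆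

instance [h : IsLieBracket e δ] : LieRing (𝔤 e δ) where
  add_lie := h.add_lie
  lie_add := h.lie_add
  lie_self := h.lie_self
  leibniz_lie := h.jacobi

instance [h : IsLieBracket e δ] : LieAlgebra ℂ (𝔤 e δ) where
  lie_smul := h.lie_smul

/-- The components of the grading modulo `2`: `𝔤₀ = L₀(V)` and `𝔤₁ = ⋀⁴V`. -/
def grading (k : ZMod 2) : Submodule ℂ (𝔤 e δ) :=
  if k = 0 then LinearMap.range (inl e δ) else LinearMap.range (inr e δ)

/-- The operators of trace `0` that are diagonal in the basis `e`, as a subalgebra of `L₀(V)`. -/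
def diag : LieSubalgebra ℂ (L₀ V) where
  carrier := {A | (LinearMap.toMatrix e e (A : Module.End ℂ V)).IsDiag}
  zero_mem' := by simp
  add_mem' := by
    intro A B hA hB
    simpa using Matrix.IsDiag.add hA hB
  smul_mem' := by
    intro c A hA
    simpa using Matrix.IsDiag.smul c hA
  lie_mem' := by
    intro A B hA hB
    simp only [Set.mem_ofPred_eq] at hA hB ⊢
    rw [LieSubalgebra.coe_bracket, LieRing.of_associative_ring_bracket, map_sub,
      LinearMap.toMatrix_mul, LinearMap.toMatrix_mul, ← hA.diagonal_diag, ← hB.diagonal_diag,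
      Matrix.diagonal_mul_diagonal, Matrix.diagonal_mul_diagonal]
    exact (Matrix.isDiag_diagonal _).sub (Matrix.isDiag_diagonal _)

/-- The functional `ε_k (diag(c₁, …, c₈)) = c_k`. -/
def ε₀ (k : Fin 8) : Module.Dual ℂ (diag e) where
  toFun A := LinearMap.toMatrix e e (A : Module.End ℂ V) k k
  map_add' A B := by simp
  map_smul' c A := by simp

/-- The diagonal subalgebra `𝔡`, inside `𝔤`. -/
def 𝔡 [IsLieBracket e δ] : LieSubalgebra ℂ (𝔤 e δ) :=
  { (diag e).toSubmodule.map (inl e δ) with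
    lie_mem' := by
      rintro _ _ ⟨A, hA, rfl⟩ ⟨B, hB, rfl⟩
      exact ⟨⁅A, B⁆, (diag e).lie_mem hA hB, (lie_inl_inl e δ A B).symm⟩ }

/-- The functional `ε_k` on `𝔡 ⊆ 𝔤`. -/
def ε [IsLieBracket e δ] (k : Fin 8) : Module.Dual ℂ (𝔡 e δ) where
  toFun A := LinearMap.toMatrix e e ((A : 𝔤 e δ).1 : Module.End ℂ V) k k
  map_add' A B := by
    change LinearMap.toMatrix e e (((A : 𝔤 e δ).1 : Module.End ℂ V) + (B : 𝔤 e δ).1) k k = _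
    simp
  map_smul' c A := by
    change LinearMap.toMatrix e e (c • ((A : 𝔤 e δ).1 : Module.End ℂ V)) k k = _
    simp

/-- The element `e_i ⊗ e^j` of `L₀(V)`, for `i ≠ j`. -/
def matrixUnit (i j : Fin 8) (hij : i ≠ j) : L₀ V :=
  ⟨(e.coord j).smulRight (e i), by
    have : Module.Finite ℂ V := Module.Finite.of_basis e
    have : Module.Free ℂ V := Module.Free.of_basis e
    rw [mem_L₀, LinearMap.trace_smulRight]
    simp [hij]⟩

/-- The four-vector `e_i ∧ e_j ∧ e_k ∧ e_l`. -/
def wedge (i : Fin 4 → Fin 8) : ⋀[ℂ]^4 V := exteriorPower.ιMulti ℂ 4 fun a => e (i a)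

/-- The root system of the semisimple Lie algebra `L` with respect to the Cartan subalgebra `H`
has Cartan matrix `C` (for some base and some numbering of it). -/
def HasCartanMatrix {L : Type*} [LieRing L] [LieAlgebra ℂ L] [FiniteDimensional ℂ L]
    [LieAlgebra.IsKilling ℂ L] (H : LieSubalgebra ℂ L) [H.IsCartanSubalgebra]
    {n : ℕ} (C : Matrix (Fin n) (Fin n) ℤ) : Prop :=
  ∃ (b : (LieAlgebra.IsKilling.rootSystem H).Base) (f : b.support ≃ Fin n),
    b.cartanMatrix.reindex f f = C

section LieGroup

variable {E : Type*} [NormedAddCommGroup E] [NormedSpace ℝ E]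
  {G : Type*} [TopologicalSpace G] [ChartedSpace E G] [Group G]

/-- The adjoint representation of a Lie group: `Ad g` is the differential at `1` of the
conjugation `x ↦ g x g⁻¹`, whose value lies in the tangent space at `g 1 g⁻¹ = 1`. -/
def Ad (g : G) (x : GroupLieAlgebra 𝓘(ℝ, E) G) : GroupLieAlgebra 𝓘(ℝ, E) G :=
  mfderiv 𝓘(ℝ, E) 𝓘(ℝ, E) (fun y : G => g * y * g⁻¹) 1 x

/-- `γ` is a one-parameter subgroup of `G` with initial velocity `x`, i.e. `γ t = exp (t x)`.
The velocity at `0` lies in the tangent space at `γ 0 = 1`. -/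
structure IsOneParameterSubgroup (γ : ℝ → G) (x : GroupLieAlgebra 𝓘(ℝ, E) G) : Prop where
  map_add : ∀ s t, γ (s + t) = γ s * γ t
  contMDiff : ContMDiff 𝓘(ℝ, ℝ) 𝓘(ℝ, E) ∞ γ
  velocity : mfderiv 𝓘(ℝ, ℝ) 𝓘(ℝ, E) γ 0 (1 : ℝ) = x

/-- The connected subgroup of `G` that corresponds to the subalgebra `𝔥` of its Lie algebra: the
subgroup generated by the exponentials of the elements of `𝔥`. -/
def connectedSubgroup (𝔥 : Set (GroupLieAlgebra 𝓘(ℝ, E) G)) : Subgroup G :=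
  Subgroup.closure {g | ∃ x ∈ 𝔥, ∃ γ : ℝ → G, IsOneParameterSubgroup γ x ∧ γ 1 = g}

end LieGroup

end FourVector

end

open FourVector

/-!
**The Jacobi identity.** The bracket of two four-vectors is equivariant under `L₀(V)`, which settles
all triples but those of three four-vectors. On these the jacobiator is alternating and again
equivariant. Matrix units carry basis four-vectors to basis four-vectors or to `0`, so by induction
on the number of differing indices the jacobiator vanishes once it does on a few reference triples.
There one uses that `[v₁ ∧ ⋯ ∧ v₄, w₁ ∧ ⋯ ∧ w₄]` is zero if two of the `v`s recur among the `w`s,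
and multiplies the `v`s by `½ δ(v, w)` and the `w`s by `-½ δ(v, w)`.

**Simplicity and roots.** Bracketing twice with matrix units turns a non-zero element of an ideal
into a single matrix unit, and then into everything. The coordinates in the basis of matrix units
and basis four-vectors are semi-invariants of `𝔡` with non-zero weights, which makes `𝔡` a Cartan
subalgebra and bounds its roots; explicit `𝔰𝔩₂`-triples give the coroots of a set of simple roots
and hence the Cartan matrix.

**Orbits.** If `γ` is the one-parameter subgroup of `x`, then `y = Ad (γ t) y₀` solves
`y' = [x, y]`. For `x` in `𝔤₀` and `y₀` in `𝔤₁` the solution is the flow of `x` on four-vectors,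
which is induced by the flow of `x` in `SL(V)`. Conversely `SL(V)` is generated by transvections and
by diagonal operators of determinant one, and both lie on such flows.
-/

noncomputable section

namespace FourVector

attribute [local instance 100] LieRing.ofAssociativeRing

universe u

variable {V : Type u} [AddCommGroup V] [Module ℂ V]

/-! ### Alternating maps and exterior powers -/

section Alternating

variable {R M N ι κ : Type*} [CommRing R] [AddCommGroup M] [Module R M] [AddCommGroup N]
  [Module R N]

/-- The interior product of an alternating map in `ι ⊕ κ` arguments with the family `v` of its
first `ι` arguments. -/
def interiorProduct (f : M [⋀^ι ⊕ κ]→ₗ[R] N) (v : ι → M) : M [⋀^κ]→ₗ[R] N :=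
  { f.toMultilinearMap.currySum v with
    map_eq_zero_of_eq' := fun w _ _ h hij =>
      f.map_eq_zero_of_eq (Sum.elim v w) (i := Sum.inr _) (j := Sum.inr _) h
        (Sum.inr_injective.ne hij) }

theorem interiorProduct_apply (f : M [⋀^ι ⊕ κ]→ₗ[R] N) (v : ι → M) (w : κ → M) :
    interiorProduct f v w = f (Sum.elim v w) := rfl

theorem interiorProduct_domDomCongr_sumComm_apply (f : M [⋀^ι ⊕ κ]→ₗ[R] N) (v : ι → M)
    (w : κ → M) :
    interiorProduct (f.domDomCongr (Equiv.sumComm ι κ)) w v = f (Sum.elim v w) := by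
  rw [interiorProduct_apply, AlternatingMap.domDomCongr_apply]
  congr 1
  ext (a | a) <;> rfl

section Derivation

variable [DecidableEq ι]

theorem update_id_apply (A : M →ₗ[R] M) (v : ι → M) (a : ι) :
    (fun b => Function.update (fun _ => LinearMap.id) a A b (v b)) =
      Function.update v a (A (v a)) := by
  ext b
  obtain rfl | h := eq_or_ne b a <;> simp [*]

theorem sum_update_eq_zero_of_eq [Fintype ι] (f : M [⋀^ι]→ₗ[R] N) (A : M →ₗ[R] M) {v : ι → M}
    {i j : ι} (h : v i = v j) (hij : i ≠ j) :
    ∑ a, f (Function.update v a (A (v a))) = 0 := by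
  rw [Fintype.sum_eq_add i j hij]
  · have hswap : Function.update v j (A (v j)) =
        Function.update v i (A (v i)) ∘ Equiv.swap i j := by
      rw [Equiv.comp_swap_eq_update, Function.update_self, Function.update_of_ne hij.symm, ← h,
        Function.update_comm hij, Function.update_idem, Function.update_comm hij.symm,
        Function.update_eq_self]
    rw [hswap, f.map_swap _ hij, add_neg_cancel]
  · rintro a ⟨hai, haj⟩
    refine f.map_eq_zero_of_eq _ ?_ hij
    rwa [Function.update_of_ne hai.symm, Function.update_of_ne haj.symm]

/-- The action of an endomorphism `A` on alternating maps by a derivation: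
`u ↦ ∑ c, f (u₁, …, A u_c, …, u_n)`. -/
def derivation [Fintype ι] (f : M [⋀^ι]→ₗ[R] N) (A : M →ₗ[R] M) : M [⋀^ι]→ₗ[R] N :=
  { ∑ c : ι, f.toMultilinearMap.compLinearMap (Function.update (fun _ => LinearMap.id) c A) with
    map_eq_zero_of_eq' := fun v i j h hij => by
      simpa [update_id_apply] using sum_update_eq_zero_of_eq f A h hij }

theorem derivation_apply [Fintype ι] (f : M [⋀^ι]→ₗ[R] N) (A : M →ₗ[R] M) (u : ι → M) :
    derivation f A u = ∑ c, f (Function.update u c (A (u c))) := by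
  simp_rw [← update_id_apply A u]
  change (∑ c : ι, f.toMultilinearMap.compLinearMap _) u = _
  rw [sum_apply]
  rfl

theorem map_update_basis [Finite ι] (e : Module.Basis ι R M) (f : M [⋀^ι]→ₗ[R] N) (c : ι)
    (x : M) : f (Function.update e c x) = e.coord c x • f e := by
  have := Fintype.ofFinite ι
  conv_lhs => rw [← e.sum_repr x]
  rw [f.map_update_sum, Fintype.sum_eq_single c]
  · rw [f.map_update_smul, Function.update_eq_self, e.coord_apply]
  · intro j hj
    rw [f.map_update_smul, f.map_update_self _ hj.symm, smul_zero]

theorem derivation_eq_trace_smul [Fintype ι] (e : Module.Basis ι R M) (f : M [⋀^ι]→ₗ[R] N)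
    (A : M →ₗ[R] M) : derivation f A = LinearMap.trace R M A • f := by
  refine e.ext_alternating fun σ hσ => ?_
  let τ : ι ≃ ι := Equiv.ofBijective σ hσ.bijective_of_finite
  have hτ : (fun i => e (σ i)) = e.reindex τ.symm := by
    ext i
    rw [e.reindex_apply, Equiv.symm_symm]
    rfl
  rw [hτ, derivation_apply, AlternatingMap.smul_apply,
    LinearMap.trace_eq_matrix_trace R (e.reindex τ.symm), Matrix.trace, Finset.sum_smul]
  refine Finset.sum_congr rfl fun c _ => ?_
  rw [map_update_basis, Matrix.diag_apply, LinearMap.toMatrix_apply, Module.Basis.coord_apply]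

theorem derivation_derivation_sub [Fintype ι] (f : M [⋀^ι]→ₗ[R] N) (A B : M →ₗ[R] M) :
    derivation (derivation f A) B - derivation (derivation f B) A =
      derivation f (A ∘ₗ B - B ∘ₗ A) := by
  ext v
  simp only [AlternatingMap.sub_apply, derivation_apply]
  rw [Finset.sum_comm, ← Finset.sum_sub_distrib]
  refine Finset.sum_congr rfl fun a _ => ?_
  rw [← Finset.sum_sub_distrib, Fintype.sum_eq_single a]
  · simp [f.map_update_sub]
  · intro b hb
    simp [hb, hb.symm, Function.update_comm hb]

theorem sum_interiorProduct_update [Fintype ι] [Fintype κ] [DecidableEq κ]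
    (f : M [⋀^ι ⊕ κ]→ₗ[R] N)
    (A : M →ₗ[R] M) (v : ι → M) :
    ∑ a, interiorProduct f (Function.update v a (A (v a))) =
      interiorProduct (derivation f A) v - derivation (interiorProduct f v) A := by
  ext w
  simp only [AlternatingMap.sub_apply, interiorProduct_apply, derivation_apply,
    Fintype.sum_sum_type, Sum.elim_inl, Sum.elim_inr, Sum.update_elim_inl, Sum.update_elim_inr,
    add_sub_cancel_right]
  change AlternatingMap.toMultilinearMapLM (S := R) (∑ a, _) w = _
  rw [map_sum, sum_apply]
  rfl

end Derivation

section Contract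

variable [Fintype κ] [DecidableEq κ]

/-- The operator `x ↦ ∑ b, f (w₁, …, x, …, w_n) w_b`, with `x` in place `b`, as a function of the
alternating form `f`. It is `f` contracted with `w₁ ∧ ⋯ ∧ w_n` in all arguments but one. -/
def contract (w : κ → M) : (M [⋀^κ]→ₗ[R] R) →ₗ[R] Module.End R M where
  toFun f := ∑ b, (f.toMultilinearMap.toLinearMap w b).smulRight (w b)
  map_add' f g := by ext; simp [add_smul, Finset.sum_add_distrib]
  map_smul' c f := by ext; simp [mul_smul, Finset.smul_sum]

theorem contract_apply (w : κ → M) (f : M [⋀^κ]→ₗ[R] R) (x : M) :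
    contract w f x = ∑ b, f (Function.update w b x) • w b := by
  simp [contract]

theorem sum_contract_update (A : Module.End R M) (w : κ → M) (f : M [⋀^κ]→ₗ[R] R) :
    ∑ c, contract (Function.update w c (A (w c))) f =
      A * contract w f - contract w f * A + contract w (derivation f A) := by
  ext x
  simp only [LinearMap.add_apply, LinearMap.sub_apply, LinearMap.sum_apply,
    Module.End.mul_apply, contract_apply, derivation_apply, map_sum, map_smul]
  rw [Finset.sum_comm, ← sub_eq_iff_eq_add, ← Finset.sum_sub_distrib, ← Finset.sum_sub_distrib]
  refine Finset.sum_congr rfl fun b _ => ?_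
  rw [Finset.sum_smul, ← Finset.sum_sub_distrib, Fintype.sum_eq_single b]
  · simp
  · intro c hc
    simp [hc, hc.symm, Function.update_comm hc]

end Contract

section Components

open Module

variable [Fintype κ]

theorem apply_eq_sum_basis [Fintype ι] [DecidableEq ι] (e : Basis κ R M)
    (f : MultilinearMap R (fun _ : ι => M) N) (v : ι → M) :
    f v = ∑ p : ι → κ, (∏ i, e.coord (p i) (v i)) • f (e ∘ p) := by
  have h : v = fun i => ∑ j, e.coord j (v i) • e j := funext fun i => (e.sum_repr (v i)).symm
  conv_lhs => rw [h, MultilinearMap.map_sum]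
  exact Finset.sum_congr rfl fun p _ => f.map_smul_univ _ _

theorem sum_det_submatrix_smul [Fintype ι] [DecidableEq ι] (e : Basis κ R M)
    (f : M [⋀^ι]→ₗ[R] N) (v : ι → M) :
    ∑ p : ι → κ, ((e.toMatrix v).submatrix p id).det • f (e ∘ p) =
      (Fintype.card ι).factorial • f v := by
  have h (σ : Equiv.Perm ι) : ∑ p : ι → κ, (Equiv.Perm.sign σ •
      ∏ i, (e.toMatrix v).submatrix p id i (σ i)) • f (e ∘ p) = f v := by
    have hσ := apply_eq_sum_basis e f.toMultilinearMap (v ∘ σ)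
    rw [AlternatingMap.coe_multilinearMap, f.map_perm] at hσ
    simp_rw [smul_assoc, ← Finset.smul_sum]
    refine (smul_eq_iff_eq_inv_smul _).2 ?_
    rw [Int.units_inv_eq_self, hσ]
    rfl
  simp_rw [← Matrix.det_transpose ((e.toMatrix v).submatrix _ _), Matrix.det_apply,
    Matrix.transpose_apply, Finset.sum_smul]
  rw [Finset.sum_comm, Fintype.sum_congr _ _ h, Finset.sum_const, Finset.card_univ,
    Fintype.card_perm]

theorem map_snoc_eq {n : ℕ} (f : M [⋀^Fin (n + 1)]→ₗ[R] N) (v : Fin n → M) (x : M) :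
    f (Fin.snoc v x : Fin (n + 1) → M) = (-1) ^ n • f.curryLeft x v := by
  have h := f.map_insertNth (Fin.last n) x v
  rwa [Fin.insertNth_last', Fin.val_last] at h

theorem map_update_eq_curryLeft_removeNth {n : ℕ} (f : M [⋀^Fin (n + 1)]→ₗ[R] N)
    (w : Fin (n + 1) → M) (b : Fin (n + 1)) (x : M) :
    f (Function.update w b x) = (-1) ^ (b : ℕ) • f.curryLeft x (b.removeNth w) := by
  rw [← Fin.insertNth_removeNth]
  exact f.map_insertNth b x _

theorem sum_det_submatrix_snoc_smul {n : ℕ} (e : Basis κ R M) (f : M [⋀^Fin (n + 1)]→ₗ[R] N)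
    (w : Fin (n + 1) → M) (k : κ) (x : M) :
    ∑ q : Fin n → κ, ((e.toMatrix w).submatrix (Fin.snoc q k : Fin (n + 1) → κ) id).det •
        f (Fin.snoc (e ∘ q) x : Fin (n + 1) → M) =
      n.factorial • ∑ b, e.coord k (w b) • f (Function.update w b x) := by
  have hdet (q : Fin n → κ) :
      ((e.toMatrix w).submatrix (Fin.snoc q k : Fin (n + 1) → κ) id).det =
        ∑ b : Fin (n + 1), (-1) ^ (n + b : ℕ) * e.coord k (w b) *
          ((e.toMatrix (b.removeNth w)).submatrix q id).det := by
    rw [Matrix.det_succ_row _ (Fin.last n)]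
    refine Finset.sum_congr rfl fun b _ => ?_
    congr 2
    · simp [Basis.toMatrix_apply]
    · ext i j
      simp [Basis.toMatrix_apply, Fin.removeNth]
  simp_rw [hdet, Finset.sum_smul, map_snoc_eq]
  rw [Finset.sum_comm, Finset.smul_sum]
  refine Finset.sum_congr rfl fun b _ => ?_
  have h := sum_det_submatrix_smul e (f.curryLeft x) (b.removeNth w)
  rw [Fintype.card_fin] at h
  rw [map_update_eq_curryLeft_removeNth, smul_comm _ ((-1) ^ (b : ℕ)), smul_comm n.factorial,
    smul_comm n.factorial, ← h, Finset.smul_sum, Finset.smul_sum]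
  refine Finset.sum_congr rfl fun q _ => ?_
  rcases n.even_or_odd with hn | hn <;> rcases (b : ℕ).even_or_odd with hb | hb <;>
    simp [hn, hb, pow_add, mul_smul]

end Components

end Alternating

section Volume

variable (e : Module.Basis (Fin 8) ℂ V) (δ : V [⋀^Fin 8]→ₗ[ℂ] ℂ)

/-- The volume form `δ` as a function of two quadruples of vectors. -/
def vol : V [⋀^Fin 4 ⊕ Fin 4]→ₗ[ℂ] ℂ :=
  δ.domDomCongr (finSumFinEquiv (m := 4) (n := 4)).symm

theorem vol_apply (v w : Fin 4 → V) :
    vol δ (Sum.elim v w) = δ ![v 0, v 1, v 2, v 3, w 0, w 1, w 2, w 3] := by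
  refine congrArg δ (funext fun a => ?_)
  fin_cases a <;> rfl

theorem vol_comm (v w : Fin 4 → V) : vol δ (Sum.elim w v) = vol δ (Sum.elim v w) := by
  have hsign : Equiv.Perm.sign (Equiv.sumComm (Fin 4) (Fin 4)) = 1 := by decide
  have h := (vol δ).map_perm (Sum.elim v w) (Equiv.sumComm (Fin 4) (Fin 4))
  rw [hsign, one_smul] at h
  rw [← h]
  congr 1
  ext (a | a) <;> rfl

variable {δ}

theorem component_ιMulti (v : Fin 4 → V) (i : Fin 4 → Fin 8) :
    component e (exteriorPower.ιMulti ℂ 4 v) i = ((e.toMatrix v).submatrix i id).det := by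
  rw [← Matrix.det_transpose]
  exact exteriorPower.pairingDual_ιMulti_ιMulti _ _

theorem sum_vol_mul_component (v w : Fin 4 → V) (k m : Fin 8) :
    ∑ p : Fin 4 → Fin 8, ∑ q : Fin 3 → Fin 8,
      δ (fun a => e (![p 0, p 1, p 2, p 3, q 0, q 1, q 2, m] a)) *
        (component e (exteriorPower.ιMulti ℂ 4 v) p *
          component e (exteriorPower.ιMulti ℂ 4 w) ![q 0, q 1, q 2, k]) =
      144 * ∑ b : Fin 4, vol δ (Sum.elim v (Function.update w b (e m))) * e.coord k (w b) := by
  have hδ (p : Fin 4 → Fin 8) (q : Fin 3 → Fin 8) :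
      δ (fun a => e (![p 0, p 1, p 2, p 3, q 0, q 1, q 2, m] a)) =
        vol δ (Sum.elim (e ∘ p) (Fin.snoc (e ∘ q) (e m) : Fin 4 → V)) := by
    rw [vol_apply]
    refine congrArg δ (funext fun a => ?_)
    fin_cases a <;> rfl
  have hk (q : Fin 3 → Fin 8) : ![q 0, q 1, q 2, k] = (Fin.snoc q k : Fin 4 → Fin 8) := by
    ext a
    fin_cases a <;> rfl
  have hp (x : Fin 4 → V) : ∑ p : Fin 4 → Fin 8, vol δ (Sum.elim (e ∘ p) x) *
      ((e.toMatrix v).submatrix p id).det = 24 * vol δ (Sum.elim v x) := by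
    have h := sum_det_submatrix_smul e
      (interiorProduct ((vol δ).domDomCongr (Equiv.sumComm _ _)) x) v
    simpa [interiorProduct_domDomCongr_sumComm_apply, Nat.factorial, mul_comm] using h
  have hq := sum_det_submatrix_snoc_smul e (interiorProduct (vol δ) v) w k (e m)
  simp only [interiorProduct_apply, smul_eq_mul, Nat.factorial, nsmul_eq_mul] at hq
  rw [Finset.sum_comm]
  simp_rw [hδ, hk, component_ιMulti, ← mul_assoc, ← Finset.sum_mul, hp, mul_assoc,
    ← Finset.mul_sum, mul_comm (vol δ _) (Matrix.det _), hq, mul_comm (e.coord k _)]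
  push_cast
  ring

end Volume

/-! ### The bracket of two four-vectors -/

section BracketFour

variable (e : Module.Basis (Fin 8) ℂ V) (δ : V [⋀^Fin 8]→ₗ[ℂ] ℂ)

/-- The operator `x ↦ ∑ b, δ (v₁, …, v₄, w₁, …, x, …, w₄) w_b`, with `x` in place of `w_b`; up to
a factor, the first of the two terms of `[v₁ ∧ ⋯ ∧ v₄, w₁ ∧ ⋯ ∧ w₄]`. -/
def contraction (v w : Fin 4 → V) : Module.End ℂ V :=
  contract w (interiorProduct (vol δ) v)

theorem contraction_apply (v w : Fin 4 → V) (x : V) :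
    contraction δ v w x = ∑ b, vol δ (Sum.elim v (Function.update w b x)) • w b :=
  contract_apply _ _ _

theorem toMatrix_bracketFour (T U : ⋀[ℂ]^4 V) :
    LinearMap.toMatrix e e (bracketFour e δ T U : Module.End ℂ V) = bracketMatrix e δ T U :=
  LinearMap.toMatrix_toLin ..

theorem coe_bracketFour_ιMulti (v w : Fin 4 → V) :
    (bracketFour e δ (exteriorPower.ιMulti ℂ 4 v) (exteriorPower.ιMulti ℂ 4 w) : Module.End ℂ V) =
      -(1 / 2 : ℂ) • (contraction δ v w - contraction δ w v) := by
  refine (LinearMap.toMatrix e e).injective ?_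
  ext k m
  have hvw := sum_vol_mul_component e (δ := δ) v w k m
  have hwv := sum_vol_mul_component e (δ := δ) w v k m
  rw [toMatrix_bracketFour]
  simp only [LinearMap.toMatrix_apply, bracketMatrix, Matrix.of_apply, mul_sub,
    Finset.sum_sub_distrib, hvw, hwv, LinearMap.smul_apply,
    LinearMap.sub_apply, contraction_apply, map_smul, map_sub, map_sum, Finsupp.smul_apply,
    Finsupp.sub_apply, Finset.sum_apply', smul_eq_mul, e.coord_apply]
  ring

theorem bracketFour_skew (T U : ⋀[ℂ]^4 V) : bracketFour e δ T U = -bracketFour e δ U T := by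
  have h : bracketMatrix e δ T U = -bracketMatrix e δ U T := by
    ext k m
    simp only [bracketMatrix, Matrix.of_apply, Matrix.neg_apply, ← mul_neg,
      ← Finset.sum_neg_distrib, neg_sub]
  exact Subtype.ext (by simp [bracketFour, h])

theorem bracketFour_self (T : ⋀[ℂ]^4 V) : bracketFour e δ T T = 0 := by
  have h : bracketMatrix e δ T T = 0 := by
    ext k m
    simp [bracketMatrix]
  exact Subtype.ext (by simp [bracketFour, h])

theorem bracketFour_add_left (S T U : ⋀[ℂ]^4 V) :
    bracketFour e δ (S + T) U = bracketFour e δ S U + bracketFour e δ T U := by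
  have h : bracketMatrix e δ (S + T) U = bracketMatrix e δ S U + bracketMatrix e δ T U := by
    ext k m
    simp only [bracketMatrix, component, map_add, Matrix.of_apply, Matrix.add_apply, ← mul_add,
      ← Finset.sum_add_distrib]
    congr! 4
    ring
  exact Subtype.ext (by simp [bracketFour, h])

theorem bracketFour_smul_left (c : ℂ) (T U : ⋀[ℂ]^4 V) :
    bracketFour e δ (c • T) U = c • bracketFour e δ T U := by
  have h : bracketMatrix e δ (c • T) U = c • bracketMatrix e δ T U := by
    ext k m
    simp only [bracketMatrix, component, map_smul, Matrix.of_apply, Matrix.smul_apply,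
      smul_eq_mul, Finset.mul_sum]
    refine Finset.sum_congr rfl fun p _ => Finset.sum_congr rfl fun q _ => ?_
    ring
  exact Subtype.ext (by simp [bracketFour, h])

/-- The bracket of four-vectors as a bilinear map. -/
def bracketBilin : ⋀[ℂ]^4 V →ₗ[ℂ] ⋀[ℂ]^4 V →ₗ[ℂ] L₀ V :=
  LinearMap.mk₂ ℂ (bracketFour e δ) (bracketFour_add_left e δ) (bracketFour_smul_left e δ)
    (fun S T U => by
      rw [bracketFour_skew, bracketFour_add_left, neg_add, ← bracketFour_skew,
        ← bracketFour_skew])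
    (fun c T U => by
      rw [bracketFour_skew, bracketFour_smul_left, ← smul_neg, ← bracketFour_skew])

@[simp] theorem bracketBilin_apply (T U : ⋀[ℂ]^4 V) :
    bracketBilin e δ T U = bracketFour e δ T U := rfl

end BracketFour

section Action

theorem action_ιMulti (A : Module.End ℂ V) (v : Fin 4 → V) :
    action A (exteriorPower.ιMulti ℂ 4 v) = derivation (exteriorPower.ιMulti ℂ 4) A v :=
  exteriorPower.alternatingMapLinearEquiv_apply_ιMulti _ _

theorem action_ιMulti_eq_sum (A : Module.End ℂ V) (v : Fin 4 → V) :
    action A (exteriorPower.ιMulti ℂ 4 v) =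
      ∑ a, exteriorPower.ιMulti ℂ 4 (Function.update v a (A (v a))) := by
  rw [action_ιMulti, derivation_apply]

theorem action_action_ιMulti (A B : Module.End ℂ V) (v : Fin 4 → V) :
    action A (action B (exteriorPower.ιMulti ℂ 4 v)) =
      derivation (derivation (exteriorPower.ιMulti ℂ 4) A) B v := by
  simp only [action_ιMulti_eq_sum B, map_sum, action_ιMulti, derivation_apply _ B]

theorem action_ιMulti_of_eigenvectors {A : Module.End ℂ V} {v : Fin 4 → V} {c : Fin 4 → ℂ}
    (h : ∀ a, A (v a) = c a • v a) :
    action A (exteriorPower.ιMulti ℂ 4 v) = (∑ a, c a) • exteriorPower.ιMulti ℂ 4 v := by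
  simp only [action_ιMulti_eq_sum, h, AlternatingMap.map_update_smul, Function.update_eq_self,
    Finset.sum_smul]

/-- The usual action of operators on four-vectors, as a representation of the Lie algebra of
all operators. -/
def actionRep : Module.End ℂ V →ₗ⁅ℂ⁆ Module.End ℂ (⋀[ℂ]^4 V) where
  toFun := action
  map_add' A B := exteriorPower.linearMap_ext <| AlternatingMap.ext fun v => by
    simp [action_ιMulti_eq_sum, Finset.sum_add_distrib]
  map_smul' c A := exteriorPower.linearMap_ext <| AlternatingMap.ext fun v => by
    simp [action_ιMulti_eq_sum, Finset.smul_sum]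
  map_lie' {A B} := exteriorPower.linearMap_ext <| AlternatingMap.ext fun v => by
    have h := congrArg (· v) (derivation_derivation_sub (exteriorPower.ιMulti ℂ 4) A B)
    let T := exteriorPower.ιMulti ℂ 4 v
    change action ⁅A, B⁆ T = action A (action B T) - action B (action A T)
    rw [action_action_ιMulti, action_action_ιMulti, action_ιMulti, Ring.lie_def]
    exact h.symm

@[simp] theorem actionRep_apply (A : Module.End ℂ V) : actionRep A = action A := rfl

theorem action_lie (A B : Module.End ℂ V) (T : ⋀[ℂ]^4 V) :
    action ⁅A, B⁆ T = action A (action B T) - action B (action A T) :=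
  LinearMap.congr_fun (actionRep.map_lie A B) T

end Action

section Equivariance

theorem derivation_vol_eq_zero (e : Module.Basis (Fin 8) ℂ V) (δ : V [⋀^Fin 8]→ₗ[ℂ] ℂ)
    {A : Module.End ℂ V} (hA : A ∈ L₀ V) :
    derivation (vol δ) A = 0 := by
  rw [derivation_eq_trace_smul (e.reindex (finSumFinEquiv (m := 4) (n := 4)).symm),
    mem_L₀.mp hA, zero_smul]

theorem sum_contraction_update (e : Module.Basis (Fin 8) ℂ V) (δ : V [⋀^Fin 8]→ₗ[ℂ] ℂ)
    {A : Module.End ℂ V} (hA : A ∈ L₀ V) (v w : Fin 4 → V) :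
    ∑ a, contraction δ (Function.update v a (A (v a))) w +
      ∑ c, contraction δ v (Function.update w c (A (w c))) = ⁅A, contraction δ v w⁆ := by
  have hv := congrArg (contract w) (sum_interiorProduct_update (vol δ) A v)
  have h0 : interiorProduct (0 : V [⋀^Fin 4 ⊕ Fin 4]→ₗ[ℂ] ℂ) v = 0 := rfl
  rw [map_sum, derivation_vol_eq_zero e δ hA, h0, zero_sub, map_neg] at hv
  simp only [contraction]
  rw [hv, sum_contract_update, Ring.lie_def]
  abel

theorem ιMulti_bilin_ext {W : Type*} [AddCommGroup W] [Module ℂ W]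
    {f g : ⋀[ℂ]^4 V →ₗ[ℂ] ⋀[ℂ]^4 V →ₗ[ℂ] W}
    (h : ∀ v w, f (exteriorPower.ιMulti ℂ 4 v) (exteriorPower.ιMulti ℂ 4 w) =
      g (exteriorPower.ιMulti ℂ 4 v) (exteriorPower.ιMulti ℂ 4 w)) : f = g :=
  exteriorPower.linearMap_ext <| AlternatingMap.ext fun v =>
    exteriorPower.linearMap_ext <| AlternatingMap.ext fun w => h v w

theorem lie_bracketFour (e : Module.Basis (Fin 8) ℂ V) (δ : V [⋀^Fin 8]→ₗ[ℂ] ℂ)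
    (A : L₀ V) (T U : ⋀[ℂ]^4 V) :
    ⁅A, bracketFour e δ T U⁆ =
      bracketFour e δ (action A T) U + bracketFour e δ T (action A U) := by
  let φ : ⋀[ℂ]^4 V →ₗ[ℂ] ⋀[ℂ]^4 V →ₗ[ℂ] L₀ V :=
    (bracketBilin e δ).compr₂ (LieModule.toEnd ℂ (L₀ V) (L₀ V) A)
  let ψ : ⋀[ℂ]^4 V →ₗ[ℂ] ⋀[ℂ]^4 V →ₗ[ℂ] L₀ V :=
    bracketBilin e δ ∘ₗ action A + (bracketBilin e δ).compl₂ (action A)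
  suffices h : φ = ψ from LinearMap.congr_fun₂ h T U
  refine ιMulti_bilin_ext fun v w => Subtype.ext ?_
  have hvw := sum_contraction_update e δ A.2 v w
  have hwv := sum_contraction_update e δ A.2 w v
  simp only [φ, ψ, LinearMap.compr₂_apply, LinearMap.add_apply, LinearMap.comp_apply,
    LinearMap.compl₂_apply, LieModule.toEnd_apply_apply, action_ιMulti_eq_sum, map_sum,
    LinearMap.sum_apply, bracketBilin_apply, LieSubalgebra.coe_bracket, AddMemClass.coe_add,
    AddSubmonoidClass.coe_finsetSum, coe_bracketFour_ιMulti, ← Finset.smul_sum,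
    Finset.sum_sub_distrib, lie_smul, lie_sub, ← hvw, ← hwv]
  module

end Equivariance

section ComponentAction

theorem sum_det_updateCol_eq_sum_det_updateRow {n R : Type*} [Fintype n] [DecidableEq n]
    [CommRing R] (M N : Matrix n n R) :
    ∑ a, (M.updateCol a fun b => N b a).det = ∑ b, (M.updateRow b (N b)).det := by
  have hcol (a : n) : (M.updateCol a fun b => N b a).det = ∑ b, M.adjugate a b * N b a := by
    rw [← Matrix.cramer_apply, Matrix.cramer_eq_adjugate_mulVec]
    rfl
  have hrow (b : n) : (M.updateRow b (N b)).det = ∑ a, M.adjugate a b * N b a := by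
    rw [← Matrix.cramer_transpose_apply, Matrix.cramer_eq_adjugate_mulVec,
      ← Matrix.adjugate_transpose]
    rfl
  rw [Fintype.sum_congr _ _ hcol, Fintype.sum_congr _ _ hrow, Finset.sum_comm]

theorem pairingDual_action (f : Fin 4 → Module.Dual ℂ V) (A : Module.End ℂ V) (T : ⋀[ℂ]^4 V) :
    exteriorPower.pairingDual ℂ V 4 (exteriorPower.ιMulti ℂ 4 f) (action A T) =
      exteriorPower.pairingDual ℂ V 4 (derivation (exteriorPower.ιMulti ℂ 4) A.dualMap f) T := by
  suffices h : exteriorPower.pairingDual ℂ V 4 (exteriorPower.ιMulti ℂ 4 f) ∘ₗ action A =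
      exteriorPower.pairingDual ℂ V 4 (derivation (exteriorPower.ιMulti ℂ 4) A.dualMap f) from
    LinearMap.congr_fun h T
  refine exteriorPower.linearMap_ext (AlternatingMap.ext fun v => ?_)
  let M : Matrix (Fin 4) (Fin 4) ℂ := Matrix.of fun b a => f a (v b)
  let N : Matrix (Fin 4) (Fin 4) ℂ := Matrix.of fun b a => f a (A (v b))
  have hrow (b : Fin 4) : (Matrix.of fun c a => f a (Function.update v b (A (v b)) c)) =
      M.updateRow b (N b) := by
    ext c a
    obtain rfl | h := eq_or_ne c b <;> simp [M, N, *]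
  have hcol (a : Fin 4) :
      (Matrix.of fun b c => Function.update f a (A.dualMap (f a)) c (v b)) =
        M.updateCol a fun b => N b a := by
    ext b c
    obtain rfl | h := eq_or_ne c a <;> simp [M, N, *]
  simp only [LinearMap.compAlternatingMap_apply, LinearMap.comp_apply, action_ιMulti_eq_sum,
    derivation_apply, map_sum, LinearMap.sum_apply, exteriorPower.pairingDual_ιMulti_ιMulti,
    hrow, hcol, sum_det_updateCol_eq_sum_det_updateRow]

theorem component_action (e : Module.Basis (Fin 8) ℂ V) (A : Module.End ℂ V) (T : ⋀[ℂ]^4 V)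
    (i : Fin 4 → Fin 8) :
    component e (action A T) i =
      ∑ a : Fin 4, ∑ s : Fin 8, LinearMap.toMatrix e e A (i a) s *
        component e T (Function.update i a s) := by
  have hA (k : Fin 8) : A.dualMap (e.coord k) = ∑ s, LinearMap.toMatrix e e A k s • e.coord s := by
    refine e.ext fun m => ?_
    simp [LinearMap.toMatrix_apply, Finsupp.single_apply]
  have hupdate (a : Fin 4) (s : Fin 8) : Function.update (fun b => e.coord (i b)) a (e.coord s) =
      fun b => e.coord (Function.update i a s b) :=
    (Function.comp_update e.coord i a s).symm
  simp only [component, pairingDual_action, derivation_apply, hA, AlternatingMap.map_update_sum,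
    AlternatingMap.map_update_smul, hupdate, map_sum, map_smul, LinearMap.sum_apply,
    LinearMap.smul_apply, smul_eq_mul]

end ComponentAction

/-! ### Moving indices and basis four-vectors -/

section Moves

theorem injective_update {ι κ : Type*} [DecidableEq ι] {q : ι → κ} (hq : Function.Injective q)
    {i : κ} (hi : ∀ b, q b ≠ i) (a : ι) : Function.Injective (Function.update q a i) := by
  intro b c h
  obtain rfl | hb := eq_or_ne b a <;> obtain rfl | hc := eq_or_ne c b <;> grind [hq.eq_iff]

theorem hammingDist_lt_of_agree {ι κ : Type*} [Fintype ι] [DecidableEq κ] {p q q' : ι → κ}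
    (h : ∀ c, q c = p c → q' c = p c) {a : ι} (ha : q a ≠ p a) (ha' : q' a = p a) :
    hammingDist q' p < hammingDist q p :=
  Finset.card_lt_card <| Finset.ssubset_iff_of_subset
    (fun c hc => by simpa using mt (h c) (by simpa using hc)) |>.mpr ⟨a, by simpa, by simpa⟩

/- Induction on the number of places where `q` and `p` differ: if `q a ≠ p a`, then either the
value `p a` is free and can be put at `a`, or it sits at some `b`, and the values are swapped. -/
theorem injective_induction_of_moves {ι κ : Type*} [Finite ι] [DecidableEq ι]
    {R : κ → κ → Prop} [IsPreorder κ R] {P : (ι → κ) → Prop}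
    (swap : ∀ q a b, a ≠ b → P q → P (q ∘ Equiv.swap a b))
    (move : ∀ q a i, Function.Injective q → (∀ b, q b ≠ i) → R (q a) i → P q →
      P (Function.update q a i))
    {p q : ι → κ} (hp : Function.Injective p) (hq : Function.Injective q)
    (h : ∀ a, R (q a) (p a)) (hPq : P q) : P p := by
  classical
  have := Fintype.ofFinite ι
  induction hn : hammingDist q p using Nat.strong_induction_on generalizing q with
  | _ n ih =>
  subst hn
  obtain rfl | hne := eq_or_ne q p
  · exact hPq
  obtain ⟨a, ha⟩ := Function.ne_iff.mp hne
  by_cases hfree : ∀ b, q b ≠ p a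
  · refine ih _ (hammingDist_lt_of_agree (a := a) ?_ ha (Function.update_self ..))
      (injective_update hq hfree a) ?_ (move q a (p a) hq hfree (h a) hPq) rfl
    · intro c hc
      rwa [Function.update_of_ne (by rintro rfl; exact ha hc)]
    · intro c
      obtain rfl | hca := eq_or_ne c a
      · simpa using refl_of R (p c)
      · simpa [hca] using h c
  · push Not at hfree
    obtain ⟨b, hb⟩ := hfree
    have hab : a ≠ b := by rintro rfl; exact ha hb
    refine ih _ (hammingDist_lt_of_agree (a := a) ?_ ha (by simpa using hb))
      (hq.comp (Equiv.injective _)) ?_ (swap q a b hab hPq) rfl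
    · intro c hc
      have hca : c ≠ a := by rintro rfl; exact ha hc
      have hcb : c ≠ b := by rintro rfl; exact hab (hp (hb.symm.trans hc))
      rwa [Function.comp_apply, Equiv.swap_apply_of_ne_of_ne hca hcb]
    · intro c
      obtain rfl | hca := eq_or_ne c a
      · simpa [hb] using refl_of R (p c)
      obtain rfl | hcb := eq_or_ne c b
      · simpa using trans_of R (h a) (hb ▸ h c)
      · simpa [Equiv.swap_apply_of_ne_of_ne hca hcb] using h c

end Moves

section Wedge

variable (e : Module.Basis (Fin 8) ℂ V)

theorem wedge_comp_swap (q : Fin 4 → Fin 8) {a b : Fin 4} (hab : a ≠ b) :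
    wedge e (q ∘ Equiv.swap a b) = -wedge e q :=
  AlternatingMap.map_swap (exteriorPower.ιMulti ℂ 4) (fun a => e (q a)) hab

theorem wedge_eq_zero {q : Fin 4 → Fin 8} {a b : Fin 4} (h : q a = q b) (hab : a ≠ b) :
    wedge e q = 0 :=
  AlternatingMap.map_eq_zero_of_eq _ _ (congrArg e h) hab

theorem matrixUnit_apply_basis_self {i j : Fin 8} (hij : i ≠ j) :
    (matrixUnit e i j hij : Module.End ℂ V) (e j) = e i := by
  simp [matrixUnit]

theorem matrixUnit_apply_basis_of_ne {i j k : Fin 8} (hij : i ≠ j) (hk : k ≠ j) :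
    (matrixUnit e i j hij : Module.End ℂ V) (e k) = 0 := by
  simp [matrixUnit, hk]

theorem action_matrixUnit_wedge {i j : Fin 8} (hij : i ≠ j) {q : Fin 4 → Fin 8}
    (hq : Function.Injective q) {a : Fin 4} (ha : q a = j) :
    action (matrixUnit e i j hij : Module.End ℂ V) (wedge e q) =
      wedge e (Function.update q a i) := by
  subst ha
  rw [wedge, action_ιMulti_eq_sum, Fintype.sum_eq_single a]
  · rw [matrixUnit_apply_basis_self]
    exact congrArg _ (Function.comp_update e q a i).symm
  · intro b hb
    rw [matrixUnit_apply_basis_of_ne e hij (hq.ne hb)]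
    exact AlternatingMap.map_update_zero _ _ _

theorem action_matrixUnit_wedge_of_notMem {i j : Fin 8} (hij : i ≠ j) {q : Fin 4 → Fin 8}
    (h : ∀ a, q a ≠ j) :
    action (matrixUnit e i j hij : Module.End ℂ V) (wedge e q) = 0 := by
  rw [wedge, action_ιMulti_of_eigenvectors (c := 0)]
  · simp
  · simp [matrixUnit_apply_basis_of_ne e hij (h _)]

theorem action_matrixUnit_wedge_eq_zero {i j : Fin 8} (hij : i ≠ j) {q : Fin 4 → Fin 8}
    (hq : Function.Injective q) (h : ∀ a, q a = j → ∃ b, q b = i) :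
    action (matrixUnit e i j hij : Module.End ℂ V) (wedge e q) = 0 := by
  by_cases hj : ∃ a, q a = j
  · obtain ⟨a, ha⟩ := hj
    obtain ⟨b, hb⟩ := h a ha
    have hab : b ≠ a := by rintro rfl; exact hij (hb.symm.trans ha)
    rw [action_matrixUnit_wedge e hij hq ha]
    exact wedge_eq_zero e (a := b) (b := a) (by simp [hab, hb]) hab
  · push Not at hj
    exact action_matrixUnit_wedge_of_notMem e hij hj

theorem wedge_mem_of_moves {N : Submodule ℂ (⋀[ℂ]^4 V)} {R : Fin 8 → Fin 8 → Prop}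
    [IsPreorder (Fin 8) R]
    (hN : ∀ i j (hij : i ≠ j), R j i →
      ∀ T ∈ N, action (matrixUnit e i j hij : Module.End ℂ V) T ∈ N)
    {p q : Fin 4 → Fin 8} (hp : Function.Injective p) (hq : Function.Injective q)
    (h : ∀ a, R (q a) (p a)) (hqN : wedge e q ∈ N) : wedge e p ∈ N :=
  injective_induction_of_moves (P := fun q => wedge e q ∈ N)
    (fun q a b hab hqN => by simpa [wedge_comp_swap e q hab] using hqN)
    (fun q a i hq hi hR hqN =>
      action_matrixUnit_wedge e (hi a).symm hq rfl ▸ hN _ _ (hi a).symm hR _ hqN)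
    hp hq h hqN

end Wedge

section Contraction

variable (δ : V [⋀^Fin 8]→ₗ[ℂ] ℂ) (v w : Fin 4 → V)

theorem vol_eq_zero_of_eq {v w : Fin 4 → V} {a b : Fin 4} (h : v a = w b) :
    vol δ (Sum.elim v w) = 0 :=
  (vol δ).map_eq_zero_of_eq _ (i := Sum.inl a) (j := Sum.inr b) (by simpa using h) (by simp)

theorem vol_eq_zero_of_eq_left {v w : Fin 4 → V} {a b : Fin 4} (h : v a = v b) (hab : a ≠ b) :
    vol δ (Sum.elim v w) = 0 :=
  (vol δ).map_eq_zero_of_eq _ (i := Sum.inl a) (j := Sum.inl b) (by simpa using h) (by simpa)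

theorem vol_update_comm (a b : Fin 4) (x : V) :
    vol δ (Sum.elim (Function.update v a (w b)) (Function.update w b x)) =
      -vol δ (Sum.elim (Function.update v a x) w) := by
  rw [← AlternatingMap.map_swap (vol δ) _ (show (Sum.inl a : Fin 4 ⊕ Fin 4) ≠ Sum.inr b by simp)]
  rw [Equiv.comp_swap_eq_update]
  simp only [Sum.elim_inl, Sum.elim_inr, Function.update_self, ← Sum.elim_update_left,
    ← Sum.elim_update_right, Function.update_idem]

theorem contraction_apply_left (a : Fin 4) : contraction δ v w (v a) = 0 := by
  rw [contraction_apply]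
  refine Finset.sum_eq_zero fun b _ => ?_
  rw [vol_eq_zero_of_eq δ (a := a) (b := b) (by simp), zero_smul]

theorem contraction_apply_right (a : Fin 4) :
    contraction δ v w (w a) = vol δ (Sum.elim v w) • w a := by
  rw [contraction_apply, Fintype.sum_eq_single a]
  · simp
  · intro b hb
    rw [← vol_comm, vol_eq_zero_of_eq_left δ (a := a) (b := b) (by simp [hb.symm]) hb.symm,
      zero_smul]

theorem contraction_eq_zero {v w : Fin 4 → V} {a a' b b' : Fin 4} (hb : b ≠ b')
    (h : v a = w b) (h' : v a' = w b') : contraction δ v w = 0 := by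
  ext x
  rw [contraction_apply]
  refine Finset.sum_eq_zero fun c _ => ?_
  by_cases hc : c = b
  · rw [vol_eq_zero_of_eq δ (a := a') (b := b') (by simp [hc, hb.symm, h']), zero_smul]
  · rw [vol_eq_zero_of_eq δ (a := a) (b := b) (by simp [Ne.symm hc, h]), zero_smul]

theorem contraction_update_right (a b : Fin 4) (x : V) :
    contraction δ w (Function.update v a (w b)) x =
      vol δ (Sum.elim (Function.update v a x) w) • w b := by
  rw [contraction_apply, Fintype.sum_eq_single a]
  · rw [Function.update_idem, Function.update_self, vol_comm]
  · intro c hc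
    rw [vol_eq_zero_of_eq δ (a := b) (b := a) (by simp [hc.symm]), zero_smul]

theorem contraction_update_left (a b : Fin 4) (x : V) :
    contraction δ (Function.update v a (w b)) w x =
      -vol δ (Sum.elim (Function.update v a x) w) • w b := by
  rw [contraction_apply, Fintype.sum_eq_single b]
  · rw [vol_update_comm]
  · intro c hc
    rw [vol_eq_zero_of_eq δ (a := a) (b := b) (by simp [hc.symm]), zero_smul]

end Contraction

section BracketFour

variable (e : Module.Basis (Fin 8) ℂ V) (δ : V [⋀^Fin 8]→ₗ[ℂ] ℂ)

theorem bracketFour_apply_left (v w : Fin 4 → V) (a : Fin 4) :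
    (bracketFour e δ (exteriorPower.ιMulti ℂ 4 v) (exteriorPower.ιMulti ℂ 4 w) : Module.End ℂ V)
      (v a) = ((1 / 2 : ℂ) * vol δ (Sum.elim v w)) • v a := by
  rw [coe_bracketFour_ιMulti, LinearMap.smul_apply, LinearMap.sub_apply, contraction_apply_left,
    contraction_apply_right, vol_comm]
  module

theorem bracketFour_apply_right (v w : Fin 4 → V) (a : Fin 4) :
    (bracketFour e δ (exteriorPower.ιMulti ℂ 4 v) (exteriorPower.ιMulti ℂ 4 w) : Module.End ℂ V)
      (w a) = (-(1 / 2 : ℂ) * vol δ (Sum.elim v w)) • w a := by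
  rw [coe_bracketFour_ιMulti, LinearMap.smul_apply, LinearMap.sub_apply, contraction_apply_left,
    contraction_apply_right]
  module

theorem bracketFour_eq_zero {v w : Fin 4 → V} {a a' b b' : Fin 4} (ha : a ≠ a') (hb : b ≠ b')
    (h : v a = w b) (h' : v a' = w b') :
    bracketFour e δ (exteriorPower.ιMulti ℂ 4 v) (exteriorPower.ιMulti ℂ 4 w) = 0 := by
  refine Subtype.ext ?_
  rw [coe_bracketFour_ιMulti, contraction_eq_zero δ hb h h',
    contraction_eq_zero δ ha h.symm h'.symm, sub_zero, smul_zero, ZeroMemClass.coe_zero]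

end BracketFour

/-! ### The Jacobi identity -/

section Jacobiator

variable (e : Module.Basis (Fin 8) ℂ V) (δ : V [⋀^Fin 8]→ₗ[ℂ] ℂ)

/-- The trilinear map `(S, T, U) ↦ [[S, T], U]` on four-vectors. -/
def bracketAction : ⋀[ℂ]^4 V →ₗ[ℂ] ⋀[ℂ]^4 V →ₗ[ℂ] ⋀[ℂ]^4 V →ₗ[ℂ] ⋀[ℂ]^4 V :=
  (bracketBilin e δ).compr₂ (actionRep.toLinearMap ∘ₗ (L₀ V).toSubmodule.subtype)

/-- The cyclic sum `(S, T, U) ↦ [[S, T], U] + [[T, U], S] + [[U, S], T]`, whose vanishing is the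
Jacobi identity for three four-vectors. -/
def jacobiator : ⋀[ℂ]^4 V →ₗ[ℂ] ⋀[ℂ]^4 V →ₗ[ℂ] ⋀[ℂ]^4 V →ₗ[ℂ] ⋀[ℂ]^4 V :=
  bracketAction e δ + (LinearMap.lflip.toLinearMap ∘ₗ bracketAction e δ).flip +
    LinearMap.lflip.toLinearMap ∘ₗ (bracketAction e δ).flip

theorem jacobiator_apply (S T U : ⋀[ℂ]^4 V) :
    jacobiator e δ S T U = action (bracketFour e δ S T : Module.End ℂ V) U +
      action (bracketFour e δ T U : Module.End ℂ V) S +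
      action (bracketFour e δ U S : Module.End ℂ V) T := rfl

theorem jacobiator_cyclic (S T U : ⋀[ℂ]^4 V) : jacobiator e δ S T U = jacobiator e δ T U S := by
  simp only [jacobiator_apply]; abel

theorem action_bracketFour_skew (S T U : ⋀[ℂ]^4 V) :
    action (bracketFour e δ S T : Module.End ℂ V) U =
      -action (bracketFour e δ T S : Module.End ℂ V) U := by
  rw [bracketFour_skew, NegMemClass.coe_neg, ← actionRep_apply, map_neg]
  rfl

theorem jacobiator_swap (S T U : ⋀[ℂ]^4 V) : jacobiator e δ S T U = -jacobiator e δ S U T := by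
  simp only [jacobiator_apply]
  rw [action_bracketFour_skew e δ S T, action_bracketFour_skew e δ T U,
    action_bracketFour_skew e δ U S]
  abel

theorem jacobiator_self (T U : ⋀[ℂ]^4 V) : jacobiator e δ T T U = 0 := by
  have h : action (bracketFour e δ T T : Module.End ℂ V) U = 0 := by
    rw [bracketFour_self, ZeroMemClass.coe_zero, ← actionRep_apply, map_zero, LinearMap.zero_apply]
  rw [jacobiator_apply, h, action_bracketFour_skew e δ U T, zero_add, add_neg_cancel]

theorem action_bracketAction (A : L₀ V) (S T U : ⋀[ℂ]^4 V) :
    action A (bracketAction e δ S T U) = bracketAction e δ (action A S) T U +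
      bracketAction e δ S (action A T) U + bracketAction e δ S T (action A U) := by
  have hlie := action_lie (A : Module.End ℂ V) (bracketFour e δ S T) U
  have hinv := congrArg (fun X : L₀ V => actionRep (X : Module.End ℂ V) U)
    (lie_bracketFour e δ A S T)
  simp only [LieSubalgebra.coe_bracket, AddMemClass.coe_add, map_add, LinearMap.add_apply,
    actionRep_apply, hlie, sub_eq_iff_eq_add] at hinv
  exact hinv

theorem action_jacobiator (A : L₀ V) (S T U : ⋀[ℂ]^4 V) :
    action A (jacobiator e δ S T U) = jacobiator e δ (action A S) T U +
      jacobiator e δ S (action A T) U + jacobiator e δ S T (action A U) := by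
  have h (S T U : ⋀[ℂ]^4 V) : jacobiator e δ S T U =
    bracketAction e δ S T U + bracketAction e δ T U S + bracketAction e δ U S T := rfl
  simp only [h, map_add, action_bracketAction]
  abel

theorem action_bracketFour_ιMulti_update (v w : Fin 4 → V) (a b : Fin 4) :
    action (bracketFour e δ (exteriorPower.ιMulti ℂ 4 v) (exteriorPower.ιMulti ℂ 4 w) :
      Module.End ℂ V) (exteriorPower.ιMulti ℂ 4 (Function.update v a (w b))) =
      vol δ (Sum.elim v w) • exteriorPower.ιMulti ℂ 4 (Function.update v a (w b)) := by
  have heig (c : Fin 4) : (bracketFour e δ (exteriorPower.ιMulti ℂ 4 v)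
      (exteriorPower.ιMulti ℂ 4 w) : Module.End ℂ V) (Function.update v a (w b) c) =
      ((if c = a then -(1 / 2) else 1 / 2) * vol δ (Sum.elim v w)) •
        Function.update v a (w b) c := by
    obtain rfl | hc := eq_or_ne c a
    · rw [Function.update_self, if_pos rfl, bracketFour_apply_right]
    · rw [Function.update_of_ne hc, if_neg hc, bracketFour_apply_left]
  have hsum : ∑ c : Fin 4, (if c = a then -(1 / 2 : ℂ) else 1 / 2) = 1 := by
    simp [Finset.sum_ite, Finset.filter_eq', Finset.filter_ne']
    norm_num
  rw [action_ιMulti_of_eigenvectors heig, ← Finset.sum_mul, hsum, one_mul]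

theorem bracketFour_ιMulti_update_apply (v w : Fin 4 → V) (a b : Fin 4) (x : V) :
    (bracketFour e δ (exteriorPower.ιMulti ℂ 4 w)
      (exteriorPower.ιMulti ℂ 4 (Function.update v a (w b))) : Module.End ℂ V) x =
      -vol δ (Sum.elim (Function.update v a x) w) • w b := by
  rw [coe_bracketFour_ιMulti, LinearMap.smul_apply, LinearMap.sub_apply,
    contraction_update_right, contraction_update_left]
  module

theorem action_bracketFour_update_ιMulti (v w : Fin 4 → V) (a b : Fin 4) :
    action (bracketFour e δ (exteriorPower.ιMulti ℂ 4 w)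
      (exteriorPower.ιMulti ℂ 4 (Function.update v a (w b))) : Module.End ℂ V)
        (exteriorPower.ιMulti ℂ 4 v) =
      -vol δ (Sum.elim v w) • exteriorPower.ιMulti ℂ 4 (Function.update v a (w b)) := by
  rw [action_ιMulti_eq_sum, Fintype.sum_eq_single a]
  · rw [bracketFour_ιMulti_update_apply, Function.update_eq_self, AlternatingMap.map_update_smul]
  · intro c hc
    rw [bracketFour_ιMulti_update_apply,
      vol_eq_zero_of_eq_left δ (a := a) (b := c) (by simp [hc]) hc.symm, neg_zero, zero_smul,
      AlternatingMap.map_update_zero]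

theorem bracketFour_update_self (v : Fin 4 → V) (a : Fin 4) (x : V) :
    bracketFour e δ (exteriorPower.ιMulti ℂ 4 (Function.update v a x))
      (exteriorPower.ιMulti ℂ 4 v) = 0 := by
  obtain ⟨c, d, hcd, hc, hd⟩ : ∃ c d : Fin 4, c ≠ d ∧ c ≠ a ∧ d ≠ a := by decide +revert
  exact bracketFour_eq_zero e δ hcd hcd (by simp [hc]) (by simp [hd])

theorem jacobiator_update (v w : Fin 4 → V) (a b : Fin 4) :
    jacobiator e δ (exteriorPower.ιMulti ℂ 4 (Function.update v a (w b)))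
      (exteriorPower.ιMulti ℂ 4 v) (exteriorPower.ιMulti ℂ 4 w) = 0 := by
  rw [jacobiator_apply, bracketFour_update_self, action_bracketFour_ιMulti_update,
    action_bracketFour_update_ιMulti, ZeroMemClass.coe_zero, ← actionRep_apply, map_zero,
    LinearMap.zero_apply]
  module

theorem action_bracketFour_half_half (v w : Fin 4 → V) :
    action (bracketFour e δ (exteriorPower.ιMulti ℂ 4 v) (exteriorPower.ιMulti ℂ 4 w) :
      Module.End ℂ V) (exteriorPower.ιMulti ℂ 4 ![v 0, v 1, w 0, w 1]) = 0 := by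
  have heig (c : Fin 4) : (bracketFour e δ (exteriorPower.ιMulti ℂ 4 v)
      (exteriorPower.ιMulti ℂ 4 w) : Module.End ℂ V) (![v 0, v 1, w 0, w 1] c) =
      (![1 / 2, 1 / 2, -(1 / 2), -(1 / 2)] c * vol δ (Sum.elim v w)) •
        ![v 0, v 1, w 0, w 1] c := by
    fin_cases c
    · exact bracketFour_apply_left e δ v w 0
    · exact bracketFour_apply_left e δ v w 1
    · exact bracketFour_apply_right e δ v w 0
    · exact bracketFour_apply_right e δ v w 1
  have hsum : ∑ c, (![1 / 2, 1 / 2, -(1 / 2), -(1 / 2)] c : ℂ) = 0 := by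
    simp [Fin.sum_univ_four]
  rw [action_ιMulti_of_eigenvectors heig, ← Finset.sum_mul, hsum, zero_mul, zero_smul]

theorem jacobiator_half_half (v w : Fin 4 → V) :
    jacobiator e δ (exteriorPower.ιMulti ℂ 4 ![v 0, v 1, w 0, w 1])
      (exteriorPower.ιMulti ℂ 4 v) (exteriorPower.ιMulti ℂ 4 w) = 0 := by
  have hv : bracketFour e δ (exteriorPower.ιMulti ℂ 4 ![v 0, v 1, w 0, w 1])
      (exteriorPower.ιMulti ℂ 4 v) = 0 :=
    bracketFour_eq_zero e δ (a := 0) (a' := 1) (b := 0) (b' := 1) (by simp) (by simp) rfl rfl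
  have hw : bracketFour e δ (exteriorPower.ιMulti ℂ 4 w)
      (exteriorPower.ιMulti ℂ 4 ![v 0, v 1, w 0, w 1]) = 0 :=
    bracketFour_eq_zero e δ (a := 0) (a' := 1) (b := 2) (b' := 3) (by simp) (by simp) rfl rfl
  rw [jacobiator_apply, hv, hw, action_bracketFour_half_half, ZeroMemClass.coe_zero,
    ← actionRep_apply, map_zero]
  simp

end Jacobiator

section Jacobi

variable (e : Module.Basis (Fin 8) ℂ V) (δ : V [⋀^Fin 8]→ₗ[ℂ] ℂ)

theorem mem_of_forall_wedge_mem {N : Submodule ℂ (⋀[ℂ]^4 V)}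
    (h : ∀ p : Fin 4 → Fin 8, StrictMono p → wedge e p ∈ N) (T : ⋀[ℂ]^4 V) : T ∈ N := by
  suffices hN : ⊤ ≤ N from hN trivial
  rw [← (e.exteriorPower 4).span_eq, Submodule.span_le]
  rintro _ ⟨s, rfl⟩
  rw [exteriorPower.basis_apply]
  exact h _ (OrderEmbedding.strictMono _)

variable {e δ} in
theorem jacobiator_eq_zero_of_wedge {T U : ⋀[ℂ]^4 V}
    (h : ∀ p : Fin 4 → Fin 8, StrictMono p → jacobiator e δ (wedge e p) T U = 0) (S : ⋀[ℂ]^4 V) :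
    jacobiator e δ S T U = 0 := by
  let N : Submodule ℂ (⋀[ℂ]^4 V) :=
    LinearMap.ker ((jacobiator e δ).compr₂ (LinearMap.applyₗ U) |>.flip T)
  have hN (S) : S ∈ N ↔ jacobiator e δ S T U = 0 := by simp [N]
  exact (hN S).mp (mem_of_forall_wedge_mem e (fun p hp => (hN _).mpr (h p hp)) S)

theorem jacobiator_wedge_eq_zero_of_moves {N₁ N₂ : Submodule ℂ (⋀[ℂ]^4 V)}
    {R : Fin 8 → Fin 8 → Prop} [IsPreorder (Fin 8) R]
    (h₁ : ∀ i j (hij : i ≠ j), R j i → ∀ S ∈ N₁, action (matrixUnit e i j hij) S ∈ N₁)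
    (h₂ : ∀ i j (hij : i ≠ j), R j i → ∀ T ∈ N₂, action (matrixUnit e i j hij) T ∈ N₂)
    {p q : Fin 4 → Fin 8} (hp : Function.Injective p) (hq : Function.Injective q)
    (h : ∀ a, R (q a) (p a)) (hJ : ∀ S ∈ N₁, ∀ T ∈ N₂, jacobiator e δ (wedge e q) S T = 0) :
    ∀ S ∈ N₁, ∀ T ∈ N₂, jacobiator e δ (wedge e p) S T = 0 := by
  let N : Submodule ℂ (⋀[ℂ]^4 V) :=
    ⨅ S ∈ N₁, ⨅ T ∈ N₂, LinearMap.ker ((jacobiator e δ).compr₂ (LinearMap.applyₗ T) |>.flip S)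
  have hN (U) : U ∈ N ↔ ∀ S ∈ N₁, ∀ T ∈ N₂, jacobiator e δ U S T = 0 := by simp [N]
  refine (hN _).mp
    (wedge_mem_of_moves e (R := R) (fun i j hij hR U hU => ?_) hp hq h ((hN _).mpr hJ))
  rw [hN] at hU ⊢
  intro S hS T hT
  have hE := action_jacobiator e δ (matrixUnit e i j hij) U S T
  rwa [hU S hS T hT, hU _ (h₁ i j hij hR S hS) T hT, hU S hS _ (h₂ i j hij hR T hT), map_zero,
    add_zero, add_zero, eq_comm] at hE

theorem action_mem_span_of_eq_zero {A : Module.End ℂ V} {T : ⋀[ℂ]^4 V} (h : action A T = 0) :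
    ∀ U ∈ ℂ ∙ T, action A U ∈ ℂ ∙ T := by
  intro U hU
  obtain ⟨c, rfl⟩ := Submodule.mem_span_singleton.mp hU
  simp [h]

theorem action_matrixUnit_mem_span_wedge_left {i j : Fin 8} (hij : i ≠ j) (h : j < 4 → i < 4) :
    ∀ S ∈ ℂ ∙ wedge e ![0, 1, 2, 3],
      action (matrixUnit e i j hij) S ∈ ℂ ∙ wedge e ![0, 1, 2, 3] :=
  action_mem_span_of_eq_zero <| action_matrixUnit_wedge_eq_zero e hij (by decide)
    (by decide +revert)

theorem action_matrixUnit_mem_span_wedge_right {i j : Fin 8} (hij : i ≠ j) (h : i < 4 → j < 4) :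
    ∀ S ∈ ℂ ∙ wedge e ![4, 5, 6, 7],
      action (matrixUnit e i j hij) S ∈ ℂ ∙ wedge e ![4, 5, 6, 7] :=
  action_mem_span_of_eq_zero <| action_matrixUnit_wedge_eq_zero e hij (by decide)
    (by decide +revert)

/- The matrix units that preserve the two halves of the basis move `p` to one of five reference
tuples, according to the number of its entries in the first half. -/
theorem exists_reference_of_strictMono {p : Fin 4 → Fin 8} (hp : StrictMono p) :
    ∃ q : Fin 4 → Fin 8, (∀ a, q a < 4 ↔ p a < 4) ∧
      q ∈ [![0, 1, 2, 3], ![0, 1, 2, 4], ![0, 1, 4, 5], ![0, 5, 6, 7], ![4, 5, 6, 7]] := by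
  have h01 : p 0 < p 1 := hp (by decide)
  have h12 : p 1 < p 2 := hp (by decide)
  have h23 : p 2 < p 3 := hp (by decide)
  by_cases h3 : p 3 < 4
  · exact ⟨![0, 1, 2, 3], by simp [Fin.forall_fin_succ]; omega, by simp⟩
  by_cases h2 : p 2 < 4
  · exact ⟨![0, 1, 2, 4], by simp [Fin.forall_fin_succ]; omega, by simp⟩
  by_cases h1 : p 1 < 4
  · exact ⟨![0, 1, 4, 5], by simp [Fin.forall_fin_succ]; omega, by simp⟩
  by_cases h0 : p 0 < 4
  · exact ⟨![0, 5, 6, 7], by simp [Fin.forall_fin_succ]; omega, by simp⟩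
  · exact ⟨![4, 5, 6, 7], by simp [Fin.forall_fin_succ]; omega, by simp⟩

theorem jacobiator_wedge_update (p q : Fin 4 → Fin 8) (a b : Fin 4) :
    jacobiator e δ (wedge e (Function.update p a (q b))) (wedge e p) (wedge e q) = 0 := by
  have h := jacobiator_update e δ (fun c => e (p c)) (fun c => e (q c)) a b
  rwa [show Function.update (fun c => e (p c)) a (e (q b)) =
    fun c => e (Function.update p a (q b) c) from (Function.comp_update e p a (q b)).symm] at h

theorem jacobiator_wedge_reference {q : Fin 4 → Fin 8}
    (hq : q ∈ [![0, 1, 2, 3], ![0, 1, 2, 4], ![0, 1, 4, 5], ![0, 5, 6, 7], ![4, 5, 6, 7]]) :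
    jacobiator e δ (wedge e q) (wedge e ![0, 1, 2, 3]) (wedge e ![4, 5, 6, 7]) = 0 := by
  simp only [List.mem_cons, List.not_mem_nil, or_false] at hq
  obtain rfl | rfl | rfl | rfl | rfl := hq
  · exact jacobiator_self e δ _ _
  · have h := jacobiator_wedge_update e δ ![0, 1, 2, 3] ![4, 5, 6, 7] 3 0
    rwa [show Function.update ![0, 1, 2, 3] 3 (![4, 5, 6, 7] 0) = (![0, 1, 2, 4] : Fin 4 → Fin 8)
      by decide] at h
  · have h := jacobiator_half_half e δ (fun a => e (![0, 1, 2, 3] a)) fun a => e (![4, 5, 6, 7] a)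
    rwa [show ![e _, e _, e _, e _] = fun a => e (![0, 1, 4, 5] a) by
      ext a; fin_cases a <;> rfl] at h
  · rw [jacobiator_swap, neg_eq_zero]
    have h := jacobiator_wedge_update e δ ![4, 5, 6, 7] ![0, 1, 2, 3] 0 0
    rwa [show Function.update ![4, 5, 6, 7] 0 (![0, 1, 2, 3] 0) = (![0, 5, 6, 7] : Fin 4 → Fin 8)
      by decide] at h
  · rw [jacobiator_swap, jacobiator_self, neg_zero]

theorem jacobiator_wedge_wedge (S : ⋀[ℂ]^4 V) :
    jacobiator e δ S (wedge e ![0, 1, 2, 3]) (wedge e ![4, 5, 6, 7]) = 0 := by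
  refine jacobiator_eq_zero_of_wedge (fun p hp => ?_) S
  obtain ⟨q, hqp, hq⟩ := exists_reference_of_strictMono hp
  have : IsPreorder (Fin 8) fun i j => i < 4 ↔ j < 4 :=
    { refl := fun _ => Iff.rfl, trans := fun _ _ _ => Iff.trans }
  have hq' : Function.Injective q := by
    simp only [List.mem_cons, List.not_mem_nil, or_false] at hq
    obtain rfl | rfl | rfl | rfl | rfl := hq <;> decide
  refine jacobiator_wedge_eq_zero_of_moves e δ (R := fun i j => i < 4 ↔ j < 4)
    (fun i j hij h => action_matrixUnit_mem_span_wedge_left e hij h.mp)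
    (fun i j hij h => action_matrixUnit_mem_span_wedge_right e hij h.mpr)
    hp.injective hq' hqp (fun S hS T hT => ?_) _ (Submodule.mem_span_singleton_self _) _
    (Submodule.mem_span_singleton_self _)
  obtain ⟨c, rfl⟩ := Submodule.mem_span_singleton.mp hS
  obtain ⟨d, rfl⟩ := Submodule.mem_span_singleton.mp hT
  simp [jacobiator_wedge_reference e δ hq]

theorem jacobiator_wedge (S T : ⋀[ℂ]^4 V) : jacobiator e δ S T (wedge e ![0, 1, 2, 3]) = 0 := by
  refine jacobiator_eq_zero_of_wedge (fun p hp => ?_) S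
  have : IsPreorder (Fin 8) fun i j => i < 4 → j < 4 :=
    { refl := fun _ => id, trans := fun _ _ _ h h' => h' ∘ h }
  refine jacobiator_wedge_eq_zero_of_moves e δ (R := fun i j => i < 4 → j < 4)
    (N₁ := ⊤) (N₂ := ℂ ∙ wedge e ![0, 1, 2, 3]) (q := ![4, 5, 6, 7]) (fun _ _ _ _ _ _ => trivial)
    (fun i j hij h => action_matrixUnit_mem_span_wedge_left e hij h)
    hp.injective (by decide) (fun a => ?_) (fun S _ T hT => ?_) T trivial _
    (Submodule.mem_span_singleton_self _)
  · fin_cases a <;> simp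
  · obtain ⟨c, rfl⟩ := Submodule.mem_span_singleton.mp hT
    rw [map_smul, jacobiator_cyclic, jacobiator_wedge_wedge, smul_zero]

theorem jacobiator_eq_zero (S T U : ⋀[ℂ]^4 V) : jacobiator e δ S T U = 0 := by
  refine jacobiator_eq_zero_of_wedge (fun p hp => ?_) S
  have : IsPreorder (Fin 8) fun _ _ => True :=
    { refl := fun _ => trivial, trans := fun _ _ _ _ _ => trivial }
  refine jacobiator_wedge_eq_zero_of_moves e δ (R := fun _ _ => True) (N₁ := ⊤) (N₂ := ⊤)
    (q := ![0, 1, 2, 3]) (fun _ _ _ _ _ _ => trivial) (fun _ _ _ _ _ _ => trivial)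
    hp.injective (by decide) (fun _ => trivial) (fun S _ T _ => ?_) T trivial U trivial
  rw [jacobiator_cyclic, jacobiator_wedge]

end Jacobi

section LieBracket

variable (e : Module.Basis (Fin 8) ℂ V) (δ : V [⋀^Fin 8]→ₗ[ℂ] ℂ)

theorem fst_add (x y : 𝔤 e δ) : (x + y).1 = x.1 + y.1 := rfl

theorem snd_add (x y : 𝔤 e δ) : (x + y).2 = x.2 + y.2 := rfl

theorem fst_smul (c : ℂ) (x : 𝔤 e δ) : (c • x).1 = c • x.1 := rfl

theorem snd_smul (c : ℂ) (x : 𝔤 e δ) : (c • x).2 = c • x.2 := rfl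

theorem fst_lie (x y : 𝔤 e δ) : ⁅x, y⁆.1 = ⁅x.1, y.1⁆ + bracketBilin e δ x.2 y.2 := rfl

theorem snd_lie (x y : 𝔤 e δ) :
    ⁅x, y⁆.2 = actionRep (x.1 : Module.End ℂ V) y.2 - actionRep (y.1 : Module.End ℂ V) x.2 := rfl

theorem fst_lie_lie (x y z : 𝔤 e δ) :
    ⁅x, ⁅y, z⁆⁆.1 = (⁅⁅x, y⁆, z⁆ + ⁅y, ⁅x, z⁆⁆ : 𝔤 e δ).1 := by
  simp only [fst_add, fst_lie, snd_lie, actionRep_apply, map_sub, LinearMap.sub_apply, add_lie,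
    lie_add, bracketBilin_apply, lie_bracketFour]
  rw [← lie_skew (bracketFour e δ x.2 y.2) z.1, lie_bracketFour, leibniz_lie x.1 y.1 z.1,
    bracketFour_skew e δ y.2 (action _ x.2)]
  abel

theorem snd_lie_lie (x y z : 𝔤 e δ) :
    ⁅x, ⁅y, z⁆⁆.2 = (⁅⁅x, y⁆, z⁆ + ⁅y, ⁅x, z⁆⁆ : 𝔤 e δ).2 := by
  have hJ := jacobiator_eq_zero e δ x.2 y.2 z.2
  rw [jacobiator_apply, action_bracketFour_skew e δ z.2 x.2, add_right_comm] at hJ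
  simp only [snd_add, fst_lie, snd_lie, actionRep_apply, map_sub, map_add, LinearMap.add_apply,
    bracketBilin_apply, AddMemClass.coe_add, LieSubalgebra.coe_bracket, action_lie,
    eq_neg_of_add_eq_zero_right hJ]
  abel

theorem isLieBracket : IsLieBracket e δ where
  add_lie x y z := Prod.ext
    (by simp only [fst_lie, fst_add, snd_add, add_lie, map_add, LinearMap.add_apply]; abel)
    (by
      simp only [snd_lie, fst_add, snd_add, map_add, AddMemClass.coe_add, LinearMap.add_apply]
      abel)
  lie_add x y z := Prod.ext
    (by simp only [fst_lie, fst_add, snd_add, lie_add, map_add]; abel)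
    (by
      simp only [snd_lie, fst_add, snd_add, map_add, AddMemClass.coe_add, LinearMap.add_apply]
      abel)
  lie_smul c x y := Prod.ext
    (by simp only [fst_lie, fst_smul, snd_smul, lie_smul, map_smul, smul_add])
    (by simp only [snd_lie, fst_smul, snd_smul, map_smul, SetLike.val_smul,
      LinearMap.smul_apply, smul_sub])
  lie_self x := Prod.ext
    (by rw [fst_lie, lie_self, bracketBilin_apply, bracketFour_self, zero_add]; rfl) (sub_self _)
  jacobi x y z := Prod.ext (fst_lie_lie e δ x y z) (snd_lie_lie e δ x y z)

end LieBracket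

/-! ### The Lie algebra `L₀(V)` -/

section Matrices

variable (e : Module.Basis (Fin 8) ℂ V)

/-- The matrix of an operator in the basis `e`, as an embedding of the Lie algebra `L₀(V)`. -/
def toMatrixHom : L₀ V →ₗ⁅ℂ⁆ Matrix (Fin 8) (Fin 8) ℂ :=
  (LinearMap.toMatrixAlgEquiv e).toLieEquiv.toLieHom.comp (L₀ V).incl

theorem toMatrixHom_apply (A : L₀ V) : toMatrixHom e A = LinearMap.toMatrix e e A := rfl

theorem toMatrixHom_injective : Function.Injective (toMatrixHom e) :=
  (LinearMap.toMatrix e e).injective.comp Subtype.val_injective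

theorem toMatrixHom_lie (A B : L₀ V) :
    toMatrixHom e ⁅A, B⁆ = toMatrixHom e A * toMatrixHom e B - toMatrixHom e B * toMatrixHom e A :=
  (toMatrixHom e).map_lie A B

theorem trace_toMatrixHom (A : L₀ V) : (toMatrixHom e A).trace = 0 := by
  rw [toMatrixHom_apply, ← LinearMap.trace_eq_matrix_trace ℂ e]
  exact A.2

@[simp] theorem toMatrixHom_matrixUnit {i j : Fin 8} (hij : i ≠ j) :
    toMatrixHom e (matrixUnit e i j hij) = Matrix.single i j 1 := by
  ext k l
  rw [toMatrixHom_apply, LinearMap.toMatrix_apply, matrixUnit, LinearMap.smulRight_apply, map_smul]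
  rcases eq_or_ne j l with rfl | hl <;> simp [Finsupp.single_apply, Matrix.single_apply, *]

/-- The operator of trace zero that is diagonal in the basis `e` with entries `c`. -/
def diagOp (c : Fin 8 → ℂ) (hc : ∑ k, c k = 0) : L₀ V :=
  ⟨Matrix.toLin e e (Matrix.diagonal c), by
    rw [mem_L₀, LinearMap.trace_eq_matrix_trace ℂ e, LinearMap.toMatrix_toLin,
      Matrix.trace_diagonal, hc]⟩

@[simp] theorem toMatrixHom_diagOp (c : Fin 8 → ℂ) (hc : ∑ k, c k = 0) :
    toMatrixHom e (diagOp e c hc) = Matrix.diagonal c :=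
  LinearMap.toMatrix_toLin _ _ _

theorem lie_matrixUnit_matrixUnit {i j k : Fin 8} (hij : i ≠ j) (hjk : j ≠ k) (hik : i ≠ k) :
    ⁅matrixUnit e i j hij, matrixUnit e j k hjk⁆ = matrixUnit e i k hik := by
  apply toMatrixHom_injective e
  rw [toMatrixHom_lie]
  simp [hik.symm]

theorem toMatrixHom_lie_matrixUnit_symm {i j : Fin 8} (hij : i ≠ j) :
    toMatrixHom e ⁅matrixUnit e i j hij, matrixUnit e j i hij.symm⁆ =
      Matrix.single i i 1 - Matrix.single j j 1 := by
  rw [toMatrixHom_lie]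
  simp

theorem lie_matrixUnit_symm {i j : Fin 8} (hij : i ≠ j) :
    ⁅matrixUnit e i j hij, matrixUnit e j i hij.symm⁆ =
      diagOp e (Pi.single i 1 - Pi.single j 1) (by simp) := by
  apply toMatrixHom_injective e
  rw [toMatrixHom_lie_matrixUnit_symm, toMatrixHom_diagOp, ← Matrix.diagonal_single,
    ← Matrix.diagonal_single, Matrix.diagonal_sub]
  rfl

theorem toMatrixHom_lie_matrixUnit {i j : Fin 8} (hij : i ≠ j) (A : L₀ V) :
    toMatrixHom e ⁅matrixUnit e i j hij, A⁆ i j =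
      toMatrixHom e A j j - toMatrixHom e A i i := by
  rw [toMatrixHom_lie]
  simp

theorem lie_lie_matrixUnit {i j : Fin 8} (hij : i ≠ j) (A : L₀ V) :
    ⁅matrixUnit e i j hij, ⁅matrixUnit e i j hij, A⁆⁆ =
      (-2 * toMatrixHom e A j i) • matrixUnit e i j hij := by
  apply toMatrixHom_injective e
  rw [toMatrixHom_lie, toMatrixHom_lie, map_smul, toMatrixHom_matrixUnit]
  generalize toMatrixHom e A = M
  have hsq : Matrix.single i j (1 : ℂ) * Matrix.single i j 1 = 0 :=
    Matrix.single_mul_single_of_ne _ _ _ _ hij.symm _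
  have hsandwich :
      Matrix.single i j (1 : ℂ) * M * Matrix.single i j 1 = M j i • Matrix.single i j 1 := by
    simp [Matrix.single_mul_mul_single]
  calc _ = (Matrix.single i j (1 : ℂ) * Matrix.single i j 1) * M +
        M * (Matrix.single i j 1 * Matrix.single i j 1) -
        (2 : ℂ) • (Matrix.single i j (1 : ℂ) * M * Matrix.single i j 1) := by
        rw [two_smul]
        noncomm_ring
    _ = _ := by rw [hsq, hsandwich]; simp

theorem exists_toMatrixHom_ne_zero {A : L₀ V} (hA : A ≠ 0) :
    ∃ i j, ∃ hij : i ≠ j,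
      toMatrixHom e A i j ≠ 0 ∨ toMatrixHom e ⁅matrixUnit e i j hij, A⁆ i j ≠ 0 := by
  by_contra! h
  have hscalar (i) : toMatrixHom e A i i = toMatrixHom e A 0 0 := by
    rcases eq_or_ne 0 i with rfl | hi
    · rfl
    · have h0 := (h 0 i hi).2
      rwa [toMatrixHom_lie_matrixUnit, sub_eq_zero] at h0
  have htrace := trace_toMatrixHom e A
  simp only [Matrix.trace, Matrix.diag_apply, hscalar] at htrace
  refine hA (toMatrixHom_injective e (Matrix.ext fun i j => ?_))
  rcases eq_or_ne i j with rfl | hij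
  · simpa [hscalar i] using htrace
  · simpa using (h i j hij).1

section Stable

variable {e} {N : Submodule ℂ (L₀ V)}
  (hN : ∀ i j (hij : i ≠ j), ∀ A ∈ N, ⁅matrixUnit e i j hij, A⁆ ∈ N)

include hN

theorem exists_matrixUnit_mem (h0 : N ≠ ⊥) : ∃ i j, ∃ hij : i ≠ j, matrixUnit e i j hij ∈ N := by
  obtain ⟨A, hA, hA0⟩ := Submodule.exists_mem_ne_zero_of_ne_bot h0
  obtain ⟨i, j, hij, h⟩ := exists_toMatrixHom_ne_zero e hA0
  obtain ⟨B, hB, hB0⟩ : ∃ B ∈ N, toMatrixHom e B i j ≠ 0 :=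
    h.elim (fun h => ⟨A, hA, h⟩) fun h => ⟨_, hN i j hij A hA, h⟩
  have hEE := hN j i hij.symm _ (hN j i hij.symm B hB)
  rw [lie_lie_matrixUnit] at hEE
  exact ⟨j, i, hij.symm, (N.smul_mem_iff (by simpa using hB0)).mp hEE⟩

theorem matrixUnit_mem_of_mem {i j : Fin 8} {hij : i ≠ j} (h : matrixUnit e i j hij ∈ N)
    {k l : Fin 8} (hkl : k ≠ l) : matrixUnit e k l hkl ∈ N := by
  have hrow {i j k : Fin 8} {hij : i ≠ j} (h : matrixUnit e i j hij ∈ N) (hkj : k ≠ j) :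
      matrixUnit e k j hkj ∈ N := by
    rcases eq_or_ne k i with rfl | hki
    · exact h
    · rw [← lie_matrixUnit_matrixUnit e hki hij]
      exact hN k i hki _ h
  have hcol {i j l : Fin 8} {hij : i ≠ j} (h : matrixUnit e i j hij ∈ N) (hil : i ≠ l) :
      matrixUnit e i l hil ∈ N := by
    rcases eq_or_ne j l with rfl | hjl
    · exact h
    · rw [← lie_matrixUnit_matrixUnit e hij hjl, ← lie_skew]
      exact N.neg_mem (hN j l hjl _ h)
  obtain ⟨m, hmj, hml⟩ := (by decide : ∀ j l : Fin 8, ∃ m, m ≠ j ∧ m ≠ l) j l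
  exact hrow (hcol (hrow h hmj) hml) hkl

theorem mem_of_forall_matrixUnit_mem (h : ∀ i j (hij : i ≠ j), matrixUnit e i j hij ∈ N)
    (A : L₀ V) : A ∈ N := by
  have hU (i j : Fin 8) : ∃ U ∈ N, toMatrixHom e U =
      Matrix.single i j 1 - if i = j then Matrix.single 0 0 1 else 0 := by
    rcases eq_or_ne i j with rfl | hij
    · rcases eq_or_ne i 0 with rfl | hi
      · exact ⟨0, N.zero_mem, by simp⟩
      · refine ⟨_, hN i 0 hi _ (h 0 i hi.symm), ?_⟩
        rw [toMatrixHom_lie_matrixUnit_symm, if_pos rfl]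
    · exact ⟨_, h i j hij, by simp [hij]⟩
  choose U hU hUe using hU
  have hA : A = ∑ i, ∑ j, toMatrixHom e A i j • U i j := by
    apply toMatrixHom_injective e
    have htrace : ∑ i, toMatrixHom e A i i = 0 := trace_toMatrixHom e A
    simp only [map_sum, map_smul, hUe, smul_sub, Finset.sum_sub_distrib, smul_ite, smul_zero,
      Finset.sum_ite_eq, Finset.mem_univ, if_true, ← Finset.sum_smul, htrace, zero_smul, sub_zero]
    simpa using Matrix.matrix_eq_sum_single (toMatrixHom e A)
  rw [hA]
  exact N.sum_mem fun i _ => N.sum_mem fun j _ => N.smul_mem _ (hU i j)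

theorem eq_top_of_lie_matrixUnit_mem (h0 : N ≠ ⊥) : N = ⊤ := by
  obtain ⟨i, j, hij, h⟩ := exists_matrixUnit_mem hN h0
  exact eq_top_iff.mpr fun A _ =>
    mem_of_forall_matrixUnit_mem hN (fun k l hkl => matrixUnit_mem_of_mem hN h hkl) A

end Stable

theorem lie_matrixUnit_symm_ne_zero {i j : Fin 8} (hij : i ≠ j) :
    ⁅matrixUnit e i j hij, matrixUnit e j i hij.symm⁆ ≠ 0 := by
  intro h
  rw [lie_matrixUnit_symm] at h
  have hii := congrFun₂ (congrArg (toMatrixHom e) h) i i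
  simp [hij] at hii

include e in
theorem isSimple_L₀ : LieAlgebra.IsSimple ℂ (L₀ V) where
  eq_bot_or_eq_top I := by
    refine or_iff_not_imp_left.mpr fun hI => ?_
    rw [← LieSubmodule.toSubmodule_eq_top]
    refine eq_top_of_lie_matrixUnit_mem (e := e)
      (fun i j hij A hA => lie_mem_right ℂ _ I _ _ hA) ?_
    rwa [Ne, LieSubmodule.toSubmodule_eq_bot]
  non_abelian h := lie_matrixUnit_symm_ne_zero e zero_ne_one (h.trivial _ _)

end Matrices

/-! ### Grading and simplicity of `𝔤` -/

section Grading

variable (e : Module.Basis (Fin 8) ℂ V) (δ : V [⋀^Fin 8]→ₗ[ℂ] ℂ)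

theorem lie_inl (A : L₀ V) (x : 𝔤 e δ) :
    ⁅inl e δ A, x⁆ = (⁅A, x.1⁆, action (A : Module.End ℂ V) x.2) := by
  refine Prod.ext ?_ ?_
  · change ⁅A, x.1⁆ + bracketBilin e δ 0 x.2 = _
    rw [map_zero, LinearMap.zero_apply, add_zero]
  · change action (A : Module.End ℂ V) x.2 - action (x.1 : Module.End ℂ V) 0 = _
    rw [map_zero, sub_zero]

theorem lie_inl_inr (A : L₀ V) (T : ⋀[ℂ]^4 V) :
    ⁅inl e δ A, inr e δ T⁆ = inr e δ (action (A : Module.End ℂ V) T) := by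
  rw [lie_inl]
  exact Prod.ext (lie_zero A) rfl

theorem lie_inr_inr (S T : ⋀[ℂ]^4 V) :
    ⁅inr e δ S, inr e δ T⁆ = inl e δ (bracketFour e δ S T) := by
  refine Prod.ext ?_ ?_
  · change ⁅(0 : L₀ V), (0 : L₀ V)⁆ + bracketFour e δ S T = bracketFour e δ S T
    rw [lie_zero, zero_add]
  · change actionRep (0 : Module.End ℂ V) T - actionRep (0 : Module.End ℂ V) S = 0
    rw [map_zero, LinearMap.zero_apply, LinearMap.zero_apply, sub_zero]

theorem eq_inl_add_inr (x : 𝔤 e δ) : x = inl e δ x.1 + inr e δ x.2 :=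
  Prod.ext (add_zero x.1).symm (zero_add x.2).symm

theorem grading_zero : grading e δ 0 = LinearMap.range (inl e δ) := if_pos rfl

theorem grading_one : grading e δ 1 = LinearMap.range (inr e δ) := if_neg one_ne_zero

theorem isInternal_grading : DirectSum.IsInternal (grading e δ) := by
  have huniv : (Set.univ : Set (ZMod 2)) = {0, 1} := by
    ext k
    simpa using (by decide : ∀ k : ZMod 2, k = 0 ∨ k = 1) k
  rw [DirectSum.isInternal_submodule_iff_isCompl (grading e δ) zero_ne_one huniv, grading_zero,
    grading_one]
  exact LinearMap.isCompl_range_inl_inr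

variable [IsLieBracket e δ]

theorem lie_inr_inl (A : L₀ V) (T : ⋀[ℂ]^4 V) :
    ⁅inr e δ T, inl e δ A⁆ = inr e δ (-action (A : Module.End ℂ V) T) := by
  rw [← lie_skew, lie_inl_inr, map_neg]

theorem lie_mem_grading_add {i j : ZMod 2} {x y : 𝔤 e δ} (hx : x ∈ grading e δ i)
    (hy : y ∈ grading e δ j) : ⁅x, y⁆ ∈ grading e δ (i + j) := by
  have h01 : ∀ k : ZMod 2, k = 0 ∨ k = 1 := by decide
  rcases h01 i with rfl | rfl <;> rcases h01 j with rfl | rfl <;>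
    simp only [grading_zero, grading_one, add_zero, zero_add, CharTwo.add_self_eq_zero] at hx hy ⊢
    <;> obtain ⟨x, rfl⟩ := hx <;> obtain ⟨y, rfl⟩ := hy
  · exact ⟨_, (lie_inl_inl e δ x y).symm⟩
  · exact ⟨_, (lie_inl_inr e δ x y).symm⟩
  · exact ⟨_, (lie_inr_inl e δ y x).symm⟩
  · exact ⟨_, (lie_inr_inr e δ x y).symm⟩

theorem nonempty_gradedLieAlgebra : Nonempty (GradedLieAlgebra (grading e δ)) :=
  ⟨{ (isInternal_grading e δ).chooseDecomposition with
    bracket_mem _ _ _ _ hx hy := lie_mem_grading_add e δ hx hy }⟩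

end Grading

section Components

variable (e : Module.Basis (Fin 8) ℂ V)

theorem exists_component_ne_zero {T : ⋀[ℂ]^4 V} (hT : T ≠ 0) :
    ∃ i : Fin 4 → Fin 8, StrictMono i ∧ component e T i ≠ 0 := by
  by_contra! h
  refine hT ((e.exteriorPower 4).ext_elem fun s => ?_)
  rw [exteriorPower.basis_repr_apply, map_zero, Finsupp.zero_apply]
  exact h _ (OrderEmbedding.strictMono _)

theorem linearMap_ext_wedge {M : Type*} [AddCommGroup M] [Module ℂ M] {f g : ⋀[ℂ]^4 V →ₗ[ℂ] M}
    (h : ∀ p : Fin 4 → Fin 8, StrictMono p → f (wedge e p) = g (wedge e p)) : f = g :=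
  LinearMap.ext fun T => mem_of_forall_wedge_mem e (N := LinearMap.eqLocus f g) h T

theorem exists_bijective_sumElim {p : Fin 4 → Fin 8} (hp : Function.Injective p) :
    ∃ q : Fin 4 → Fin 8, Function.Bijective (Sum.elim p q) := by
  have hcard : ((Finset.univ.image p)ᶜ).card = 4 := by
    rw [Finset.card_compl, Finset.card_image_of_injective _ hp]
    rfl
  let q := ((Finset.univ.image p)ᶜ).orderEmbOfFin hcard
  have hpq (a b) : p a ≠ q b := fun h => by
    have hb : q b ∈ (Finset.univ.image p)ᶜ := Finset.orderEmbOfFin_mem _ hcard b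
    rw [← h] at hb
    simp at hb
  exact ⟨q, (Fintype.bijective_iff_injective_and_card _).mpr ⟨hp.sumElim q.injective hpq, rfl⟩⟩

theorem vol_basis_ne_zero {δ : V [⋀^Fin 8]→ₗ[ℂ] ℂ} (hδ : δ ≠ 0) {p q : Fin 4 → Fin 8}
    (hpq : Function.Bijective (Sum.elim p q)) :
    vol δ (Sum.elim (fun a => e (p a)) fun a => e (q a)) ≠ 0 := by
  have hvol : vol δ ≠ 0 := (AlternatingMap.domDomCongr_eq_zero_iff _ _).not.mpr hδ
  convert (AlternatingMap.map_basis_ne_zero_iff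
    (e.reindex (Equiv.ofBijective _ hpq).symm) (vol δ)).mpr hvol using 2
  ext (a | a) <;> simp

theorem component_wedge (p i : Fin 4 → Fin 8) :
    component e (wedge e p) i = ((1 : Matrix (Fin 8) (Fin 8) ℂ).submatrix i p).det := by
  rw [wedge, component_ιMulti]
  congr 1
  ext a b
  simp [Module.Basis.toMatrix_apply, Finsupp.single_apply, Matrix.one_apply, eq_comm]

theorem component_wedge_self {p : Fin 4 → Fin 8} (hp : Function.Injective p) :
    component e (wedge e p) p = 1 := by
  rw [component_wedge, Matrix.submatrix_one _ hp, Matrix.det_one]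

theorem component_wedge_eq_zero {p i : Fin 4 → Fin 8} {a : Fin 4} (h : ∀ b, i b ≠ p a) :
    component e (wedge e p) i = 0 := by
  rw [component_wedge]
  exact Matrix.det_eq_zero_of_column_eq_zero a fun b => Matrix.one_apply_ne (h b)

theorem wedge_ne_zero {p : Fin 4 → Fin 8} (hp : Function.Injective p) : wedge e p ≠ 0 := by
  intro h
  have hp1 := component_wedge_self e hp
  rw [h] at hp1
  simp [component] at hp1

theorem eq_of_range_subset {p i : Fin 4 → Fin 8} (hp : StrictMono p) (hi : StrictMono i)
    (h : ∀ a, ∃ b, i b = p a) : p = i := by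
  refine (StrictMono.range_inj hp hi).mp (Set.eq_of_subset_of_ncard_le ?_ ?_)
  · rintro _ ⟨a, rfl⟩
    exact h a
  · rw [Set.ncard_range_of_injective hp.injective, Set.ncard_range_of_injective hi.injective]

theorem coord_contraction_wedge (δ : V [⋀^Fin 8]→ₗ[ℂ] ℂ) {i q p : Fin 4 → Fin 8}
    (hi : StrictMono i) (hiq : Function.Bijective (Sum.elim i q)) (hp : StrictMono p) :
    e.coord (i 0) (contraction δ (fun a => e (q a)) (fun a => e (p a)) (e (i 0))) =
      vol δ (Sum.elim (fun a => e (i a)) fun a => e (q a)) * component e (wedge e p) i := by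
  by_cases hpi : ∀ a, ∃ b, i b = p a
  · obtain rfl := eq_of_range_subset hp hi hpi
    rw [contraction_apply_right δ _ (fun a => e (p a)) 0, component_wedge_self e hp.injective,
      vol_comm]
    simp
  · push Not at hpi
    obtain ⟨a, ha⟩ := hpi
    rw [component_wedge_eq_zero e ha, mul_zero, contraction_apply, map_sum]
    obtain ⟨c | c, hc⟩ := hiq.surjective (p a)
    · exact absurd hc (ha c)
    · refine Finset.sum_eq_zero fun b _ => ?_
      rcases eq_or_ne a b with rfl | hab
      · rw [map_smul, e.coord_apply, e.repr_self, Finsupp.single_eq_of_ne (ha 0), smul_zero]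
      · rw [vol_eq_zero_of_eq δ (a := c) (b := a), zero_smul, map_zero]
        rw [Function.update_of_ne hab]
        exact congrArg e hc

theorem coord_bracketFour_wedge (δ : V [⋀^Fin 8]→ₗ[ℂ] ℂ) {i q : Fin 4 → Fin 8}
    (hi : StrictMono i) (hiq : Function.Bijective (Sum.elim i q)) (T : ⋀[ℂ]^4 V) :
    e.coord (i 0) ((bracketFour e δ T (wedge e q) : Module.End ℂ V) (e (i 0))) =
      (1 / 2 * vol δ (Sum.elim (fun a => e (i a)) fun a => e (q a))) * component e T i := by
  let f : ⋀[ℂ]^4 V →ₗ[ℂ] ℂ :=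
    e.coord (i 0) ∘ₗ LinearMap.applyₗ (e (i 0)) ∘ₗ (L₀ V).toSubmodule.subtype ∘ₗ
      (bracketBilin e δ).flip (wedge e q)
  let g : ⋀[ℂ]^4 V →ₗ[ℂ] ℂ := (1 / 2 * vol δ (Sum.elim (fun a => e (i a)) fun a => e (q a))) •
    exteriorPower.pairingDual ℂ V 4 (exteriorPower.ιMulti ℂ 4 fun a => e.coord (i a))
  suffices hfg : f = g from LinearMap.congr_fun hfg T
  refine linearMap_ext_wedge e fun p hp => ?_
  change e.coord (i 0) ((bracketFour e δ (wedge e p) (wedge e q) : Module.End ℂ V) (e (i 0))) =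
    (1 / 2 * vol δ (Sum.elim (fun a => e (i a)) fun a => e (q a))) * component e (wedge e p) i
  have hbracket : (bracketFour e δ (wedge e p) (wedge e q) : Module.End ℂ V) = _ :=
    coe_bracketFour_ιMulti e δ (fun a => e (p a)) (fun a => e (q a))
  have hne (b) : i 0 ≠ q b :=
    hiq.injective.ne (a₁ := Sum.inl 0) (a₂ := Sum.inr b) Sum.inl_ne_inr
  have hzero : e.coord (i 0)
      (contraction δ (fun a => e (p a)) (fun a => e (q a)) (e (i 0))) = 0 := by
    rw [contraction_apply, map_sum]
    refine Finset.sum_eq_zero fun b _ => ?_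
    rw [map_smul, e.coord_apply, e.repr_self, Finsupp.single_eq_of_ne (hne b), smul_zero]
  rw [hbracket, LinearMap.smul_apply, LinearMap.sub_apply, map_smul, map_sub, hzero,
    coord_contraction_wedge e δ hi hiq hp]
  simp only [smul_eq_mul]
  ring

theorem exists_bracketFour_ne_zero {δ : V [⋀^Fin 8]→ₗ[ℂ] ℂ} (hδ : δ ≠ 0) {T : ⋀[ℂ]^4 V}
    (hT : T ≠ 0) : ∃ U, bracketFour e δ T U ≠ 0 := by
  obtain ⟨i, hi, hTi⟩ := exists_component_ne_zero e hT
  obtain ⟨q, hiq⟩ := exists_bijective_sumElim hi.injective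
  refine ⟨wedge e q, fun h => ?_⟩
  have hcoord := coord_bracketFour_wedge e δ hi hiq T
  rw [h] at hcoord
  simp [hTi, vol_basis_ne_zero e hδ hiq] at hcoord

theorem action_action_matrixUnit {i j : Fin 8} (hij : i ≠ j) (T : ⋀[ℂ]^4 V) :
    action (matrixUnit e i j hij : Module.End ℂ V)
      (action (matrixUnit e i j hij : Module.End ℂ V) T) = 0 := by
  suffices h : action (matrixUnit e i j hij : Module.End ℂ V) ∘ₗ
      action (matrixUnit e i j hij : Module.End ℂ V) = 0 from LinearMap.congr_fun h T
  refine linearMap_ext_wedge e fun p hp => ?_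
  rw [LinearMap.comp_apply, LinearMap.zero_apply]
  by_cases h : ∃ a, p a = j
  · obtain ⟨a, rfl⟩ := h
    rw [action_matrixUnit_wedge e hij hp.injective rfl]
    refine action_matrixUnit_wedge_of_notMem e hij fun b => ?_
    rcases eq_or_ne b a with rfl | hb
    · simpa using hij
    · simpa [hb] using hp.injective.ne hb
  · push Not at h
    rw [action_matrixUnit_wedge_of_notMem e hij h, map_zero]

theorem exists_forall_ne (p : Fin 4 → Fin 8) : ∃ k, ∀ a, p a ≠ k := by
  by_contra! h
  simpa using Fintype.card_le_of_surjective p h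

theorem exists_action_matrixUnit_eq_wedge {p : Fin 4 → Fin 8} (hp : Function.Injective p) :
    ∃ i j, ∃ hij : i ≠ j, ∃ T, action (matrixUnit e i j hij : Module.End ℂ V) T = wedge e p := by
  obtain ⟨k, hk⟩ := exists_forall_ne p
  refine ⟨p 0, k, hk 0, wedge e (Function.update p 0 k), ?_⟩
  rw [action_matrixUnit_wedge e (hk 0) (injective_update hp hk 0) (a := 0) (by simp),
    Function.update_idem, Function.update_eq_self]

end Components

section Simple

variable (e : Module.Basis (Fin 8) ℂ V) {δ : V [⋀^Fin 8]→ₗ[ℂ] ℂ}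

theorem lie_lie_inl_matrixUnit {i j : Fin 8} (hij : i ≠ j) (x : 𝔤 e δ) :
    ⁅inl e δ (matrixUnit e i j hij), ⁅inl e δ (matrixUnit e i j hij), x⁆⁆ =
      inl e δ ((-2 * toMatrixHom e x.1 j i) • matrixUnit e i j hij) := by
  rw [lie_inl, lie_inl]
  exact Prod.ext (lie_lie_matrixUnit e hij x.1) (action_action_matrixUnit e hij x.2)

variable [IsLieBracket e δ]

theorem comap_inl_ne_bot_of_fst_ne_zero {I : LieIdeal ℂ (𝔤 e δ)} {x : 𝔤 e δ} (hx : x ∈ I)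
    (hx0 : x.1 ≠ 0) : I.toSubmodule.comap (inl e δ) ≠ ⊥ := by
  obtain ⟨i, j, hij, h⟩ := exists_toMatrixHom_ne_zero e hx0
  obtain ⟨y, hy, hy0⟩ : ∃ y ∈ I, toMatrixHom e y.1 i j ≠ 0 := by
    refine h.elim (fun h => ⟨x, hx, h⟩) fun h =>
      ⟨⁅inl e δ (matrixUnit e i j hij), x⁆, lie_mem_right ℂ _ I _ _ hx, ?_⟩
    rwa [lie_inl]
  have hmem : (-2 * toMatrixHom e y.1 i j) • matrixUnit e j i hij.symm ∈
      I.toSubmodule.comap (inl e δ) := by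
    rw [Submodule.mem_comap, ← lie_lie_inl_matrixUnit]
    exact lie_mem_right ℂ _ I _ _ (lie_mem_right ℂ _ I _ _ hy)
  refine Submodule.ne_bot_iff _ |>.mpr ⟨_, hmem, smul_ne_zero (by simpa using hy0) fun h => ?_⟩
  simpa using congrFun₂ (congrArg (toMatrixHom e) h) j i

theorem exists_mem_fst_ne_zero (hδ : δ ≠ 0) {I : LieIdeal ℂ (𝔤 e δ)} (hI : I ≠ ⊥) :
    ∃ x ∈ I, x.1 ≠ 0 := by
  obtain ⟨x, hx, hx0⟩ := Submodule.exists_mem_ne_zero_of_ne_bot (p := I.toSubmodule)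
    (by rwa [Ne, LieSubmodule.toSubmodule_eq_bot])
  by_cases hx1 : x.1 = 0
  · obtain ⟨U, hU⟩ := exists_bracketFour_ne_zero e hδ fun hx2 : x.2 = 0 => hx0 (Prod.ext hx1 hx2)
    refine ⟨⁅x, inr e δ U⁆, lie_mem_left ℂ _ I _ _ hx, ?_⟩
    rwa [show x = inr e δ x.2 from Prod.ext hx1 rfl, lie_inr_inr]
  · exact ⟨x, hx, hx1⟩

theorem eq_top_of_forall_inl_mem {I : LieIdeal ℂ (𝔤 e δ)} (h : ∀ A, inl e δ A ∈ I) : I = ⊤ := by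
  have hinr (T : ⋀[ℂ]^4 V) : inr e δ T ∈ I := by
    refine mem_of_forall_wedge_mem e (N := I.toSubmodule.comap (inr e δ)) (fun p hp => ?_) T
    obtain ⟨i, j, hij, T, hT⟩ := exists_action_matrixUnit_eq_wedge e hp.injective
    rw [Submodule.mem_comap, ← hT, ← lie_inl_inr]
    exact lie_mem_left ℂ _ I _ _ (h _)
  rw [← LieSubmodule.toSubmodule_eq_top, eq_top_iff]
  intro x _
  rw [eq_inl_add_inr e δ x]
  exact I.add_mem (h _) (hinr _)

theorem isSimple_𝔤 (hδ : δ ≠ 0) : LieAlgebra.IsSimple ℂ (𝔤 e δ) where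
  eq_bot_or_eq_top I := by
    refine or_iff_not_imp_left.mpr fun hI => ?_
    obtain ⟨x, hx, hx0⟩ := exists_mem_fst_ne_zero e hδ hI
    have hstable (i j) (hij : i ≠ j) (A) (hA : A ∈ I.toSubmodule.comap (inl e δ)) :
        ⁅matrixUnit e i j hij, A⁆ ∈ I.toSubmodule.comap (inl e δ) := by
      rw [Submodule.mem_comap, ← lie_inl_inl]
      exact lie_mem_right ℂ _ I _ _ hA
    have htop :=
      eq_top_of_lie_matrixUnit_mem hstable (comap_inl_ne_bot_of_fst_ne_zero e hx hx0)
    exact eq_top_of_forall_inl_mem e fun A => (htop ▸ trivial :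
      A ∈ I.toSubmodule.comap (inl e δ))
  non_abelian h := by
    refine lie_matrixUnit_symm_ne_zero e (zero_ne_one' (Fin 8)) ?_
    have h0 := h.trivial (inl e δ (matrixUnit e 0 1 zero_ne_one)) (inl e δ (matrixUnit e 1 0
      one_ne_zero))
    rw [lie_inl_inl] at h0
    exact congrArg Prod.fst h0

end Simple

/-! ### Cartan subalgebras and roots -/

section WeightCoordinates

open LieAlgebra LieAlgebra.IsKilling

variable {K L ι : Type*} [Field K] [LieRing L] [LieAlgebra K L] {H : LieSubalgebra K L}
  {μ : ι → Module.Dual K H} {f : ι → Module.Dual K L}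

/-- Linear functionals `f i` on `L` that are semi-invariants of `H`, with non-zero weights `μ i`,
and vanish simultaneously only on `H`. They exhibit an abelian subalgebra `H` as a Cartan
subalgebra whose roots are among the `μ i`. -/
structure IsWeightCoordinates (μ : ι → Module.Dual K H) (f : ι → Module.Dual K L) : Prop where
  apply_lie : ∀ i (a : H) x, f i ⁅(a : L), x⁆ = μ i a * f i x
  weight_ne_zero : ∀ i, μ i ≠ 0
  mem_of_forall_eq_zero : ∀ x, (∀ i, f i x = 0) → x ∈ H

namespace IsWeightCoordinates

theorem eq_zero_of_forall_lie_eq_zero (hf : IsWeightCoordinates μ f) {i : ι} {x : L}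
    (h : ∀ a : H, f i ⁅(a : L), x⁆ = 0) : f i x = 0 := by
  obtain ⟨a, ha⟩ := DFunLike.ne_iff.mp (hf.weight_ne_zero i)
  have hax := h a
  rw [hf.apply_lie] at hax
  exact (mul_eq_zero.mp hax).resolve_left ha

theorem exists_weight_eq [IsLieAbelian H] (hf : IsWeightCoordinates μ f) {α : Module.Dual K H}
    (hα : α ≠ 0) {x : L} (hx : x ≠ 0) (h : ∀ a : H, ⁅(a : L), x⁆ = α a • x) : ∃ i, μ i = α := by
  have hxH : x ∉ H := fun hxH => hα <| LinearMap.ext fun a => by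
    have hax : ⁅(a : L), x⁆ = 0 := congrArg Subtype.val (trivial_lie_zero H H a ⟨x, hxH⟩)
    exact (smul_eq_zero.mp ((h a).symm.trans hax)).resolve_right hx
  obtain ⟨i, hi⟩ := not_forall.mp (mt (hf.mem_of_forall_eq_zero x) hxH)
  refine ⟨i, LinearMap.ext fun a => mul_right_cancel₀ hi ?_⟩
  rw [← hf.apply_lie, h, map_smul, smul_eq_mul]

theorem isCartanSubalgebra [IsLieAbelian H] (hf : IsWeightCoordinates μ f) :
    H.IsCartanSubalgebra where
  nilpotent := inferInstance
  self_normalizing := by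
    refine le_antisymm (fun x hx => hf.mem_of_forall_eq_zero x fun i => ?_) H.le_normalizer
    refine hf.eq_zero_of_forall_lie_eq_zero fun a => hf.eq_zero_of_forall_lie_eq_zero fun b => ?_
    have hax : ⁅(a : L), x⁆ ∈ H := by
      rw [← lie_skew]
      exact H.neg_mem ((H.mem_normalizer_iff x).mp hx a a.2)
    rw [show ⁅(b : L), ⁅(a : L), x⁆⁆ = 0 from
      congrArg Subtype.val (trivial_lie_zero H H b ⟨_, hax⟩), map_zero]

end IsWeightCoordinates

variable [CharZero K] [FiniteDimensional K L] [H.IsCartanSubalgebra] [IsKilling K L]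
  [LieModule.IsTriangularizable K H L]

theorem exists_root_eq {α : Module.Dual K H} (hα : α ≠ 0) {x : L} (hx : x ≠ 0)
    (h : ∀ a : H, ⁅(a : L), x⁆ = α a • x) :
    ∃ χ : H.root, (rootSystem H).root χ = α ∧ x ∈ rootSpace H χ.1 := by
  have hmem : x ∈ rootSpace H α :=
    LieModule.weightSpace_le_genWeightSpace L α ((LieModule.mem_weightSpace α x).mpr h)
  have hbot : rootSpace H α ≠ ⊥ := fun hbot => hx (by simpa [hbot] using hmem)
  refine ⟨⟨⟨α, hbot⟩, ?_⟩, rfl, hmem⟩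
  rw [LieSubalgebra.root, Finset.mem_filter_univ]
  exact fun h0 => hα (LinearMap.ext fun a => congrFun h0 a)

theorem rootSpace_eq_span {α : Module.Dual K H} (hα : α ≠ 0) {x : L} (hx : x ≠ 0)
    (h : ∀ a : H, ⁅(a : L), x⁆ = α a • x) :
    (rootSpace H α).toSubmodule = Submodule.span K {x} := by
  obtain ⟨χ, rfl, hxχ⟩ := exists_root_eq hα hx h
  have hrank := finrank_rootSpace_eq_one χ.1 (Finset.mem_filter.mp χ.2).2
  refine le_antisymm (fun y hy => ?_) ((Submodule.span_singleton_le_iff_mem ..).mpr hxχ)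
  obtain ⟨c, hc⟩ := (finrank_eq_one_iff_of_nonzero' (⟨x, hxχ⟩ : rootSpace H χ.1)
    (by simpa using hx)).mp hrank ⟨y, hy⟩
  exact Submodule.mem_span_singleton.mpr ⟨c, congrArg Subtype.val hc⟩

theorem IsWeightCoordinates.range_root [IsLieAbelian H] (hf : IsWeightCoordinates μ f) {x : ι → L}
    (hx0 : ∀ i, x i ≠ 0) (hx : ∀ i (a : H), ⁅(a : L), x i⁆ = μ i a • x i) :
    Set.range (rootSystem H).root = Set.range μ := by
  refine Set.Subset.antisymm ?_ ?_
  · rintro _ ⟨χ, rfl⟩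
    obtain ⟨y, hy, hy0⟩ := χ.1.exists_ne_zero
    exact hf.exists_weight_eq ((rootSystem H).ne_zero χ) hy0 fun a =>
      lie_eq_smul_of_mem_rootSpace hy a
  · rintro _ ⟨i, rfl⟩
    obtain ⟨χ, hχ, -⟩ := exists_root_eq (hf.weight_ne_zero i) (hx0 i) (hx i)
    exact ⟨χ, hχ⟩

end WeightCoordinates

section Diagonal

variable (e : Module.Basis (Fin 8) ℂ V)

theorem mem_diag {A : L₀ V} : A ∈ diag e ↔ (toMatrixHom e A).IsDiag := Iff.rfl

theorem apply_basis_of_mem_diag {A : L₀ V} (hA : A ∈ diag e) (k : Fin 8) :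
    (A : Module.End ℂ V) (e k) = toMatrixHom e A k k • e k := by
  conv_lhs => rw [← Matrix.toLin_toMatrix e e (A : Module.End ℂ V), Matrix.toLin_self]
  rw [Finset.sum_eq_single k (fun j _ hj => by rw [hA hj, zero_smul]) (by simp)]
  rfl

theorem toMatrixHom_lie_of_mem_diag {A : L₀ V} (hA : A ∈ diag e) (B : L₀ V) (i j : Fin 8) :
    toMatrixHom e ⁅A, B⁆ i j =
      (toMatrixHom e A i i - toMatrixHom e A j j) * toMatrixHom e B i j := by
  rw [toMatrixHom_lie, ← ((mem_diag e).mp hA).diagonal_diag, Matrix.sub_apply,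
    Matrix.diagonal_mul, Matrix.mul_diagonal]
  simp only [Matrix.diag_apply, Matrix.diagonal_apply_eq]
  ring

theorem component_action_of_mem_diag {A : L₀ V} (hA : A ∈ diag e) (T : ⋀[ℂ]^4 V)
    (i : Fin 4 → Fin 8) :
    component e (action (A : Module.End ℂ V) T) i =
      (∑ a, toMatrixHom e A (i a) (i a)) * component e T i := by
  rw [component_action, Finset.sum_mul]
  refine Finset.sum_congr rfl fun a _ => ?_
  rw [Finset.sum_eq_single (i a) (fun s _ hs => by rw [hA hs.symm, zero_mul]) (by simp),
    Function.update_eq_self]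
  rfl

theorem action_wedge_of_mem_diag {A : L₀ V} (hA : A ∈ diag e) (i : Fin 4 → Fin 8) :
    action (A : Module.End ℂ V) (wedge e i) =
      (∑ a, toMatrixHom e A (i a) (i a)) • wedge e i :=
  action_ιMulti_of_eigenvectors fun a => apply_basis_of_mem_diag e hA (i a)

theorem lie_matrixUnit_of_mem_diag {A : L₀ V} (hA : A ∈ diag e) {i j : Fin 8} (hij : i ≠ j) :
    ⁅A, matrixUnit e i j hij⁆ =
      (toMatrixHom e A i i - toMatrixHom e A j j) • matrixUnit e i j hij := by
  refine toMatrixHom_injective e (Matrix.ext fun k l => ?_)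
  rw [toMatrixHom_lie_of_mem_diag e hA, map_smul, toMatrixHom_matrixUnit, Matrix.smul_apply,
    smul_eq_mul]
  by_cases h : i = k ∧ j = l
  · rw [h.1, h.2]
  · rw [Matrix.single_apply_of_ne _ _ _ _ _ h, mul_zero, mul_zero]

theorem lie_eq_zero_of_mem_diag {A B : L₀ V} (hA : A ∈ diag e) (hB : B ∈ diag e) : ⁅A, B⁆ = 0 := by
  refine toMatrixHom_injective e (Matrix.ext fun i j => ?_)
  rw [toMatrixHom_lie_of_mem_diag e hA, map_zero]
  rcases eq_or_ne i j with rfl | hij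
  · simp
  · rw [(mem_diag e).mp hB hij, mul_zero]
    rfl

/-- The element `diag(c₁, …, c₈)` of the diagonal subalgebra of `L₀(V)`. -/
def diagElem₀ (c : Fin 8 → ℂ) (hc : ∑ k, c k = 0) : diag e :=
  ⟨diagOp e c hc, (mem_diag e).mpr <| by
    rw [toMatrixHom_diagOp]
    exact Matrix.isDiag_diagonal c⟩

@[simp]
theorem ε₀_diagElem₀ (c : Fin 8 → ℂ) (hc : ∑ k, c k = 0) (k : Fin 8) :
    ε₀ e k (diagElem₀ e c hc) = c k := by
  change toMatrixHom e (diagOp e c hc) k k = c k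
  rw [toMatrixHom_diagOp, Matrix.diagonal_apply_eq]

theorem ε₀_sub_ne_zero {i j : Fin 8} (hij : i ≠ j) : ε₀ e i - ε₀ e j ≠ 0 := by
  intro h
  have happly := LinearMap.congr_fun h
    (diagElem₀ e (Pi.single i 1 - Pi.single j 1) (by simp))
  norm_num [hij, hij.symm] at happly

theorem lie_matrixUnit_diag {i j : Fin 8} (hij : i ≠ j) (A : diag e) :
    ⁅(A : L₀ V), matrixUnit e i j hij⁆ = (ε₀ e i - ε₀ e j) A • matrixUnit e i j hij :=
  lie_matrixUnit_of_mem_diag e A.2 hij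

theorem matrixUnit_ne_zero {i j : Fin 8} (hij : i ≠ j) : matrixUnit e i j hij ≠ 0 := by
  intro h
  simpa using congrFun₂ (congrArg (toMatrixHom e) h) i j

/-- The positions `(i, j)` off the diagonal; they index the roots `ε_i - ε_j`. -/
abbrev OffDiag : Type := {q : Fin 8 × Fin 8 // q.1 ≠ q.2}

theorem isWeightCoordinates_diag :
    IsWeightCoordinates (fun q : OffDiag => ε₀ e q.1.1 - ε₀ e q.1.2) fun q =>
      Matrix.entryLinearMap ℂ ℂ q.1.1 q.1.2 ∘ₗ (toMatrixHom e : L₀ V →ₗ[ℂ] _) where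
  apply_lie q A B := toMatrixHom_lie_of_mem_diag e A.2 B q.1.1 q.1.2
  weight_ne_zero q := ε₀_sub_ne_zero e q.2
  mem_of_forall_eq_zero _ h i j hij := h ⟨(i, j), hij⟩

instance isLieAbelian_diag : IsLieAbelian (diag e) :=
  ⟨fun A B => Subtype.ext (lie_eq_zero_of_mem_diag e A.2 B.2)⟩

instance isCartanSubalgebra_diag : (diag e).IsCartanSubalgebra :=
  (isWeightCoordinates_diag e).isCartanSubalgebra

theorem range_root_diag [FiniteDimensional ℂ V] [LieAlgebra.IsSimple ℂ (L₀ V)] :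
    Set.range (LieAlgebra.IsKilling.rootSystem (diag e)).root =
      {α | ∃ i j : Fin 8, i ≠ j ∧ α = ε₀ e i - ε₀ e j} := by
  rw [(isWeightCoordinates_diag e).range_root (fun q => matrixUnit_ne_zero e q.2)
    fun q => lie_matrixUnit_diag e q.2]
  ext α
  simp [eq_comm]

variable (δ : V [⋀^Fin 8]→ₗ[ℂ] ℂ)

theorem inl_ne_zero {A : L₀ V} (hA : A ≠ 0) : inl e δ A ≠ 0 := fun h => hA (congrArg Prod.fst h)

theorem inr_ne_zero {T : ⋀[ℂ]^4 V} (hT : T ≠ 0) : inr e δ T ≠ 0 := fun h =>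
  hT (congrArg Prod.snd h)

variable [IsLieBracket e δ]

theorem mem_𝔡 {x : 𝔤 e δ} : x ∈ 𝔡 e δ ↔ x.1 ∈ diag e ∧ x.2 = 0 := by
  refine ⟨?_, fun h => ⟨x.1, h.1, Prod.ext rfl h.2.symm⟩⟩
  rintro ⟨A, hA, rfl⟩
  exact ⟨hA, rfl⟩

theorem coe_𝔡_eq_inl (A : 𝔡 e δ) : (A : 𝔤 e δ) = inl e δ (A : 𝔤 e δ).1 :=
  Prod.ext rfl ((mem_𝔡 e δ).mp A.2).2

theorem coe_𝔡_lie (A : 𝔡 e δ) (x : 𝔤 e δ) :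
    ⁅(A : 𝔤 e δ), x⁆ =
      (⁅(A : 𝔤 e δ).1, x.1⁆, action ((A : 𝔤 e δ).1 : Module.End ℂ V) x.2) := by
  rw [coe_𝔡_eq_inl, lie_inl]
  rfl

/-- The element `diag(c₁, …, c₈)` of `𝔡`. -/
def diagElem (c : Fin 8 → ℂ) (hc : ∑ k, c k = 0) : 𝔡 e δ :=
  ⟨inl e δ (diagOp e c hc), (mem_𝔡 e δ).mpr ⟨(diagElem₀ e c hc).2, rfl⟩⟩

@[simp]
theorem ε_diagElem (c : Fin 8 → ℂ) (hc : ∑ k, c k = 0) (k : Fin 8) :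
    ε e δ k (diagElem e δ c hc) = c k :=
  ε₀_diagElem₀ e c hc k

theorem sum_ε : ∑ k, ε e δ k = 0 := by
  ext A
  rw [LinearMap.sum_apply]
  exact trace_toMatrixHom e (A : 𝔤 e δ).1

theorem ε_sub_ne_zero {i j : Fin 8} (hij : i ≠ j) : ε e δ i - ε e δ j ≠ 0 := by
  intro h
  have happly := LinearMap.congr_fun h
    (diagElem e δ (Pi.single i 1 - Pi.single j 1) (by simp))
  norm_num [hij, hij.symm] at happly

theorem sum_ε_ne_zero {i : Fin 4 → Fin 8} (hi : Function.Injective i) :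
    ∑ a, ε e δ (i a) ≠ 0 := by
  intro h
  obtain ⟨k, hk⟩ := exists_forall_ne i
  have happly := LinearMap.congr_fun h
    (diagElem e δ (Pi.single (i 0) 1 - Pi.single k 1) (by simp))
  simp [Pi.single_apply, hk, hi.eq_iff] at happly

theorem lie_inl_matrixUnit {i j : Fin 8} (hij : i ≠ j) (A : 𝔡 e δ) :
    ⁅(A : 𝔤 e δ), inl e δ (matrixUnit e i j hij)⁆ =
      (ε e δ i - ε e δ j) A • inl e δ (matrixUnit e i j hij) := by
  rw [coe_𝔡_eq_inl, lie_inl_inl, lie_matrixUnit_of_mem_diag e ((mem_𝔡 e δ).mp A.2).1, map_smul]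
  rfl

theorem lie_inr_wedge (i : Fin 4 → Fin 8) (A : 𝔡 e δ) :
    ⁅(A : 𝔤 e δ), inr e δ (wedge e i)⁆ =
      (∑ a : Fin 4, ε e δ (i a)) A • inr e δ (wedge e i) := by
  rw [coe_𝔡_eq_inl, lie_inl_inr, action_wedge_of_mem_diag e ((mem_𝔡 e δ).mp A.2).1, map_smul,
    LinearMap.sum_apply]
  rfl

/-- The coordinate `x ↦ (x.1)^i_j` or `x ↦ (x.2)^{ijkl}` of `𝔤` attached to the root `ε_i - ε_j`
or `ε_i + ε_j + ε_k + ε_l`. -/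
def rootCoord : OffDiag ⊕ {p : Fin 4 → Fin 8 // Function.Injective p} → Module.Dual ℂ (𝔤 e δ)
  | .inl q => Matrix.entryLinearMap ℂ ℂ q.1.1 q.1.2 ∘ₗ (toMatrixHom e : L₀ V →ₗ[ℂ] _) ∘ₗ
      LinearMap.fst ℂ (L₀ V) (⋀[ℂ]^4 V)
  | .inr p => exteriorPower.pairingDual ℂ V 4 (exteriorPower.ιMulti ℂ 4 fun a => e.coord (p.1 a)) ∘ₗ
      LinearMap.snd ℂ (L₀ V) (⋀[ℂ]^4 V)

theorem isWeightCoordinates_rootCoord :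
    IsWeightCoordinates
      (Sum.elim (fun q : OffDiag => ε e δ q.1.1 - ε e δ q.1.2) fun p => ∑ a : Fin 4, ε e δ (p.1 a))
      (rootCoord e δ) where
  apply_lie
    | .inl q, A, x => by
      rw [coe_𝔡_lie]
      exact toMatrixHom_lie_of_mem_diag e ((mem_𝔡 e δ).mp A.2).1 x.1 q.1.1 q.1.2
    | .inr p, A, x => by
      rw [coe_𝔡_lie, Sum.elim_inr, LinearMap.sum_apply]
      exact component_action_of_mem_diag e ((mem_𝔡 e δ).mp A.2).1 x.2 p
  weight_ne_zero
    | .inl q => ε_sub_ne_zero e δ q.2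
    | .inr p => sum_ε_ne_zero e δ p.2
  mem_of_forall_eq_zero x h := by
    refine (mem_𝔡 e δ).mpr ⟨fun i j hij => h (.inl ⟨(i, j), hij⟩), ?_⟩
    by_contra hx
    obtain ⟨p, hp, hxp⟩ := exists_component_ne_zero e hx
    exact hxp (h (.inr ⟨p, hp.injective⟩))

instance isLieAbelian_𝔡 : IsLieAbelian (𝔡 e δ) :=
  ⟨fun A B => Subtype.ext <| by
    obtain ⟨hA, -⟩ := (mem_𝔡 e δ).mp A.2
    obtain ⟨hB, -⟩ := (mem_𝔡 e δ).mp B.2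
    rw [LieSubalgebra.coe_bracket, coe_𝔡_eq_inl, coe_𝔡_eq_inl e δ B, lie_inl_inl,
      lie_eq_zero_of_mem_diag e hA hB, map_zero]
    rfl⟩

instance isCartanSubalgebra_𝔡 : (𝔡 e δ).IsCartanSubalgebra :=
  (isWeightCoordinates_rootCoord e δ).isCartanSubalgebra

theorem range_root_𝔡 [LieAlgebra.IsSimple ℂ (𝔤 e δ)] :
    Set.range (LieAlgebra.IsKilling.rootSystem (𝔡 e δ)).root =
      {α | ∃ i j : Fin 8, i ≠ j ∧ α = ε e δ i - ε e δ j} ∪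
      {α | ∃ i : Fin 4 → Fin 8, Function.Injective i ∧ α = ∑ a : Fin 4, ε e δ (i a)} := by
  rw [(isWeightCoordinates_rootCoord e δ).range_root
    (x := Sum.elim (fun q => inl e δ (matrixUnit e q.1.1 q.1.2 q.2)) fun p => inr e δ (wedge e p))
    (Sum.rec (fun q => inl_ne_zero e δ (matrixUnit_ne_zero e q.2))
      fun p => inr_ne_zero e δ (wedge_ne_zero e p.2))
    (Sum.rec (fun q => lie_inl_matrixUnit e δ q.2) fun p => lie_inr_wedge e δ p),
    Set.Sum.elim_range]
  ext α
  simp [eq_comm]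

end Diagonal

section LieGroup

open VectorField Filter Set
open scoped Topology

/-! ### Lie groups in the chart at the identity -/

variable {E : Type*} [NormedAddCommGroup E] [NormedSpace ℝ E]

theorem hasDerivAt_of_clm_apply_eq [CompleteSpace E] {R : ℝ → E →L[ℝ] E} {R' : E →L[ℝ] E}
    {f l : ℝ → E} {l' : E} {t : ℝ} (hR : HasDerivAt R R' t) (hRt : R t = 1)
    (hl : HasDerivAt l l' t) (h : ∀ᶠ s in 𝓝 t, R s (f s) = l s) :
    HasDerivAt f (l' - R' (l t)) t := by
  have hinv := hasFDerivAt_ringInverse (𝕜 := ℝ) (1 : (E →L[ℝ] E)ˣ)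
  rw [Units.val_one, ← hRt] at hinv
  have hunit : ∀ᶠ s in 𝓝 t, IsUnit (R s) :=
    hR.continuousAt.eventually_mem (Units.isOpen.mem_nhds (hRt ▸ isUnit_one))
  refine (((hinv.comp_hasDerivAt t hR).clm_apply hl).congr_deriv ?_).congr_of_eventuallyEq ?_
  · simp [hRt, neg_add_eq_sub]
  · filter_upwards [h, hunit] with s hs hu
    change f s = Ring.inverse (R s) (l s)
    rw [← hs, ← mul_apply_eq_comp, Ring.inverse_mul_cancel _ hu,
      one_apply_eq_self]

variable {G : Type*} [TopologicalSpace G] [ChartedSpace E G] [Group G]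

local notation "chartAtOne" => extChartAt 𝓘(ℝ, E) (1 : G)

variable (E G) in
/-- The multiplication of a Lie group, in the chart at `1`. -/
def chartMul (p : E × E) : E :=
  chartAtOne ((chartAtOne).symm p.1 * (chartAtOne).symm p.2)

variable (E G) in
/-- The coordinates of `1`, in the chart at `1`. -/
def chartOne : E := chartAtOne 1

variable (E G) in
/-- The differential at `1` of the left translation by the element with coordinates `a`, in the
chart at `1`. -/
def leftDeriv (a : E) : E →L[ℝ] E := fderiv ℝ (fun b => chartMul E G (a, b)) (chartOne E G)

variable (E G) in
/-- The differential at `1` of the right translation by the element with coordinates `a`, in the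
chart at `1`. -/
def rightDeriv (a : E) : E →L[ℝ] E := fderiv ℝ (fun b => chartMul E G (b, a)) (chartOne E G)

variable (E G) in
/-- The second derivative at `(1, 1)` of the multiplication, in the chart at `1`; its antisymmetric
part is the Lie bracket. -/
def chartMulSnd : E × E →L[ℝ] E × E →L[ℝ] E :=
  fderiv ℝ (fderiv ℝ (chartMul E G)) (chartOne E G, chartOne E G)

theorem leftDeriv_eq {a : E} (h : DifferentiableAt ℝ (chartMul E G) (a, chartOne E G)) :
    leftDeriv E G a =
      fderiv ℝ (chartMul E G) (a, chartOne E G) ∘L ContinuousLinearMap.inr ℝ E E :=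
  (h.hasFDerivAt.comp (chartOne E G) (hasFDerivAt_prodMk_right a (chartOne E G))).fderiv

theorem rightDeriv_eq {a : E} (h : DifferentiableAt ℝ (chartMul E G) (chartOne E G, a)) :
    rightDeriv E G a =
      fderiv ℝ (chartMul E G) (chartOne E G, a) ∘L ContinuousLinearMap.inl ℝ E E :=
  (h.hasFDerivAt.comp (f := fun b => (b, a)) (chartOne E G)
    (hasFDerivAt_prodMk_left (chartOne E G) a)).fderiv

variable (E G) in
theorem leftDeriv_chartOne : leftDeriv E G (chartOne E G) = 1 := by
  have h : (fun b => chartMul E G (chartOne E G, b)) =ᶠ[𝓝 (chartOne E G)] id := by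
    filter_upwards [extChartAt_target_mem_nhds (I := 𝓘(ℝ, E)) (1 : G)] with a ha
    simp only [chartMul, chartOne, extChartAt_to_inv, one_mul, id_eq]
    exact (chartAtOne).right_inv ha
  rw [leftDeriv, h.fderiv_eq, fderiv_id]
  rfl

variable (E G) in
theorem rightDeriv_chartOne : rightDeriv E G (chartOne E G) = 1 := by
  have h : (fun b => chartMul E G (b, chartOne E G)) =ᶠ[𝓝 (chartOne E G)] id := by
    filter_upwards [extChartAt_target_mem_nhds (I := 𝓘(ℝ, E)) (1 : G)] with a ha
    simp only [chartMul, chartOne, extChartAt_to_inv, mul_one, id_eq]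
    exact (chartAtOne).right_inv ha
  rw [rightDeriv, h.fderiv_eq, fderiv_id]
  rfl

variable [LieGroup 𝓘(ℝ, E) ∞ G]

theorem mdifferentiable_mul_left (g : G) :
    MDifferentiable 𝓘(ℝ, E) 𝓘(ℝ, E) (fun h : G => g * h) :=
  (contMDiff_mul_left (I := 𝓘(ℝ, E)) (n := ∞)).mdifferentiable (by simp)

theorem mdifferentiable_mul_right (g : G) :
    MDifferentiable 𝓘(ℝ, E) 𝓘(ℝ, E) (fun h : G => h * g) :=
  (contMDiff_mul_right (I := 𝓘(ℝ, E)) (n := ∞)).mdifferentiable (by simp)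

theorem mdifferentiable_conj (g : G) :
    MDifferentiable 𝓘(ℝ, E) 𝓘(ℝ, E) (fun h : G => g * h * g⁻¹) :=
  (mdifferentiable_mul_right g⁻¹).comp (mdifferentiable_mul_left g)

theorem isManifold_infty : IsManifold 𝓘(ℝ, E) ∞ G :=
  LieGroup.toContMDiffMul.toIsManifold

theorem isManifold_one : IsManifold 𝓘(ℝ, E) 1 G :=
  have : IsManifold 𝓘(ℝ, E) ∞ G := isManifold_infty
  IsManifold.of_le (n := ∞) (by simp)

theorem mdifferentiableAt_chartAtOne {g : G} (hg : g ∈ (chartAtOne).source) :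
    MDifferentiableAt 𝓘(ℝ, E) 𝓘(ℝ, E) chartAtOne g :=
  have : IsManifold 𝓘(ℝ, E) 1 G := isManifold_one
  mdifferentiableAt_extChartAt (by rwa [extChartAt_source] at hg)

theorem contMDiffAt_chartAtOne_symm {a : E} (ha : a ∈ (chartAtOne).target) :
    ContMDiffAt 𝓘(ℝ, E) 𝓘(ℝ, E) ∞ (chartAtOne).symm a :=
  have : IsManifold 𝓘(ℝ, E) ∞ G := isManifold_infty
  (contMDiffOn_extChartAt_symm (1 : G)).contMDiffAt
    ((isOpen_extChartAt_target (1 : G)).mem_nhds ha)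

theorem contDiffAt_chartMul_of_mem {p : E × E} (h₁ : p.1 ∈ (chartAtOne).target)
    (h₂ : p.2 ∈ (chartAtOne).target)
    (hp : (chartAtOne).symm p.1 * (chartAtOne).symm p.2 ∈ (chartAtOne).source) :
    ContDiffAt ℝ ∞ (chartMul E G) p := by
  have : IsManifold 𝓘(ℝ, E) ∞ G := isManifold_infty
  have hmul : ContMDiffAt 𝓘(ℝ, E × E) 𝓘(ℝ, E) ∞
      (fun p : E × E => (chartAtOne).symm p.1 * (chartAtOne).symm p.2) p :=
    ((contMDiffAt_chartAtOne_symm h₁).comp p contDiff_fst.contMDiff.contMDiffAt).mul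
      ((contMDiffAt_chartAtOne_symm h₂).comp p contDiff_snd.contMDiff.contMDiffAt)
  rw [extChartAt_source] at hp
  exact ((contMDiffAt_extChartAt' hp).comp p hmul).contDiffAt

variable (E G) in
theorem eventually_contDiffAt_chartMul :
    ∀ᶠ p in 𝓝 (chartOne E G, chartOne E G), ContDiffAt ℝ ∞ (chartMul E G) p := by
  have : IsTopologicalGroup G := topologicalGroup_of_lieGroup 𝓘(ℝ, E) ∞
  have hsymm : ContinuousAt (chartAtOne).symm (chartOne E G) := continuousAt_extChartAt_symm 1
  have hmul : ContinuousAt (fun p : E × E => (chartAtOne).symm p.1 * (chartAtOne).symm p.2)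
      (chartOne E G, chartOne E G) :=
    (hsymm.comp' (x := (chartOne E G, chartOne E G)) continuousAt_fst).mul
      (hsymm.comp' (x := (chartOne E G, chartOne E G)) continuousAt_snd)
  have htarget : (chartAtOne).target ∈ 𝓝 (chartOne E G) := extChartAt_target_mem_nhds 1
  have hsource : (chartAtOne).source ∈
      𝓝 ((chartAtOne).symm (chartOne E G) * (chartAtOne).symm (chartOne E G)) := by
    simp only [chartOne, extChartAt_to_inv, mul_one]
    exact extChartAt_source_mem_nhds 1
  filter_upwards [prod_mem_nhds htarget htarget, hmul.eventually_mem hsource] with p hp hp'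
  exact contDiffAt_chartMul_of_mem hp.1 hp.2 hp'

variable (E G) in
theorem eventually_contDiffAt_chartMul_left :
    ∀ᶠ a in 𝓝 (chartOne E G), ContDiffAt ℝ ∞ (chartMul E G) (a, chartOne E G) :=
  (Continuous.prodMk_left (chartOne E G)).continuousAt.eventually
    (eventually_contDiffAt_chartMul E G)

variable (E G) in
theorem eventually_contDiffAt_chartMul_right :
    ∀ᶠ a in 𝓝 (chartOne E G), ContDiffAt ℝ ∞ (chartMul E G) (chartOne E G, a) :=
  (Continuous.prodMk_right (chartOne E G)).continuousAt.eventually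
    (eventually_contDiffAt_chartMul E G)

variable (E G) in
theorem hasFDerivAt_fderiv_chartMul :
    HasFDerivAt (fderiv ℝ (chartMul E G)) (chartMulSnd E G) (chartOne E G, chartOne E G) :=
  (((eventually_contDiffAt_chartMul E G).self_of_nhds.fderiv_right (m := 1)
    (by rw [one_add_one_eq_two]; exact ENat.LEInfty.out)).differentiableAt
    one_ne_zero).hasFDerivAt

theorem chartMulSnd_comm (p q : E × E) : chartMulSnd E G p q = chartMulSnd E G q p :=
  (eventually_contDiffAt_chartMul E G).self_of_nhds.isSymmSndFDerivAt
    (by rw [minSmoothness_of_isRCLikeNormedField]; exact ENat.LEInfty.out) p q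

variable (E G) in
theorem hasFDerivAt_leftDeriv :
    HasFDerivAt (leftDeriv E G) (ContinuousLinearMap.precomp E (ContinuousLinearMap.inr ℝ E E) ∘L
      chartMulSnd E G ∘L ContinuousLinearMap.inl ℝ E E) (chartOne E G) := by
  refine ((ContinuousLinearMap.hasFDerivAt _).comp _
    ((hasFDerivAt_fderiv_chartMul E G).comp (f := fun a => (a, chartOne E G)) _
      (hasFDerivAt_prodMk_left _ _))).congr_of_eventuallyEq ?_
  filter_upwards [eventually_contDiffAt_chartMul_left E G] with a ha
  exact leftDeriv_eq (ha.differentiableAt (by simp))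

variable (E G) in
theorem hasFDerivAt_rightDeriv :
    HasFDerivAt (rightDeriv E G) (ContinuousLinearMap.precomp E (ContinuousLinearMap.inl ℝ E E) ∘L
      chartMulSnd E G ∘L ContinuousLinearMap.inr ℝ E E) (chartOne E G) := by
  refine ((ContinuousLinearMap.hasFDerivAt _).comp _
    ((hasFDerivAt_fderiv_chartMul E G).comp _
      (hasFDerivAt_prodMk_right _ _))).congr_of_eventuallyEq ?_
  filter_upwards [eventually_contDiffAt_chartMul_right E G] with a ha
  exact rightDeriv_eq (ha.differentiableAt (by simp))

theorem mfderiv_chartAtOne_comp_mul_left {g : G} (hg : g ∈ (chartAtOne).source) (x : E) :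
    mfderiv 𝓘(ℝ, E) 𝓘(ℝ, E) (chartAtOne ∘ (g * ·)) (1 : G) x =
      leftDeriv E G (chartAtOne g) x := by
  have hd : MDifferentiableAt 𝓘(ℝ, E) 𝓘(ℝ, E) (chartAtOne ∘ (g * ·)) (1 : G) :=
    MDifferentiableAt.comp (I' := 𝓘(ℝ, E)) _
      (mdifferentiableAt_chartAtOne (by rwa [mul_one])) (mdifferentiable_mul_left g _)
  rw [hd.mfderiv, modelWithCornersSelf_coe, range_id, fderivWithin_univ]
  simp only [leftDeriv, chartMul, (chartAtOne).left_inv hg]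
  rfl

theorem mfderiv_chartAtOne_comp_mul_right {g : G} (hg : g ∈ (chartAtOne).source) (x : E) :
    mfderiv 𝓘(ℝ, E) 𝓘(ℝ, E) (chartAtOne ∘ (· * g)) (1 : G) x =
      rightDeriv E G (chartAtOne g) x := by
  have hd : MDifferentiableAt 𝓘(ℝ, E) 𝓘(ℝ, E) (chartAtOne ∘ (· * g)) (1 : G) :=
    MDifferentiableAt.comp (I' := 𝓘(ℝ, E)) _
      (mdifferentiableAt_chartAtOne (by rwa [one_mul])) (mdifferentiable_mul_right g _)
  rw [hd.mfderiv, modelWithCornersSelf_coe, range_id, fderivWithin_univ]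
  simp only [rightDeriv, chartMul, (chartAtOne).left_inv hg]
  rfl

theorem mfderiv_chartAtOne_mulInvariantVectorField {g : G} (hg : g ∈ (chartAtOne).source)
    (x : GroupLieAlgebra 𝓘(ℝ, E) G) :
    mfderiv 𝓘(ℝ, E) 𝓘(ℝ, E) chartAtOne g (mulInvariantVectorField x g) =
      leftDeriv E G (chartAtOne g) x :=
  (mfderiv_comp_apply_of_eq (1 : G) (mdifferentiableAt_chartAtOne hg) (mdifferentiable_mul_left g 1)
    (mul_one g) x).symm.trans (mfderiv_chartAtOne_comp_mul_left hg x)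

theorem mpullbackWithin_mulInvariantVectorField {a : E} (ha : a ∈ (chartAtOne).target)
    (x : GroupLieAlgebra 𝓘(ℝ, E) G) :
    mpullbackWithin 𝓘(ℝ, E) 𝓘(ℝ, E) (chartAtOne).symm
      (mulInvariantVectorField x) (range 𝓘(ℝ, E)) a = leftDeriv E G a x := by
  have : IsManifold 𝓘(ℝ, E) 1 G := isManifold_one
  have hinv := ContinuousLinearMap.inverse_eq
    (mfderivWithin_extChartAt_symm_comp_mfderiv_extChartAt ha)
    (mfderiv_extChartAt_comp_mfderivWithin_extChartAt_symm ha)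
  have hleft := mfderiv_chartAtOne_mulInvariantVectorField ((chartAtOne).map_target ha) x
  rw [(chartAtOne).right_inv ha] at hleft
  exact (congrArg (fun f => f (mulInvariantVectorField x ((chartAtOne).symm a))) hinv).trans hleft

theorem lie_eq_chartMulSnd (x y : GroupLieAlgebra 𝓘(ℝ, E) G) :
    ⁅x, y⁆ = chartMulSnd E G (x, 0) (0, y) - chartMulSnd E G (y, 0) (0, x) := by
  have : IsManifold 𝓘(ℝ, E) 1 G := isManifold_one
  let field (z : GroupLieAlgebra 𝓘(ℝ, E) G) : E → E :=
    mpullbackWithin 𝓘(ℝ, E) 𝓘(ℝ, E) (chartAtOne).symm (mulInvariantVectorField z) (range 𝓘(ℝ, E))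
  have hfield (z : GroupLieAlgebra 𝓘(ℝ, E) G) :
      field z =ᶠ[𝓝 (chartOne E G)] fun a => leftDeriv E G a z := by
    filter_upwards [extChartAt_target_mem_nhds (I := 𝓘(ℝ, E)) (1 : G)] with a ha
    exact mpullbackWithin_mulInvariantVectorField ha z
  have hderiv (z : E) : fderiv ℝ (fun a => leftDeriv E G a z) (chartOne E G) =
      (chartMulSnd E G).flip (0, z) ∘L ContinuousLinearMap.inl ℝ E E := by
    rw [((hasFDerivAt_leftDeriv E G).clm_apply (hasFDerivAt_const z _)).fderiv]
    ext
    simp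
  have hbracket : lieBracketWithin ℝ (field x) (field y)
      ((chartAtOne).symm ⁻¹' univ ∩ range 𝓘(ℝ, E)) (chartOne E G) =
      chartMulSnd E G (x, 0) (0, y) - chartMulSnd E G (y, 0) (0, x) := by
    rw [preimage_univ, univ_inter, modelWithCornersSelf_coe, range_id, lieBracketWithin_univ,
      (hfield x).lieBracket_vectorField_eq (hfield y), lieBracket, hderiv y, hderiv x,
      leftDeriv_chartOne]
    rfl
  have hinv : (mfderiv 𝓘(ℝ, E) 𝓘(ℝ, E) chartAtOne (1 : G)).inverse =
      ContinuousLinearMap.id ℝ E := by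
    rw [mfderiv_extChartAt_self]
    exact ContinuousLinearMap.inverse_id
  exact (congrArg (fun f : E →L[ℝ] E => f _) hinv).trans hbracket

end LieGroup

section LieGroup

open VectorField Filter Set
open scoped Topology

/-! ### One-parameter subgroups and the adjoint representation -/

variable {E : Type*} [NormedAddCommGroup E] [NormedSpace ℝ E]
  {G : Type*} [TopologicalSpace G] [ChartedSpace E G]

theorem mfderiv_of_eq_id {f : G → G} (hf : f = id) (g : G) (x : E) :
    mfderiv 𝓘(ℝ, E) 𝓘(ℝ, E) f g x = x := by
  subst hf
  exact congrArg (fun L : E →L[ℝ] E => L x) (mfderiv_id (I := 𝓘(ℝ, E)) (x := g))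

variable [Group G]

local notation "chartAtOne" => extChartAt 𝓘(ℝ, E) (1 : G)

theorem Ad_one (y : GroupLieAlgebra 𝓘(ℝ, E) G) : Ad (1 : G) y = y :=
  mfderiv_of_eq_id (E := E) (by ext; simp) 1 y

theorem mulInvariantVectorField_one (x : GroupLieAlgebra 𝓘(ℝ, E) G) :
    mulInvariantVectorField x (1 : G) = x :=
  mfderiv_of_eq_id (E := E) (by ext; simp) 1 x

theorem IsOneParameterSubgroup.map_zero {γ : ℝ → G} {x : GroupLieAlgebra 𝓘(ℝ, E) G}
    (h : IsOneParameterSubgroup γ x) : γ 0 = 1 := by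
  simpa using h.map_add 0 0

theorem IsOneParameterSubgroup.hasDerivAt_chartAtOne {γ : ℝ → G} {x : GroupLieAlgebra 𝓘(ℝ, E) G}
    (h : IsOneParameterSubgroup γ x) : HasDerivAt (fun t => chartAtOne (γ t)) (x : E) 0 := by
  have hd : MDifferentiableAt 𝓘(ℝ, ℝ) 𝓘(ℝ, E) γ 0 := h.contMDiff.mdifferentiable (by simp) 0
  have hw : writtenInExtChartAt 𝓘(ℝ, ℝ) 𝓘(ℝ, E) 0 γ = fun t => chartAtOne (γ t) := by
    ext t
    simp only [writtenInExtChartAt, h.map_zero]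
    rfl
  let L : ℝ →L[ℝ] E := mfderiv 𝓘(ℝ, ℝ) 𝓘(ℝ, E) γ 0
  have hL : HasFDerivWithinAt (writtenInExtChartAt 𝓘(ℝ, ℝ) 𝓘(ℝ, E) 0 γ) L (range 𝓘(ℝ, ℝ)) 0 :=
    hd.hasMFDerivAt.2
  rw [hw, modelWithCornersSelf_coe, range_id, hasFDerivWithinAt_univ] at hL
  exact hL.hasDerivAt.congr_deriv h.velocity

variable [LieGroup 𝓘(ℝ, E) ∞ G]

theorem Ad_mul (g h : G) (y : GroupLieAlgebra 𝓘(ℝ, E) G) : Ad (g * h) y = Ad g (Ad h y) := by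
  have hconj : (fun y : G => g * h * y * (g * h)⁻¹) =
      (fun y : G => g * y * g⁻¹) ∘ fun y : G => h * y * h⁻¹ := by
    ext
    simp [mul_assoc]
  rw [Ad, hconj]
  exact mfderiv_comp_apply_of_eq (1 : G) (mdifferentiable_conj g 1) (mdifferentiable_conj h 1)
    (by simp) y

theorem rightDeriv_Ad {g : G} (hg : g ∈ (chartAtOne).source) (y : GroupLieAlgebra 𝓘(ℝ, E) G) :
    rightDeriv E G (chartAtOne g) (Ad g y) = leftDeriv E G (chartAtOne g) y := by
  have hconj : (chartAtOne ∘ (g * ·)) = (chartAtOne ∘ (· * g)) ∘ fun y : G => g * y * g⁻¹ := by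
    ext
    simp
  have hd : MDifferentiableAt 𝓘(ℝ, E) 𝓘(ℝ, E) (chartAtOne ∘ (· * g)) (1 : G) :=
    MDifferentiableAt.comp (I' := 𝓘(ℝ, E)) _
      (mdifferentiableAt_chartAtOne (by rwa [one_mul])) (mdifferentiable_mul_right g _)
  refine (mfderiv_chartAtOne_comp_mul_right hg _).symm.trans
    (Eq.trans ?_ (mfderiv_chartAtOne_comp_mul_left hg y))
  rw [hconj]
  exact (mfderiv_comp_apply_of_eq (1 : G) hd (mdifferentiable_conj g 1) (by simp) y).symm

theorem hasDerivAt_of_rightDeriv_eq_leftDeriv [CompleteSpace E] {α f : ℝ → E} {v w : E}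
    (hα : HasDerivAt α v 0) (hα0 : α 0 = chartOne E G)
    (hf : ∀ᶠ t in 𝓝 0, rightDeriv E G (α t) (f t) = leftDeriv E G (α t) w) :
    HasDerivAt f (chartMulSnd E G (v, 0) (0, w) - chartMulSnd E G (w, 0) (0, v)) 0 := by
  have hright := hasFDerivAt_rightDeriv E G
  have hleft := hasFDerivAt_leftDeriv E G
  rw [← hα0] at hright hleft
  have hR := hright.comp_hasDerivAt (0 : ℝ) hα
  have hL := (hleft.comp_hasDerivAt (0 : ℝ) hα).clm_apply (hasDerivAt_const (0 : ℝ) w)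
  have hR1 : rightDeriv E G (α 0) = 1 := by rw [hα0, rightDeriv_chartOne]
  have hL1 : leftDeriv E G (α 0) = 1 := by rw [hα0, leftDeriv_chartOne]
  refine (hasDerivAt_of_clm_apply_eq hR hR1 hL hf).congr_deriv ?_
  rw [chartMulSnd_comm (w, 0)]
  simp [hL1]

theorem IsOneParameterSubgroup.hasDerivAt_Ad_zero [CompleteSpace E] {γ : ℝ → G}
    {x : GroupLieAlgebra 𝓘(ℝ, E) G} (h : IsOneParameterSubgroup γ x)
    (y : GroupLieAlgebra 𝓘(ℝ, E) G) :
    HasDerivAt (fun t => (Ad (γ t) y : E)) (⁅x, y⁆ : GroupLieAlgebra 𝓘(ℝ, E) G) 0 := by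
  have hsource : ∀ᶠ t in 𝓝 (0 : ℝ), γ t ∈ (chartAtOne).source :=
    h.contMDiff.continuous.continuousAt.eventually_mem
      (by rw [h.map_zero]; exact extChartAt_source_mem_nhds 1)
  have hγ0 : chartAtOne (γ 0) = chartOne E G := by rw [h.map_zero]; rfl
  refine HasDerivAt.congr_deriv (F := E) (hasDerivAt_of_rightDeriv_eq_leftDeriv (E := E) (w := y)
    h.hasDerivAt_chartAtOne hγ0 ?_) (lie_eq_chartMulSnd x y).symm
  filter_upwards [hsource] with t ht using rightDeriv_Ad ht y

theorem IsOneParameterSubgroup.hasDerivAt_Ad [CompleteSpace E] {γ : ℝ → G}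
    {x : GroupLieAlgebra 𝓘(ℝ, E) G} (h : IsOneParameterSubgroup γ x)
    (y : GroupLieAlgebra 𝓘(ℝ, E) G) (t : ℝ) :
    HasDerivAt (fun t => (Ad (γ t) y : E))
      (⁅x, Ad (γ t) y⁆ : GroupLieAlgebra 𝓘(ℝ, E) G) t := by
  have h₀ : HasDerivAt (F := E) (fun s => Ad (γ s) (Ad (γ t) y))
      (⁅x, Ad (γ t) y⁆ : GroupLieAlgebra 𝓘(ℝ, E) G) (t - t) := by
    rw [sub_self]
    exact h.hasDerivAt_Ad_zero (Ad (γ t) y)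
  refine (h₀.comp_sub_const t t).congr_of_eventuallyEq (Eventually.of_forall fun s => ?_)
  change Ad (γ s) y = Ad (γ (s - t)) (Ad (γ t) y)
  rw [← Ad_mul, ← h.map_add, sub_add_cancel]

theorem IsOneParameterSubgroup.Ad_eq [CompleteSpace E] {γ : ℝ → G}
    {x : GroupLieAlgebra 𝓘(ℝ, E) G} (h : IsOneParameterSubgroup γ x)
    {w : ℝ → GroupLieAlgebra 𝓘(ℝ, E) G}
    (hw : ∀ t, HasDerivAt (F := E) w (⁅x, w t⁆ : GroupLieAlgebra 𝓘(ℝ, E) G) t) (t : ℝ) :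
    Ad (γ t) (w 0) = w t := by
  let adx : E →L[ℝ] E := chartMulSnd E G ((x : E), (0 : E)) ∘L ContinuousLinearMap.inr ℝ E E -
    (chartMulSnd E G).flip ((0 : E), (x : E)) ∘L ContinuousLinearMap.inl ℝ E E
  have hadx : ∀ y : GroupLieAlgebra 𝓘(ℝ, E) G,
      (⁅x, y⁆ : GroupLieAlgebra 𝓘(ℝ, E) G) = adx y := lie_eq_chartMulSnd x
  exact congrFun (ODE_solution_unique_univ (E := E) (v := fun _ => adx) (s := fun _ => univ)
    (t₀ := 0) (f := fun t => Ad (γ t) (w 0)) (g := w) (fun _ => adx.lipschitz.lipschitzOnWith)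
    (fun t => ⟨hadx (Ad (γ t) (w 0)) ▸ h.hasDerivAt_Ad (w 0) t, mem_univ _⟩)
    (fun t => ⟨hadx (w t) ▸ hw t, mem_univ _⟩)
    (by rw [h.map_zero]; exact Ad_one (w 0))) t

/-! ### Existence of the exponential map -/

theorem mulInvariantVectorField_mul (g h : G) (x : GroupLieAlgebra 𝓘(ℝ, E) G) :
    mulInvariantVectorField x (g * h) =
      mfderiv 𝓘(ℝ, E) 𝓘(ℝ, E) (g * ·) h (mulInvariantVectorField x h) := by
  have hcomp : (fun y : G => g * h * y) = (fun y : G => g * y) ∘ fun y : G => h * y := by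
    ext
    simp [mul_assoc]
  rw [mulInvariantVectorField, hcomp]
  exact mfderiv_comp_apply_of_eq (1 : G) (mdifferentiable_mul_left g h)
    (mdifferentiable_mul_left h 1) (mul_one h) x

theorem isMIntegralCurveOn_mul_left {γ : ℝ → G} {x : GroupLieAlgebra 𝓘(ℝ, E) G} {s : Set ℝ}
    (h : IsMIntegralCurveOn γ (mulInvariantVectorField x) s) (g : G) :
    IsMIntegralCurveOn (fun t => g * γ t) (mulInvariantVectorField x) s := by
  intro t ht
  refine ((mdifferentiable_mul_left (E := E) g (γ t)).hasMFDerivAt.comp_hasMFDerivWithinAt t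
    (h t ht)).congr_mfderiv ?_
  ext
  let L : E →L[ℝ] E := mfderiv 𝓘(ℝ, E) 𝓘(ℝ, E) (fun y : G => g * y) (γ t)
  exact (L.map_smul (1 : ℝ) (mulInvariantVectorField x (γ t) : E)).trans
    (congrArg (fun z : E => (1 : ℝ) • z) (mulInvariantVectorField_mul g (γ t) x)).symm

theorem contMDiff_mulInvariantVectorField_one (x : GroupLieAlgebra 𝓘(ℝ, E) G) :
    ContMDiff 𝓘(ℝ, E) 𝓘(ℝ, E).tangent 1
      (fun g : G => (⟨g, mulInvariantVectorField x g⟩ : TangentBundle 𝓘(ℝ, E) G)) := by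
  have : LieGroup 𝓘(ℝ, E) (minSmoothness ℝ 3) G := by
    rw [minSmoothness_of_isRCLikeNormedField]
    infer_instance
  refine (contMDiff_mulInvariantVectorField x).of_le ?_
  rw [minSmoothness_of_isRCLikeNormedField]
  exact one_le_two

/- A local integral curve through `1`, translated to any other point, gives integral curves on an
interval of fixed length, so it extends to all times. -/
theorem exists_isMIntegralCurve [CompleteSpace E] [T2Space G] (x : GroupLieAlgebra 𝓘(ℝ, E) G) :
    ∃ γ : ℝ → G, γ 0 = 1 ∧ IsMIntegralCurve γ (mulInvariantVectorField x) := by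
  have : IsManifold 𝓘(ℝ, E) 1 G := isManifold_one
  obtain ⟨γ, hγ0, hγ⟩ := exists_isMIntegralCurveAt_of_contMDiffAt_boundaryless (I := 𝓘(ℝ, E)) 0
    ((contMDiff_mulInvariantVectorField_one x) 1)
  obtain ⟨r, hr, hball⟩ := isMIntegralCurveAt_iff'.mp hγ
  rw [Real.ball_eq_Ioo, zero_sub, zero_add] at hball
  exact exists_isMIntegralCurve_of_isMIntegralCurveOn
    (contMDiff_mulInvariantVectorField_one x) hr
    (fun g => ⟨fun t => g * γ t, by simp [hγ0], isMIntegralCurveOn_mul_left hball g⟩) 1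

theorem map_add_of_isMIntegralCurve [CompleteSpace E] [T2Space G] {γ : ℝ → G}
    {x : GroupLieAlgebra 𝓘(ℝ, E) G} (hγ : IsMIntegralCurve γ (mulInvariantVectorField x))
    (hγ0 : γ 0 = 1) (s t : ℝ) : γ (s + t) = γ s * γ t := by
  have : IsManifold 𝓘(ℝ, E) 1 G := isManifold_one
  have hmul : IsMIntegralCurve (fun t => γ s * γ t) (mulInvariantVectorField x) := by
    rw [isMIntegralCurve_iff_isMIntegralCurveOn]
    exact isMIntegralCurveOn_mul_left (hγ.isMIntegralCurveOn _) _
  have heq := isMIntegralCurve_Ioo_eq_of_contMDiff_boundaryless (t₀ := 0)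
    (contMDiff_mulInvariantVectorField_one x) (hγ.comp_add s) hmul (by simp [hγ0])
  rw [add_comm]
  exact congrFun heq t

theorem hasDerivAt_chartAtOne_of_isMIntegralCurve {γ : ℝ → G} {x : GroupLieAlgebra 𝓘(ℝ, E) G}
    (hγ : IsMIntegralCurve γ (mulInvariantVectorField x)) {t : ℝ}
    (ht : γ t ∈ (chartAtOne).source) :
    HasDerivAt (fun t => chartAtOne (γ t)) (leftDeriv E G (chartAtOne (γ t)) x) t := by
  have hcomp := HasMFDerivAt.comp t (mdifferentiableAt_chartAtOne ht).hasMFDerivAt (hγ t)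
  let M : E →L[ℝ] E := mfderiv 𝓘(ℝ, E) 𝓘(ℝ, E) chartAtOne (γ t)
  let L : ℝ →L[ℝ] E := M ∘L (1 : ℝ →L[ℝ] ℝ).smulRight (mulInvariantVectorField x (γ t) : E)
  have hL : HasFDerivAt (fun t => chartAtOne (γ t)) L t := hasMFDerivAt_iff_hasFDerivAt.mp hcomp
  refine hL.hasDerivAt.congr_deriv
    (Eq.trans ?_ (mfderiv_chartAtOne_mulInvariantVectorField ht x))
  exact congrArg M (one_smul ℝ (mulInvariantVectorField x (γ t) : E))

variable (G) in
theorem eventually_contDiffAt_leftDeriv (x : E) :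
    ∀ᶠ a in 𝓝 (chartOne E G), ContDiffAt ℝ ∞ (fun a => leftDeriv E G a x) a := by
  have hmul := eventually_contDiffAt_chartMul_left E G
  filter_upwards [hmul, hmul.eventually_nhds] with a ha hnhds
  have hfderiv : ContDiffAt ℝ ∞ (fun a => fderiv ℝ (chartMul E G) (a, chartOne E G)) a :=
    (ha.fderiv_right (by simp)).comp (f := fun a => (a, chartOne E G)) a (by fun_prop)
  refine ((hfderiv.clm_apply contDiffAt_const).congr_of_eventuallyEq
    (f := fun a => fderiv ℝ (chartMul E G) (a, chartOne E G) (0, x)) ?_)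
  filter_upwards [hnhds] with b hb
  rw [leftDeriv_eq (hb.differentiableAt (by simp))]
  rfl

/- In the chart, `γ` solves an autonomous differential equation with smooth right-hand side. -/
theorem contMDiffAt_zero_of_isMIntegralCurve [CompleteSpace E] {γ : ℝ → G}
    {x : GroupLieAlgebra 𝓘(ℝ, E) G} (hγ : IsMIntegralCurve γ (mulInvariantVectorField x))
    (hγ0 : γ 0 = 1) : ContMDiffAt 𝓘(ℝ, ℝ) 𝓘(ℝ, E) ∞ γ 0 := by
  let α : ℝ → E := fun t => chartAtOne (γ t)
  have hα0 : α 0 = chartOne E G := by simp only [α, hγ0]; rfl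
  have hsource : ∀ᶠ t in 𝓝 (0 : ℝ), γ t ∈ (chartAtOne).source :=
    hγ.continuous.continuousAt.eventually_mem (by rw [hγ0]; exact extChartAt_source_mem_nhds 1)
  have hderiv : ∀ t, γ t ∈ (chartAtOne).source → HasDerivAt α (leftDeriv E G (α t) x) t :=
    fun t ht => hasDerivAt_chartAtOne_of_isMIntegralCurve hγ ht
  obtain ⟨u, hu, huo, hu0⟩ :=
    eventually_nhds_iff.mp (eventually_contDiffAt_leftDeriv (E := E) G x)
  have hαu : ∀ᶠ t in 𝓝 (0 : ℝ), α t ∈ u :=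
    (hderiv 0 hsource.self_of_nhds).continuousAt.eventually_mem (huo.mem_nhds (by rwa [hα0]))
  obtain ⟨r, hr, hball⟩ := Metric.eventually_nhds_iff.mp (hsource.and hαu)
  have hIcc : ∀ t ∈ Icc (-(r / 2)) (r / 2), γ t ∈ (chartAtOne).source ∧ α t ∈ u := fun t ht =>
    hball (by rw [Real.dist_0_eq_abs]; exact (abs_le.mpr ht).trans_lt (half_lt_self hr))
  have hα : ContDiffOn ℝ ∞ α (Icc (-(r / 2)) (r / 2)) :=
    ODE.contDiffOn_enat_Icc_of_hasDerivWithinAt (E := E) (n := ⊤)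
      (f := fun _ a => leftDeriv E G a x)
      (fun p hp => ((hu p.2 hp.2).comp p contDiffAt_snd).contDiffWithinAt)
      (fun t ht => (hderiv t (hIcc t ht).1).hasDerivWithinAt) fun t ht => (hIcc t ht).2
  have hαt : ContDiffAt ℝ ∞ α 0 := hα.contDiffAt (Icc_mem_nhds (by linarith) (by linarith))
  have hsymm : ContMDiffAt 𝓘(ℝ, E) 𝓘(ℝ, E) ∞ (chartAtOne).symm (α 0) :=
    contMDiffAt_chartAtOne_symm ((chartAtOne).map_source hsource.self_of_nhds)
  refine (hsymm.comp 0 hαt.contMDiffAt).congr_of_eventuallyEq ?_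
  filter_upwards [hsource] with t ht
  exact ((chartAtOne).left_inv ht).symm

theorem exists_isOneParameterSubgroup [CompleteSpace E] [T2Space G]
    (x : GroupLieAlgebra 𝓘(ℝ, E) G) : ∃ γ : ℝ → G, IsOneParameterSubgroup γ x := by
  obtain ⟨γ, hγ0, hγ⟩ := exists_isMIntegralCurve x
  have hadd := map_add_of_isMIntegralCurve hγ hγ0
  refine ⟨γ, hadd, fun s => ?_, ?_⟩
  · have hshift : ContMDiffAt 𝓘(ℝ, ℝ) 𝓘(ℝ, E) ∞ (fun t => γ (t - s)) s :=
      ContMDiffAt.comp_of_eq (contMDiffAt_zero_of_isMIntegralCurve hγ hγ0)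
        (contDiff_id.sub contDiff_const).contMDiff.contMDiffAt (sub_self s)
    have hγs : γ = fun t => γ s * γ (t - s) := by
      ext t
      rw [← hadd, add_sub_cancel]
    rw [hγs]
    exact (contMDiff_mul_left (I := 𝓘(ℝ, E)) (n := ∞) (a := γ s)).contMDiffAt.comp s hshift
  · have hγ1 : mfderiv 𝓘(ℝ, ℝ) 𝓘(ℝ, E) γ 0 (1 : ℝ) = (1 : ℝ) • mulInvariantVectorField x (γ 0) :=
      congrArg (fun f : ℝ →L[ℝ] E => f 1) (hγ 0).mfderiv
    have hγx : ∀ g : G, g = 1 → (mulInvariantVectorField x g : E) = x := by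
      rintro _ rfl
      exact mulInvariantVectorField_one x
    exact hγ1.trans ((one_smul ℝ (mulInvariantVectorField x (γ 0) : E)).trans (hγx _ hγ0))

end LieGroup

/-! ### Linear flows on four-vectors -/

section Flow

variable {κ : Type*} [Finite κ] (e : Module.Basis κ ℂ V)

theorem hasDerivAt_multilinearMap {ι W F : Type*} [Fintype ι] [DecidableEq ι] [AddCommGroup W]
    [Module ℂ W] [NormedAddCommGroup F] [NormedSpace ℝ F]
    (f : MultilinearMap ℂ (fun _ : ι => V) W) (ψ : W →ₗ[ℝ] F) {c : ι → ℝ → V} {c' : ι → V} {t : ℝ}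
    (hc : ∀ a k, HasDerivAt (fun t => e.coord k (c a t)) (e.coord k (c' a)) t) :
    HasDerivAt (fun t => ψ (f fun a => c a t))
      (ψ (∑ a, f (Function.update (fun b => c b t) a (c' a)))) t := by
  have := Fintype.ofFinite κ
  let L (q : ι → κ) : ℂ →L[ℝ] F := LinearMap.toContinuousLinearMap
    (ψ ∘ₗ ((LinearMap.toSpanSingleton ℂ W (f fun i => e (q i))).restrictScalars ℝ))
  have hcoord (v : ι → V) : ψ (f v) = ∑ q : ι → κ, L q (∏ a, e.coord (q a) (v a)) := by
    rw [apply_eq_sum_basis e f v, map_sum]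
    rfl
  have hsum : HasDerivAt (fun t => ∑ q : ι → κ, L q (∏ a, e.coord (q a) (c a t)))
      (∑ q : ι → κ, L q (∑ a, (∏ b ∈ Finset.univ.erase a, e.coord (q b) (c b t)) •
        e.coord (q a) (c' a))) t :=
    HasDerivAt.fun_sum fun q _ => (L q).hasFDerivAt.comp_hasDerivAt t
      (HasDerivAt.fun_finsetProd fun a _ => hc a (q a))
  refine (hsum.congr_deriv ?_).congr_of_eventuallyEq (.of_forall fun s => hcoord _)
  simp only [map_sum, hcoord]
  rw [Finset.sum_comm]
  refine Finset.sum_congr rfl fun a _ => Finset.sum_congr rfl fun q _ => congrArg (L q) ?_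
  rw [← Finset.mul_prod_erase _ _ (Finset.mem_univ a), Function.update_self, smul_eq_mul, mul_comm]
  congr 1
  refine Finset.prod_congr rfl fun b hb => ?_
  rw [Function.update_of_ne (Finset.ne_of_mem_erase hb)]

/-- `u t` is a fundamental solution of the linear equation `v' = A v`, that is `u t = exp (t A)`.
The space `V` carries no norm, so the equation is stated in the coordinates of a basis. -/
structure IsFlow (A : Module.End ℂ V) (u : ℝ → Module.End ℂ V) : Prop where
  map_zero : u 0 = 1
  hasDerivAt : ∀ v k t, HasDerivAt (fun t => e.coord k (u t v)) (e.coord k (A (u t v))) t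

variable {e} {A : Module.End ℂ V} {u : ℝ → Module.End ℂ V}

theorem IsFlow.hasDerivAt_map (h : IsFlow e A u) {F : Type*} [NormedAddCommGroup F]
    [NormedSpace ℝ F] (ψ : ⋀[ℂ]^4 V →ₗ[ℝ] F) (T : ⋀[ℂ]^4 V) (t : ℝ) :
    HasDerivAt (fun t => ψ (exteriorPower.map 4 (u t) T))
      (ψ (action A (exteriorPower.map 4 (u t) T))) t := by
  have hT : T ∈ Submodule.span ℂ (Set.range (exteriorPower.ιMulti ℂ 4 (M := V))) :=
    exteriorPower.ιMulti_span ℂ 4 V ▸ Submodule.mem_top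
  induction hT using Submodule.span_induction generalizing ψ with
  | mem _ hv =>
    obtain ⟨v, rfl⟩ := hv
    simp only [exteriorPower.map_apply_ιMulti, action_ιMulti_eq_sum]
    exact hasDerivAt_multilinearMap e (exteriorPower.ιMulti ℂ 4).toMultilinearMap ψ
      fun a k => h.hasDerivAt (v a) k t
  | zero => simpa using hasDerivAt_const t (0 : F)
  | add S T _ _ hS hT =>
    simp only [map_add]
    exact (hS ψ).add (hT ψ)
  | smul c T _ hT =>
    simp only [map_smul]
    exact hT (ψ ∘ₗ (LinearMap.lsmul ℂ (⋀[ℂ]^4 V) c).restrictScalars ℝ)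

theorem IsFlow.hasDerivAt_det (h : IsFlow e A u) (t : ℝ) :
    HasDerivAt (fun t => LinearMap.det (u t)) (LinearMap.trace ℂ V A * LinearMap.det (u t)) t := by
  classical
  have := Fintype.ofFinite κ
  have hdet (s : ℝ) : LinearMap.det (u s) = e.det fun a => u s (e a) := by
    have h := e.det_comp (u s) e
    rw [e.det_self, mul_one] at h
    exact h.symm
  have htrace : ∑ a, e.det (Function.update (fun b => u t (e b)) a (A (u t (e a)))) =
      LinearMap.trace ℂ V A * LinearMap.det (u t) := by
    rw [← derivation_apply e.det A fun b => u t (e b), derivation_eq_trace_smul e, hdet]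
    rfl
  rw [← htrace]
  exact (hasDerivAt_multilinearMap e e.det.toMultilinearMap (LinearMap.id (R := ℝ) (M := ℂ))
    fun a k => h.hasDerivAt (e a) k t).congr_of_eventuallyEq (.of_forall hdet)

theorem IsFlow.det_eq_one (h : IsFlow e A u) (hA : LinearMap.trace ℂ V A = 0) (t : ℝ) :
    LinearMap.det (u t) = 1 := by
  have hderiv (t : ℝ) : HasDerivAt (fun t => LinearMap.det (u t)) 0 t := by
    simpa only [hA, zero_mul] using h.hasDerivAt_det t
  rw [is_const_of_deriv_eq_zero (fun t => (hderiv t).differentiableAt) (fun t => (hderiv t).deriv)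
    t 0, h.map_zero, map_one]

variable (e)

section Coordinates

variable {κ : Type*} [Fintype κ] [DecidableEq κ] (e : Module.Basis κ ℂ V)

theorem isFlow_toLin {M : Matrix κ κ ℂ} {u : ℝ → Matrix κ κ ℂ} (h0 : u 0 = 1)
    (h : ∀ i j t, HasDerivAt (fun t => u t i j) ((M * u t) i j) t) :
    IsFlow e (Matrix.toLin e e M) fun t => Matrix.toLin e e (u t) where
  map_zero := by
    rw [h0, Matrix.toLin_one]
    rfl
  hasDerivAt v k t := by
    have hcoord (N : Matrix κ κ ℂ) (v : V) :
        e.coord k (Matrix.toLin e e N v) = ∑ j, N k j * e.coord j v := by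
      rw [Matrix.toLin_apply, map_sum]
      simp [Matrix.mulVec, dotProduct, Finsupp.single_apply]
    rw [← Matrix.toLin_mul_apply]
    simp only [hcoord]
    exact HasDerivAt.fun_sum fun j _ => (h k j t).mul_const _

theorem isFlow_transvection {i j : κ} (hij : i ≠ j) (c : ℂ) :
    IsFlow e (Matrix.toLin e e (Matrix.single i j c)) fun t =>
      Matrix.toLin e e (Matrix.transvection i j (t • c)) := by
  refine isFlow_toLin e (by simp) fun k l t => ?_
  have hmul : Matrix.single i j c * Matrix.transvection i j (t • c) = Matrix.single i j c := by
    rw [Matrix.transvection, mul_add, mul_one, Matrix.single_mul_single_of_ne _ _ _ _ hij.symm,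
      add_zero]
  have hentry (s : ℝ) : Matrix.transvection i j (s • c) k l =
      (1 : Matrix κ κ ℂ) k l + s • Matrix.single i j c k l := by
    rw [Matrix.transvection, Matrix.add_apply, ← Matrix.smul_single, Matrix.smul_apply]
  simp only [hmul, hentry]
  simpa using ((hasDerivAt_id t).smul_const (Matrix.single i j c k l)).const_add
    ((1 : Matrix κ κ ℂ) k l)

theorem isFlow_diagonal (c : κ → ℂ) :
    IsFlow e (Matrix.toLin e e (Matrix.diagonal c)) fun t =>
      Matrix.toLin e e (Matrix.diagonal fun k => Complex.exp (t * c k)) := by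
  refine isFlow_toLin e (by simp) fun k l t => ?_
  rw [Matrix.diagonal_mul_diagonal]
  rcases eq_or_ne k l with rfl | hkl
  · simp only [Matrix.diagonal_apply_eq]
    simpa [mul_comm] using ((Complex.ofRealCLM.hasDerivAt (x := t)).mul_const (c k)).cexp
  · simpa only [Matrix.diagonal_apply_ne _ hkl] using hasDerivAt_const t (0 : ℂ)

end Coordinates

theorem exists_isFlow (A : Module.End ℂ V) : ∃ u, IsFlow e A u := by
  classical
  have := Fintype.ofFinite κ
  let _ : NormedRing (Matrix κ κ ℂ) := Matrix.linftyOpNormedRing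
  let _ : NormedAlgebra ℝ (Matrix κ κ ℂ) := Matrix.linftyOpNormedAlgebra
  rw [← Matrix.toLin_toMatrix e e A]
  refine ⟨_, isFlow_toLin e (u := fun t => NormedSpace.exp (t • LinearMap.toMatrix e e A))
    (by simp) fun i j t => ?_⟩
  let entry : Matrix κ κ ℂ →ₗ[ℝ] ℂ := Matrix.entryLinearMap ℝ ℂ i j
  exact (LinearMap.toContinuousLinearMap entry).hasFDerivAt.comp_hasDerivAt t
    (hasDerivAt_exp_smul_const' (𝕂 := ℝ) (LinearMap.toMatrix e e A) t)

end Flow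

theorem exists_exp_eq_of_prod_eq_one {κ : Type*} [Fintype κ] {D : κ → ℂ}
    (hD : ∏ k, D k = 1) : ∃ c : κ → ℂ, ∑ k, c k = 0 ∧ ∀ k, Complex.exp (c k) = D k := by
  classical
  rcases isEmpty_or_nonempty κ with _ | ⟨⟨k₀⟩⟩
  · exact ⟨0, by simp, isEmptyElim⟩
  have hD0 (k : κ) : D k ≠ 0 := Finset.prod_ne_zero_iff.mp (hD ▸ one_ne_zero) k (Finset.mem_univ k)
  rw [← Finset.mul_prod_erase _ _ (Finset.mem_univ k₀)] at hD
  refine ⟨Function.update (fun k => Complex.log (D k)) k₀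
    (-∑ k ∈ Finset.univ.erase k₀, Complex.log (D k)), ?_, fun k => ?_⟩
  · rw [Finset.sum_update_of_mem (Finset.mem_univ k₀), ← Finset.erase_eq, neg_add_cancel]
  · rcases eq_or_ne k k₀ with rfl | hk
    · rw [Function.update_self, Complex.exp_neg, Complex.exp_sum,
        Finset.prod_congr rfl fun j _ => Complex.exp_log (hD0 j), eq_inv_of_mul_eq_one_left hD]
    · rw [Function.update_of_ne hk, Complex.exp_log (hD0 k)]

theorem exists_specialLinearGroup_toLinearMap_eq {K W : Type*} [Field K] [AddCommGroup W]
    [Module K W] [FiniteDimensional K W] {f : Module.End K W} (hf : LinearMap.det f = 1) :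
    ∃ a : SpecialLinearGroup K W, (a : W ≃ₗ[K] W).toLinearMap = f := by
  have hunit : IsUnit (LinearMap.det f) := hf ▸ isUnit_one
  refine ⟨⟨LinearMap.equivOfIsUnitDet hunit, ?_⟩, ?_⟩
  · ext
    simp [hf]
  · ext
    simp

/-! ### Orbits of four-vectors -/

section Orbits

variable (e : Module.Basis (Fin 8) ℂ V) (δ : V [⋀^Fin 8]→ₗ[ℂ] ℂ)
  {E : Type*} [NormedAddCommGroup E] [NormedSpace ℝ E]
  {G : Type*} [TopologicalSpace G] [ChartedSpace E G] [Group G]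
  (φ : GroupLieAlgebra 𝓘(ℝ, E) G ≃ₗ[ℝ] 𝔤 e δ)

/-- The adjoint action of `g` on the image of `⋀⁴V` in the Lie algebra of `G` is the natural action
of the operator `f`. -/
def ActsAs (g : G) (f : Module.End ℂ V) : Prop :=
  ∀ T : ⋀[ℂ]^4 V, φ (Ad g (φ.symm (inr e δ T))) = inr e δ (exteriorPower.map 4 f T)

variable {e δ φ}

theorem actsAs_one : ActsAs e δ φ 1 1 := fun T => by
  rw [Ad_one, LinearEquiv.apply_symm_apply, Module.End.one_eq_id, exteriorPower.map_id]
  rfl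

variable [LieGroup 𝓘(ℝ, E) ∞ G]

theorem ActsAs.mul {g h : G} {a b : Module.End ℂ V} (hg : ActsAs e δ φ g a)
    (hh : ActsAs e δ φ h b) : ActsAs e δ φ (g * h) (a * b) := fun T => by
  rw [Ad_mul, ← φ.symm_apply_apply (Ad h _), hh T, hg, Module.End.mul_eq_comp,
    exteriorPower.map_comp]
  rfl

theorem ActsAs.inv {g : G} {a b : Module.End ℂ V} (hg : ActsAs e δ φ g a) (hab : a * b = 1) :
    ActsAs e δ φ g⁻¹ b := fun T => by
  have hT : exteriorPower.map 4 a (exteriorPower.map 4 b T) = T := by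
    rw [← LinearMap.comp_apply, ← exteriorPower.map_comp, ← Module.End.mul_eq_comp, hab,
      Module.End.one_eq_id, exteriorPower.map_id, LinearMap.id_apply]
  conv_lhs => rw [← hT, ← hg]
  rw [φ.symm_apply_apply, ← Ad_mul, inv_mul_cancel, Ad_one, φ.apply_symm_apply]

variable [CompleteSpace E]

theorem actsAs_of_isFlow (hφ : ∀ x y, φ ⁅x, y⁆ = ⁅φ x, φ y⁆) {γ : ℝ → G}
    {x : GroupLieAlgebra 𝓘(ℝ, E) G} (hγ : IsOneParameterSubgroup γ x) {A : L₀ V}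
    (hx : φ x = inl e δ A) {u : ℝ → Module.End ℂ V} (hu : IsFlow e (A : Module.End ℂ V) u) :
    ActsAs e δ φ (γ 1) (u 1) := by
  intro T
  let ψ : ⋀[ℂ]^4 V →ₗ[ℝ] E := φ.symm.toLinearMap ∘ₗ (inr e δ).restrictScalars ℝ
  have hlie (S : ⋀[ℂ]^4 V) :
      ⁅x, φ.symm (inr e δ S)⁆ = φ.symm (inr e δ (action (A : Module.End ℂ V) S)) := by
    rw [← lie_inl_inr, LinearEquiv.eq_symm_apply, hφ, hx, LinearEquiv.apply_symm_apply]
  have hw (t : ℝ) : HasDerivAt (F := E)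
      (fun t => φ.symm (inr e δ (exteriorPower.map 4 (u t) T)))
      (⁅x, φ.symm (inr e δ (exteriorPower.map 4 (u t) T))⁆ : GroupLieAlgebra 𝓘(ℝ, E) G) t := by
    rw [hlie]
    exact hu.hasDerivAt_map ψ T t
  have hAd := hγ.Ad_eq hw 1
  rw [hu.map_zero, Module.End.one_eq_id, exteriorPower.map_id, LinearMap.id_apply] at hAd
  rw [hAd, LinearEquiv.apply_symm_apply]

theorem exists_specialLinearGroup_actsAs (hφ : ∀ x y, φ ⁅x, y⁆ = ⁅φ x, φ y⁆) {g : G}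
    (hg : g ∈ connectedSubgroup (φ ⁻¹' Set.range (inl e δ))) :
    ∃ a : SpecialLinearGroup ℂ V, ActsAs e δ φ g (a : V ≃ₗ[ℂ] V).toLinearMap := by
  have : FiniteDimensional ℂ V := e.finiteDimensional_of_finite
  induction hg using Subgroup.closure_induction with
  | mem g hg =>
    obtain ⟨x, ⟨A, hA⟩, γ, hγ, rfl⟩ := hg
    obtain ⟨u, hu⟩ := exists_isFlow e (A : Module.End ℂ V)
    obtain ⟨a, ha⟩ := exists_specialLinearGroup_toLinearMap_eq (hu.det_eq_one A.2 1)
    exact ⟨a, ha ▸ actsAs_of_isFlow hφ hγ hA.symm hu⟩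
  | one => exact ⟨1, actsAs_one⟩
  | mul g h _ _ hg hh =>
    obtain ⟨a, ha⟩ := hg
    obtain ⟨b, hb⟩ := hh
    exact ⟨a * b, ha.mul hb⟩
  | inv g _ hg =>
    obtain ⟨a, ha⟩ := hg
    exact ⟨a⁻¹, ha.inv (LinearMap.ext fun v => LinearEquiv.apply_symm_apply a.1 v)⟩

variable [T2Space G]

theorem exists_mem_actsAs_of_isFlow (hφ : ∀ x y, φ ⁅x, y⁆ = ⁅φ x, φ y⁆)
    {A : Module.End ℂ V} (hA : LinearMap.trace ℂ V A = 0) {u : ℝ → Module.End ℂ V}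
    (hu : IsFlow e A u) :
    ∃ g ∈ connectedSubgroup (φ ⁻¹' Set.range (inl e δ)), ActsAs e δ φ g (u 1) := by
  obtain ⟨γ, hγ⟩ := exists_isOneParameterSubgroup (φ.symm (inl e δ ⟨A, hA⟩))
  have hx := φ.apply_symm_apply (inl e δ ⟨A, hA⟩)
  exact ⟨γ 1, Subgroup.subset_closure ⟨_, ⟨_, hx.symm⟩, γ, hγ, rfl⟩, actsAs_of_isFlow hφ hγ hx hu⟩

theorem exists_mem_actsAs_diagonal (hφ : ∀ x y, φ ⁅x, y⁆ = ⁅φ x, φ y⁆) {D : Fin 8 → ℂ}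
    (hD : ∏ k, D k = 1) : ∃ g ∈ connectedSubgroup (φ ⁻¹' Set.range (inl e δ)),
      ActsAs e δ φ g (Matrix.toLin e e (Matrix.diagonal D)) := by
  obtain ⟨c, hc, hexp⟩ := exists_exp_eq_of_prod_eq_one hD
  have htr : LinearMap.trace ℂ V (Matrix.toLin e e (Matrix.diagonal c)) = 0 := by
    rw [Matrix.trace_toLin_eq, Matrix.trace_diagonal, hc]
  simpa only [Complex.ofReal_one, one_mul, hexp] using
    exists_mem_actsAs_of_isFlow hφ htr (isFlow_diagonal e c)

theorem exists_mem_actsAs_transvection (hφ : ∀ x y, φ ⁅x, y⁆ = ⁅φ x, φ y⁆) {i j : Fin 8}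
    (hij : i ≠ j) (c : ℂ) : ∃ g ∈ connectedSubgroup (φ ⁻¹' Set.range (inl e δ)),
      ActsAs e δ φ g (Matrix.toLin e e (Matrix.transvection i j c)) := by
  have htr : LinearMap.trace ℂ V (Matrix.toLin e e (Matrix.single i j c)) = 0 := by
    rw [Matrix.trace_toLin_eq, Matrix.trace_single_eq_of_ne _ _ _ hij]
  simpa only [one_smul] using exists_mem_actsAs_of_isFlow hφ htr (isFlow_transvection e hij c)

theorem exists_mem_actsAs_of_det_eq_one (hφ : ∀ x y, φ ⁅x, y⁆ = ⁅φ x, φ y⁆)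
    {f : Module.End ℂ V} (hf : LinearMap.det f = 1) :
    ∃ g ∈ connectedSubgroup (φ ⁻¹' Set.range (inl e δ)), ActsAs e δ φ g f := by
  rw [← LinearMap.det_toMatrix e] at hf
  rw [← Matrix.toLin_toMatrix e e f]
  refine Matrix.diagonal_transvection_induction (fun M => ∃ g ∈ connectedSubgroup
    (φ ⁻¹' Set.range (inl e δ)), ActsAs e δ φ g (Matrix.toLin e e M)) _ (fun D hD => ?_)
    (fun t => exists_mem_actsAs_transvection hφ t.hij t.c) ?_
  · exact exists_mem_actsAs_diagonal hφ (by rw [← Matrix.det_diagonal, hD, hf])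
  · rintro M N ⟨g, hg, hgM⟩ ⟨h, hh, hhN⟩
    rw [Matrix.toLin_mul e e e]
    exact ⟨g * h, mul_mem hg hh, hgM.mul hhN⟩

omit [CompleteSpace E] in
theorem orbit_eq [FiniteDimensional ℝ E] (hφ : ∀ x y, φ ⁅x, y⁆ = ⁅φ x, φ y⁆) (T : ⋀[ℂ]^4 V) :
    {x | ∃ g ∈ connectedSubgroup (φ ⁻¹' Set.range (inl e δ)),
        φ (Ad g (φ.symm (inr e δ T))) = x} =
      {x | ∃ a : SpecialLinearGroup ℂ V,
        inr e δ (exteriorPower.map 4 (a : V ≃ₗ[ℂ] V).toLinearMap T) = x} := by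
  have : CompleteSpace E := FiniteDimensional.complete ℝ E
  ext x
  constructor
  · rintro ⟨g, hg, rfl⟩
    obtain ⟨a, ha⟩ := exists_specialLinearGroup_actsAs hφ hg
    exact ⟨a, (ha T).symm⟩
  · rintro ⟨a, rfl⟩
    obtain ⟨g, hg, ha⟩ := exists_mem_actsAs_of_det_eq_one hφ a.det_eq_one
    exact ⟨g, hg, ha T⟩

end Orbits

/-! ### Cartan matrices -/

section Killing

open LieAlgebra LieAlgebra.IsKilling

theorem exists_root_coroot_eq {K L : Type*} [Field K] [CharZero K] [LieRing L] [LieAlgebra K L]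
    [FiniteDimensional K L] [IsKilling K L] {H : LieSubalgebra K L} [H.IsCartanSubalgebra]
    [LieModule.IsTriangularizable K H L] {α : Module.Dual K H} {x y : L} {h : H}
    (hx : ∀ a : H, ⁅(a : L), x⁆ = α a • x) (hy : ∀ a : H, ⁅(a : L), y⁆ = -α a • y)
    (hxy : ⁅x, y⁆ = h) (hαh : α h = 2) :
    ∃ χ : H.root, (rootSystem H).root χ = α ∧ coroot χ.1 = h := by
  have hα0 : α ≠ 0 := by
    rintro rfl
    simp at hαh
  have hx0 : x ≠ 0 := by
    rintro rfl
    rw [zero_lie, eq_comm, ZeroMemClass.coe_eq_zero] at hxy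
    simp [hxy] at hαh
  obtain ⟨χ, rfl, hxχ⟩ := exists_root_eq hα0 hx0 hx
  have hyχ : y ∈ rootSpace H (-χ.1) :=
    LieModule.weightSpace_le_genWeightSpace L _ ((LieModule.mem_weightSpace _ y).mpr hy)
  have hmem : h ∈ corootSpace χ.1 :=
    (mem_corootSpace _).mpr (Submodule.subset_span ⟨x, hxχ, y, hyχ, hxy⟩)
  exact ⟨χ, rfl, (eq_coroot_of_mem_corootSpace_of_two χ.1 hmem hαh).symm⟩

variable {L : Type*} [LieRing L] [LieAlgebra ℂ L] [FiniteDimensional ℂ L]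
  [LieAlgebra.IsKilling ℂ L] {H : LieSubalgebra ℂ L} [H.IsCartanSubalgebra]
  {n : ℕ} {C : Matrix (Fin n) (Fin n) ℤ} {χ : Fin n → H.root}

theorem linearIndependent_root_of_det_ne_zero
    (hC : ∀ i j, (rootSystem H).root (χ i) (coroot (χ j).1) = C i j) (hdet : C.det ≠ 0) :
    LinearIndependent ℂ ((rootSystem H).root ∘ χ) := by
  have hdetℂ : (C.map (Int.castRingHom ℂ)).det ≠ 0 := by
    rwa [← RingHom.mapMatrix_apply, ← RingHom.map_det, eq_intCast, Int.cast_ne_zero]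
  rw [Fintype.linearIndependent_iff]
  intro g hg
  refine congrFun (Matrix.eq_zero_of_vecMul_eq_zero hdetℂ (funext fun j => ?_))
  have hgj := LinearMap.congr_fun hg (coroot (χ j).1)
  change ∑ i, g i * (C i j : ℂ) = 0
  simpa only [LinearMap.sum_apply, LinearMap.smul_apply, Function.comp_apply, hC, smul_eq_mul,
    LinearMap.zero_apply] using hgj

theorem hasCartanMatrix_of_roots
    (hC : ∀ i j, (rootSystem H).root (χ i) (coroot (χ j).1) = C i j) (hdet : C.det ≠ 0)
    (hpos : ∀ β ∈ Set.range (rootSystem H).root,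
      β ∈ AddSubmonoid.closure (Set.range ((rootSystem H).root ∘ χ)) ∨
        -β ∈ AddSubmonoid.closure (Set.range ((rootSystem H).root ∘ χ))) :
    HasCartanMatrix H C := by
  have hli := linearIndependent_root_of_det_ne_zero hC hdet
  have hχ : Function.Injective χ := hli.injective.of_comp
  let b : (rootSystem H).Base := RootPairing.Base.mk' (rootSystem H) (Set.range χ)
    ((linearIndependent_equiv (Equiv.ofInjective χ hχ)).mp hli)
    fun i => by simpa only [Set.range_comp] using hpos _ ⟨i, rfl⟩
  let f : Fin n ≃ b.support :=
    (Equiv.ofInjective χ hχ).trans (Set.Finite.subtypeEquivToFinset _)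
  refine ⟨b, f.symm, Matrix.ext fun i j => ?_⟩
  apply Int.cast_injective (α := ℂ)
  rw [← hC, Matrix.reindex_apply, Matrix.submatrix_apply]
  exact b.algebraMap_cartanMatrixIn_apply ℤ (f i) (f j)

end Killing

section Simple

variable {M : Type*} [AddCommGroup M]

theorem sub_mem_of_forall_castSucc_sub_succ_mem {n : ℕ} {ε : Fin (n + 1) → M} {P : AddSubmonoid M}
    (h : ∀ i : Fin n, ε i.castSucc - ε i.succ ∈ P) {i j : Fin (n + 1)} (hij : i ≤ j) :
    ε i - ε j ∈ P := by
  induction j using Fin.induction with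
  | zero => rw [Fin.le_zero_iff.mp hij, sub_self]; exact P.zero_mem
  | succ j ih =>
    rcases hij.eq_or_lt with rfl | hlt
    · rw [sub_self]; exact P.zero_mem
    · rw [← sub_add_sub_cancel _ (ε j.castSucc)]
      exact P.add_mem (ih (Fin.le_castSucc_iff.mpr hlt)) (h j)

/-- The simple roots of type `E₇`, in Bourbaki's numbering, for the root system formed by the
`ε i - ε j` and the sums of four distinct `ε k`, where the eight vectors `ε k` have sum zero. -/
def simpleRootE₇ (ε : Fin 8 → M) : Fin 7 → M :=
  ![ε 6 - ε 7, ε 0 + ε 5 + ε 6 + ε 7, ε 5 - ε 6, ε 4 - ε 5, ε 3 - ε 4, ε 2 - ε 3, ε 1 - ε 2]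

theorem map_simpleRootE₇ {N : Type*} [AddCommGroup N] (f : M →+ N) (ε : Fin 8 → M) (i : Fin 7) :
    f (simpleRootE₇ ε i) = simpleRootE₇ (fun k => f (ε k)) i := by
  fin_cases i <;> simp [simpleRootE₇]

variable {ε : Fin 8 → M} {P : AddSubmonoid M}

theorem sub_mem_of_forall_simpleRootE₇_mem (hε : ∑ k, ε k = 0) (hP : ∀ i, simpleRootE₇ ε i ∈ P)
    {i j : Fin 8} (hij : i ≤ j) : ε i - ε j ∈ P := by
  refine sub_mem_of_forall_castSucc_sub_succ_mem (Fin.cases ?_ fun k => ?_) hij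
  · -- `ε 0 - ε 1` is the highest root of the subsystem `E₆` of the first six simple roots.
    have h : ε 0 - ε 1 = simpleRootE₇ ε 0 + 2 • simpleRootE₇ ε 1 + 2 • simpleRootE₇ ε 2 +
        3 • simpleRootE₇ ε 3 + 2 • simpleRootE₇ ε 4 + simpleRootE₇ ε 5 := by
      rw [Fin.sum_univ_eight] at hε
      simp only [simpleRootE₇, Matrix.cons_val]
      linear_combination (norm := module) (-1 : ℤ) • hε
    change ε 0 - ε 1 ∈ P
    rw [h]
    exact add_mem (add_mem (add_mem (add_mem (add_mem (hP 0) (nsmul_mem (hP 1) 2))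
      (nsmul_mem (hP 2) 2)) (nsmul_mem (hP 3) 3)) (nsmul_mem (hP 4) 2)) (hP 5)
  · fin_cases k
    exacts [hP 6, hP 5, hP 4, hP 3, hP 2, hP 0]

theorem sum_mem_of_forall_simpleRootE₇_mem (hε : ∑ k, ε k = 0) (hP : ∀ i, simpleRootE₇ ε i ∈ P)
    {s : Finset (Fin 8)} (hs : s.card = 4) (h0 : 0 ∈ s) : ∑ k ∈ s, ε k ∈ P := by
  let p := s.orderEmbOfFin hs
  have hp0 : p 0 = 0 :=
    (Finset.orderEmbOfFin_zero hs (by norm_num)).trans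
      (le_antisymm (s.min'_le 0 h0) (Fin.zero_le _))
  have h12 : p 1 < p 2 := p.strictMono (by decide)
  have h23 : p 2 < p 3 := p.strictMono (by decide)
  have hsum : ∑ k ∈ s, ε k =
      simpleRootE₇ ε 1 + (ε (p 1) - ε 5) + (ε (p 2) - ε 6) + (ε (p 3) - ε 7) := by
    rw [← s.map_orderEmbOfFin_univ hs, Finset.sum_map, Fin.sum_univ_four]
    change ε (p 0) + ε (p 1) + ε (p 2) + ε (p 3) = (ε 0 + ε 5 + ε 6 + ε 7) + _ + _ + _
    rw [hp0]
    abel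
  have hsub {i j : Fin 8} (hij : i ≤ j) : ε i - ε j ∈ P :=
    sub_mem_of_forall_simpleRootE₇_mem hε hP hij
  rw [hsum]
  exact add_mem (add_mem (add_mem (hP 1) (hsub (by omega))) (hsub (by omega))) (hsub (by omega))

theorem sum_mem_or_neg_sum_mem_of_forall_simpleRootE₇_mem (hε : ∑ k, ε k = 0)
    (hP : ∀ i, simpleRootE₇ ε i ∈ P) {i : Fin 4 → Fin 8} (hi : Function.Injective i) :
    ∑ a, ε (i a) ∈ P ∨ -∑ a, ε (i a) ∈ P := by
  let s : Finset (Fin 8) := Finset.univ.map ⟨i, hi⟩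
  have hs : s.card = 4 := Finset.card_map _
  have hsum : ∑ a, ε (i a) = ∑ k ∈ s, ε k := (Finset.sum_map Finset.univ ⟨i, hi⟩ ε).symm
  have hneg : -∑ k ∈ s, ε k = ∑ k ∈ sᶜ, ε k := by
    rw [neg_eq_iff_add_eq_zero, Finset.sum_add_sum_compl, hε]
  rw [hsum, hneg]
  by_cases h0 : 0 ∈ s
  · exact .inl (sum_mem_of_forall_simpleRootE₇_mem hε hP hs h0)
  · exact .inr (sum_mem_of_forall_simpleRootE₇_mem hε hP (by rw [Finset.card_compl, hs]; rfl)
      (Finset.mem_compl.mpr h0))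

end Simple

section CartanMatrix

open LieAlgebra.IsKilling

variable (e : Module.Basis (Fin 8) ℂ V)

/-- The traceless part of `e_k ⊗ e^k`. The coroot of a root `∑ n_k ε_k` of `L₀(V)` or `𝔤` is the
same combination `∑ n_k coε_k`. -/
def coε₀ (k : Fin 8) : diag e := diagElem₀ e (Pi.single k 1 - fun _ => 1 / 8) (by simp)

theorem ε₀_coε₀ (i j : Fin 8) : ε₀ e i (coε₀ e j) = (if i = j then 1 else 0) - 1 / 8 := by
  rw [coε₀, ε₀_diagElem₀, Pi.sub_apply, Pi.single_apply]

theorem toMatrixHom_coε₀ (k : Fin 8) :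
    toMatrixHom e (coε₀ e k : diag e) = Matrix.diagonal (Pi.single k 1 - fun _ => 1 / 8) :=
  toMatrixHom_diagOp e _ (by simp)

theorem coe_coε₀_sub (i j : Fin 8) : ((coε₀ e i - coε₀ e j : diag e) : L₀ V) =
    diagOp e (Pi.single i 1 - Pi.single j 1) (by simp) := by
  refine toMatrixHom_injective e ?_
  rw [AddSubgroupClass.coe_sub, map_sub, toMatrixHom_coε₀, toMatrixHom_coε₀, toMatrixHom_diagOp,
    Matrix.diagonal_sub]
  exact congrArg Matrix.diagonal (sub_sub_sub_cancel_right _ _ _)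

theorem exists_root_coroot_eq_ε₀_sub [FiniteDimensional ℂ V] [LieAlgebra.IsSimple ℂ (L₀ V)]
    {i j : Fin 8} (hij : i ≠ j) : ∃ χ : (diag e).root,
      (rootSystem (diag e)).root χ = ε₀ e i - ε₀ e j ∧ coroot χ.1 = coε₀ e i - coε₀ e j := by
  refine exists_root_coroot_eq (lie_matrixUnit_diag e hij) (fun a => ?_)
    ((lie_matrixUnit_symm e hij).trans (coe_coε₀_sub e i j).symm) ?_
  · rw [lie_matrixUnit_diag e hij.symm, ← LinearMap.neg_apply, neg_sub]
  · simp only [map_sub, LinearMap.sub_apply, ε₀_coε₀]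
    norm_num [hij, hij.symm]

theorem cartanMatrix_A_apply {n : ℕ} (i j : Fin n) :
    CartanMatrix.A n i j =
      ((if i.castSucc = j.castSucc then 1 else 0) - if i.castSucc = j.succ then 1 else 0) -
        ((if i.succ = j.castSucc then 1 else 0) - if i.succ = j.succ then 1 else 0) := by
  simp only [CartanMatrix.A, Matrix.of_apply, Fin.ext_iff, Fin.val_castSucc, Fin.val_succ]
  split_ifs <;> omega

theorem det_cartanMatrix_A_seven : (CartanMatrix.A 7).det = 8 := by
  have hA : CartanMatrix.A 7 =
      !![ 2, -1,  0,  0,  0,  0,  0;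
         -1,  2, -1,  0,  0,  0,  0;
          0, -1,  2, -1,  0,  0,  0;
          0,  0, -1,  2, -1,  0,  0;
          0,  0,  0, -1,  2, -1,  0;
          0,  0,  0,  0, -1,  2, -1;
          0,  0,  0,  0,  0, -1,  2] := by decide
  rw [hA]
  simp only [norm_det]

theorem hasCartanMatrix_diag [FiniteDimensional ℂ V] [LieAlgebra.IsSimple ℂ (L₀ V)] :
    HasCartanMatrix (diag e) (CartanMatrix.A 7) := by
  choose χ hroot hcoroot using fun i : Fin 7 =>
    exists_root_coroot_eq_ε₀_sub e (Fin.castSucc_lt_succ (i := i)).ne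
  refine hasCartanMatrix_of_roots (χ := χ) (fun i j => ?_)
    (by rw [det_cartanMatrix_A_seven]; norm_num) ?_
  · rw [hroot, hcoroot, cartanMatrix_A_apply]
    simp only [map_sub, LinearMap.sub_apply, ε₀_coε₀]
    push_cast
    ring
  · have hsimple (i : Fin 7) : ε₀ e i.castSucc - ε₀ e i.succ ∈
        AddSubmonoid.closure (Set.range ((rootSystem (diag e)).root ∘ χ)) :=
      AddSubmonoid.subset_closure ⟨i, hroot i⟩
    rw [range_root_diag]
    rintro _ ⟨i, j, -, rfl⟩
    rw [neg_sub]
    exact (le_total i j).imp (sub_mem_of_forall_castSucc_sub_succ_mem hsimple)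
      (sub_mem_of_forall_castSucc_sub_succ_mem hsimple)

variable (δ : V [⋀^Fin 8]→ₗ[ℂ] ℂ)

theorem sum_coε₀_apply (p : Fin 4 → Fin 8) (k : Fin 8) :
    ((∑ a, coε₀ e (p a) : diag e) : Module.End ℂ V) (e k) =
      ((∑ a, if k = p a then 1 else 0) - 1 / 2 : ℂ) • e k := by
  rw [apply_basis_of_mem_diag e (SetLike.coe_mem _)]
  congr 1
  change ε₀ e k (∑ a, coε₀ e (p a)) = _
  simp only [map_sum, ε₀_coε₀, Finset.sum_sub_distrib, Finset.sum_const]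
  norm_num

theorem bracketFour_wedge_wedge {p q : Fin 4 → Fin 8} (hpq : Function.Bijective (Sum.elim p q)) :
    bracketFour e δ (wedge e p) (wedge e q) =
      vol δ (Sum.elim (fun a => e (p a)) fun a => e (q a)) • (∑ a, coε₀ e (p a) : diag e) := by
  refine Subtype.ext (e.ext fun k => ?_)
  change _ = vol δ _ • ((∑ a, coε₀ e (p a) : diag e) : Module.End ℂ V) (e k)
  rw [sum_coε₀_apply, wedge, wedge, smul_smul]
  obtain ⟨b | b, rfl⟩ := hpq.2 k
  · have hp (a : Fin 4) : p b = p a ↔ b = a :=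
      (hpq.1.comp Sum.inl_injective).eq_iff (a := b) (b := a)
    simp only [Sum.elim_inl, hp, Finset.sum_ite_eq, Finset.mem_univ, if_true]
    rw [bracketFour_apply_left e δ (fun a => e (p a))]
    congr 1
    ring
  · have hp (a : Fin 4) : q b ≠ p a := fun h => Sum.inr_ne_inl (hpq.1 h)
    simp only [Sum.elim_inr, hp, if_false, Finset.sum_const_zero]
    rw [bracketFour_apply_right e δ _ (fun a => e (q a))]
    congr 1
    ring

variable [IsLieBracket e δ]

/-- The element of `𝔡` that corresponds to `coε₀ e k`. -/
def coε (k : Fin 8) : 𝔡 e δ := diagElem e δ (Pi.single k 1 - fun _ => 1 / 8) (by simp)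

theorem ε_coε (i j : Fin 8) : ε e δ i (coε e δ j) = (if i = j then 1 else 0) - 1 / 8 :=
  ε₀_coε₀ e i j

theorem exists_root_coroot_eq_ε_sub [FiniteDimensional ℂ V] [LieAlgebra.IsSimple ℂ (𝔤 e δ)]
    {i j : Fin 8} (hij : i ≠ j) : ∃ χ : (𝔡 e δ).root,
      (rootSystem (𝔡 e δ)).root χ = ε e δ i - ε e δ j ∧
        coroot χ.1 = coε e δ i - coε e δ j := by
  refine exists_root_coroot_eq (lie_inl_matrixUnit e δ hij) (fun a => ?_) ?_ ?_
    (y := inl e δ (matrixUnit e j i hij.symm))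
  · rw [lie_inl_matrixUnit e δ hij.symm, ← LinearMap.neg_apply, neg_sub]
  · rw [lie_inl_inl, lie_matrixUnit_symm e hij, ← coe_coε₀_sub, AddSubgroupClass.coe_sub, map_sub]
    rfl
  · simp only [map_sub, LinearMap.sub_apply, ε_coε]
    norm_num [hij, hij.symm]

theorem exists_root_coroot_eq_sum_ε [FiniteDimensional ℂ V] [LieAlgebra.IsSimple ℂ (𝔤 e δ)]
    (hδ : δ ≠ 0) {p : Fin 4 → Fin 8} (hp : Function.Injective p) : ∃ χ : (𝔡 e δ).root,
      (rootSystem (𝔡 e δ)).root χ = ∑ a, ε e δ (p a) ∧ coroot χ.1 = ∑ a, coε e δ (p a) := by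
  obtain ⟨q, hpq⟩ := exists_bijective_sumElim hp
  have hq : ∑ a, ε e δ (q a) = -∑ a, ε e δ (p a) := by
    rw [eq_neg_iff_add_eq_zero, add_comm, ← sum_ε e δ, ← hpq.sum_comp, Fintype.sum_sum_type]
    rfl
  refine exists_root_coroot_eq (fun a => ?_) (fun a => ?_) ?_ ?_
    (x := inr e δ ((vol δ (Sum.elim (fun a => e (p a)) fun a => e (q a)))⁻¹ • wedge e p))
    (y := inr e δ (wedge e q))
  · rw [map_smul, lie_smul, lie_inr_wedge, smul_comm]
  · rw [lie_inr_wedge, hq, LinearMap.neg_apply]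
  · rw [lie_inr_inr, bracketFour_smul_left, bracketFour_wedge_wedge e δ hpq,
      inv_smul_smul₀ (vol_basis_ne_zero e hδ hpq), AddSubmonoidClass.coe_finsetSum,
      AddSubmonoidClass.coe_finsetSum, map_sum]
    rfl
  · simp only [map_sum, LinearMap.sum_apply, ε_coε, hp.eq_iff, Finset.sum_sub_distrib,
      Finset.sum_const]
    norm_num

theorem exists_root_coroot_eq_simpleRootE₇ [FiniteDimensional ℂ V]
    [LieAlgebra.IsSimple ℂ (𝔤 e δ)] (hδ : δ ≠ 0) (i : Fin 7) : ∃ χ : (𝔡 e δ).root,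
      (rootSystem (𝔡 e δ)).root χ = simpleRootE₇ (ε e δ) i ∧
        coroot χ.1 = simpleRootE₇ (coε e δ) i := by
  have hsub {k l : Fin 8} (hkl : k ≠ l) := exists_root_coroot_eq_ε_sub e δ hkl
  have hsum := exists_root_coroot_eq_sum_ε e δ hδ (p := ![0, 5, 6, 7]) (by decide)
  rw [Fin.sum_univ_four, Fin.sum_univ_four] at hsum
  fin_cases i
  exacts [hsub (by decide), hsum, hsub (by decide), hsub (by decide), hsub (by decide),
    hsub (by decide), hsub (by decide)]

theorem simpleRootE₇_apply_simpleRootE₇_coε (i j : Fin 7) :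
    simpleRootE₇ (ε e δ) i (simpleRootE₇ (coε e δ) j) = CartanMatrix.E₇ i j := by
  have hpairing : ∀ i j, simpleRootE₇ (fun k => simpleRootE₇ (fun l =>
      (if k = l then 8 else 0) - 1) j) i = 8 * CartanMatrix.E₇ i j := by decide
  -- All pairings lie in `(1 / 8) ℤ`, so that the computation takes place in `ℤ`.
  let eval : Module.Dual ℂ (𝔡 e δ) →+ ℂ :=
    (LinearMap.applyₗ (simpleRootE₇ (coε e δ) j)).toAddMonoidHom
  let f : ℤ →+ ℂ := (AddMonoidHom.mulRight (1 / 8 : ℂ)).comp (Int.castAddHom ℂ)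
  have hf (k l : Fin 8) : ε e δ k (coε e δ l) = f ((if k = l then 8 else 0) - 1) := by
    rw [ε_coε]
    simp only [f, AddMonoidHom.comp_apply, AddMonoidHom.mulRight_apply, Int.coe_castAddHom]
    split_ifs <;> norm_num
  have hcoε (k : Fin 8) : eval (ε e δ k) =
      f (simpleRootE₇ (fun l => (if k = l then 8 else 0) - 1) j) := by
    rw [map_simpleRootE₇]
    simp only [← hf]
    exact map_simpleRootE₇ (ε e δ k).toAddMonoidHom (coε e δ) j
  calc simpleRootE₇ (ε e δ) i (simpleRootE₇ (coε e δ) j)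
      = simpleRootE₇ (fun k => eval (ε e δ k)) i := map_simpleRootE₇ eval (ε e δ) i
    _ = f (8 * CartanMatrix.E₇ i j) := by simp only [hcoε, ← map_simpleRootE₇, hpairing]
    _ = CartanMatrix.E₇ i j := by
      simp only [f, AddMonoidHom.comp_apply, AddMonoidHom.mulRight_apply, Int.coe_castAddHom]
      push_cast
      ring

theorem hasCartanMatrix_𝔡 [FiniteDimensional ℂ V] [LieAlgebra.IsSimple ℂ (𝔤 e δ)] (hδ : δ ≠ 0) :
    HasCartanMatrix (𝔡 e δ) CartanMatrix.E₇ := by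
  choose χ hroot hcoroot using exists_root_coroot_eq_simpleRootE₇ e δ hδ
  refine hasCartanMatrix_of_roots (χ := χ) (fun i j => ?_)
    (by rw [CartanMatrix.E₇_det]; norm_num) ?_
  · rw [hroot, hcoroot, simpleRootE₇_apply_simpleRootE₇_coε]
  · have hsimple (i : Fin 7) : simpleRootE₇ (ε e δ) i ∈
        AddSubmonoid.closure (Set.range ((rootSystem (𝔡 e δ)).root ∘ χ)) :=
      AddSubmonoid.subset_closure ⟨i, hroot i⟩
    rw [range_root_𝔡]
    rintro _ (⟨i, j, -, rfl⟩ | ⟨i, hi, rfl⟩)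
    · rw [neg_sub]
      exact (le_total i j).imp (sub_mem_of_forall_simpleRootE₇_mem (sum_ε e δ) hsimple)
        (sub_mem_of_forall_simpleRootE₇_mem (sum_ε e δ) hsimple)
    · exact sum_mem_or_neg_sum_mem_of_forall_simpleRootE₇_mem (sum_ε e δ) hsimple hi

end CartanMatrix

end FourVector

end

theorem mainTheorem1 {V : Type*} [AddCommGroup V] [Module ℂ V] [FiniteDimensional ℂ V]
    (e : Module.Basis (Fin 8) ℂ V) (δ : V [⋀^Fin 8]→ₗ[ℂ] ℂ) (hδ : δ ≠ 0) :
    -- the action of `L₀(V)` on `⋀⁴V` in components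
    (∀ (A : L₀ V) (T : ⋀[ℂ]^4 V) (i : Fin 4 → Fin 8),
      component e (action A T) i =
        ∑ a : Fin 4, ∑ s : Fin 8, LinearMap.toMatrix e e (A : Module.End ℂ V) (i a) s *
          component e T (Function.update i a s)) ∧
    -- `𝔤` is a Lie algebra, graded modulo 2
    ∃ _ : IsLieBracket e δ,
      Nonempty (GradedLieAlgebra (grading e δ)) ∧
      -- `𝔤` is simple of type `E₇`, `𝔡` is a Cartan subalgebra; roots and root spaces
      (∃ (_ : LieAlgebra.IsSimple ℂ (𝔤 e δ))
          (_ : (𝔡 e δ).IsCartanSubalgebra),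
        HasCartanMatrix (𝔡 e δ) CartanMatrix.E₇ ∧
        Set.range (LieAlgebra.IsKilling.rootSystem (𝔡 e δ)).root =
          {α | ∃ i j : Fin 8, i ≠ j ∧ α = ε e δ i - ε e δ j} ∪
          {α | ∃ i : Fin 4 → Fin 8, Function.Injective i ∧
            α = ∑ a : Fin 4, ε e δ (i a)} ∧
        (∀ (i j : Fin 8) (hij : i ≠ j),
          (∀ A : 𝔡 e δ,
            ⁅(A : 𝔤 e δ), inl e δ (matrixUnit e i j hij)⁆ =
              (ε e δ i - ε e δ j) A •
                inl e δ (matrixUnit e i j hij)) ∧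
          (LieAlgebra.rootSpace (𝔡 e δ)
              (ε e δ i - ε e δ j : 𝔡 e δ → ℂ)).toSubmodule =
            Submodule.span ℂ {inl e δ (matrixUnit e i j hij)}) ∧
        (∀ i : Fin 4 → Fin 8, Function.Injective i →
          (∀ A : 𝔡 e δ,
            ⁅(A : 𝔤 e δ), inr e δ (wedge e i)⁆ =
              (∑ a : Fin 4, ε e δ (i a)) A •
                inr e δ (wedge e i)) ∧
          (LieAlgebra.rootSpace (𝔡 e δ)
              (⇑(∑ a : Fin 4, ε e δ (i a)) : 𝔡 e δ → ℂ)).toSubmodule =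
            Submodule.span ℂ {inr e δ (wedge e i)})) ∧
      -- `𝔤₀ = L₀(V)` is simple of type `A₇` with the same Cartan subalgebra
      (∃ (_ : LieAlgebra.IsSimple ℂ (L₀ V))
          (_ : (diag e).IsCartanSubalgebra),
        HasCartanMatrix (diag e) (CartanMatrix.A 7) ∧
        Set.range (LieAlgebra.IsKilling.rootSystem (diag e)).root =
          {α | ∃ i j : Fin 8, i ≠ j ∧ α = ε₀ e i - ε₀ e j}) ∧
      -- for every connected Lie group `G` with Lie algebra `𝔤`, the orbits on `𝔤₁ = ⋀⁴V` of its
      -- connected subgroup `G₀` with Lie algebra `𝔤₀` are the orbits of `SL(V)`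
      ∀ (E : Type*) [NormedAddCommGroup E] [NormedSpace ℝ E] [FiniteDimensional ℝ E]
        (G : Type*) [TopologicalSpace G] [T2Space G] [ConnectedSpace G] [ChartedSpace E G]
        [Group G] [LieGroup 𝓘(ℝ, E) ∞ G]
        (φ : GroupLieAlgebra 𝓘(ℝ, E) G ≃ₗ[ℝ] 𝔤 e δ)
        (_ : ∀ x y, φ ⁅x, y⁆ = ⁅φ x, φ y⁆) (T : ⋀[ℂ]^4 V),
        {x | ∃ g ∈ connectedSubgroup (φ ⁻¹' Set.range (inl e δ)),
            φ (Ad g (φ.symm (inr e δ T))) = x} =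
          {x | ∃ a : SpecialLinearGroup ℂ V,
            inr e δ (exteriorPower.map 4 (a : V ≃ₗ[ℂ] V).toLinearMap T) = x} := by
  have := isLieBracket e δ
  have := isSimple_𝔤 e hδ
  have := isSimple_L₀ e
  refine ⟨fun A T i => component_action e A T i, isLieBracket e δ, nonempty_gradedLieAlgebra e δ,
    ⟨isSimple_𝔤 e hδ, isCartanSubalgebra_𝔡 e δ, hasCartanMatrix_𝔡 e δ hδ, range_root_𝔡 e δ,
      fun i j hij => ⟨lie_inl_matrixUnit e δ hij, ?_⟩, fun i hi => ⟨lie_inr_wedge e δ i, ?_⟩⟩,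
    ⟨isSimple_L₀ e, isCartanSubalgebra_diag e, hasCartanMatrix_diag e, range_root_diag e⟩,
    fun E _ _ _ G _ _ _ _ _ _ φ hφ T => orbit_eq hφ T⟩
  · exact rootSpace_eq_span (ε_sub_ne_zero e δ hij) (inl_ne_zero e δ (matrixUnit_ne_zero e hij))
      (lie_inl_matrixUnit e δ hij)
  · exact rootSpace_eq_span (sum_ε_ne_zero e δ hi) (inr_ne_zero e δ (wedge_ne_zero e hi))
      (lie_inr_wedge e δ i)
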